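/- Write $\log=\log_2$. For $g:\{0,1,2,\dots\}\to\{0,1,2,\dots\}$ let $$\Phi_g(n)=\max\Big\{\ell\log\tfrac{n}{4\ell}-\log g(\ell)\ :\ \ell\in\mathbb Z,\ 0\le \ell\le n/4\Big\},$$ where the first term is $0$ for $\ell=0$ and $\log 0$ is read as $0$. Call $g$ *optimizable* if, given $0\le k\le n$, a minimizer $t$ of $\binom nt\binom kt^{-1}g(k-t)$ over $0\le t\le k$ can be computed by a deterministic Turing machine in time polynomial in $n$. An *implicit set problem* $\mathcal P$ is a set of instances $(E,\mathcal F,B,\mathsf{oracle})$, where $E$ is a finite set (its elements are named by bit strings), $\mathcal F\subseteq 2^E$, $B\in\{0,1\}^*$ is the encoding, and $\mathsf{oracle}:2^E\times\mathbb N\to\{0,1\}$. Algorithms for $\mathcal P$ are multi-tape oracle Turing machines (randomized ones toss fair coins) that receive $B$ as input and have access to $\mathsf{oracle}$; running times are worst case over the coin tosses. $\mathcal P$ is *polynomial time computable* if $E$ can be computed, and $S\in\mathcal F$ can be decided for a given $S\subseteq E$, by deterministic machines in time $\mathrm{poly}(|B|)$. A set $S\subseteq E\setminus X$ is an *$\ell$-extension*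 of $X\subseteq E$ if $X\cup S\in\mathcal F$ and $|S|=\ell$. A *random extension algorithm of time $g$* for $\mathcal P$ is a randomized algorithm that, given additionally $X\subseteq E$ and $\ell\ge 0$, runs in time $g(\ell)\cdot\mathrm{poly}(|B|)$, always returns either an $\ell$-extension of $X$ or a special symbol $\perp$, and returns an $\ell$-extension of $X$ with probability at least $1/2$ if one exists. A *randomized algorithm for $\mathcal P$* answers "yes" with probability at least $1/2$ if $\mathcal F\neq\emptyset$, and "no" with probability $1$ if $\mathcal F=\emptyset$ (its answer is always "yes" or "no"). **Lemma.** (1) For every function $g$, $\Phi_g(n)=\omega(\log n)$, that is, $\Phi_g(n)/\log n\to\infty$ as $n\to\infty$. (2) For every optimizable function $g$ there is a function $f$ with $f(n)=\omega(\log n)$ (so that $2^{n-f(n)}=o(2^n/n^c)$ for every $c$: super-polynomially faster than brute force) such that every polynomial time computable implicit set problem $\mathcal P$ that has a random extension algorithm of time $g$ has a randomized algorithm that runs in time $2^{|E|-f(|E|)}\cdot\mathrm{poly}(|B|)$ on every instance $(E,\mathcal F,B,\mathsf{oracle})\in\mathcal P$. -/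

import Mathlib

open Filter Topology

noncomputable section

/-! ### Words -/

/-- The tape alphabet (the blank is added separately, as `none : Option TapeSym`):
the two bits, a terminator for the members of a list, and a separator for the parts of an input. -/
inductive TapeSym where
  | bit (b : Bool)
  | comma
  | semi

namespace TapeSym

/-- A bit string, as a word. -/
def ofBits (l : List Bool) : List TapeSym := l.map bit

/-- A number in unary. -/
def unary (n : ℕ) : List TapeSym := List.replicate n (bit true)

/-- A number in binary, least significant bit first. -/
def binary (n : ℕ) : List TapeSym := ofBits n.bits

/-- A finite set of bit strings: its members in increasing (lexicographic) order, each of them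
followed by a comma. -/
def ofSet (S : Finset (List Bool)) : List TapeSym :=
  (S.sort (· ≤ ·)).flatMap fun a => ofBits a ++ [comma]

/-- The special output that says that no set is returned. It is not of the form `ofSet S`. -/
def bot : List TapeSym := [semi]

/-- The output of a decision algorithm that accepts. -/
def yes : List TapeSym := [bit true]

/-- The output of a decision algorithm that rejects. -/
def no : List TapeSym := [bit false]

end TapeSym

/-! ### Randomized oracle Turing machines -/

/-- The tapes of a machine: one for the input, one for the output, one for the queries to the
oracle, and the work tapes. -/
inductive TapeName (W : Type) where
  | input
  | output
  | query
  | work (i : W)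

/-- What happens in a state: the machine has halted; or it puts a query to the oracle and continues
in one of two states, according to the answer; or it performs an ordinary step. -/
inductive StateKind (Q : Type) where
  | halt
  | ask (ifYes ifNo : Q)
  | run

/-- A randomized multi-tape oracle Turing machine, with two-way infinite tapes. In an ordinary step
the machine reads all its heads and tosses a fair coin; depending on the state, the symbols
read and the coin, it passes to a new state and on every tape it writes a symbol and then moves the
head by at most one cell. -/
structure OracleTM where
  State : Type
  finite_state : Finite State
  Work : Type
  finite_work : Finite Work
  start : State
  kind : State → StateKind State
  trans : State → (TapeName Work → Option TapeSym) → Bool →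
    State × (TapeName Work → Option TapeSym × Option Turing.Dir)

namespace OracleTM

/-- The tape that holds a word, starting at the position of the head, and nothing else. -/
def tapeOf (w : List TapeSym) : Turing.Tape (Option TapeSym) := Turing.Tape.mk₁ (w.map some)

/-- Write a symbol, then move the head (or leave it where it is). -/
def actOn (T : Turing.Tape (Option TapeSym)) (a : Option TapeSym × Option Turing.Dir) :
    Turing.Tape (Option TapeSym) :=
  match a.2 with
  | none => T.write a.1
  | some d => (T.write a.1).move d

variable (M : OracleTM)

/-- The machine is deterministic: it never makes use of the coin. -/
def Deterministic : Prop := ∀ q h, M.trans q h true = M.trans q h false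

/-- Configurations. -/
structure Cfg where
  state : M.State
  tape : TapeName M.Work → Turing.Tape (Option TapeSym)

/-- The initial configuration: the input is on the input tape, all other tapes are blank. -/
def init (w : List TapeSym) : M.Cfg where
  state := M.start
  tape := fun
    | .input => tapeOf w
    | _ => tapeOf []

/-- The machine has halted. -/
def Halted (c : M.Cfg) : Prop := M.kind c.state = .halt

/-- The word `w` stands on the output tape. -/
def Output (c : M.Cfg) (w : List TapeSym) : Prop := c.tape .output = tapeOf w

open Classical in
/-- The answer of the oracle `O` when `T` is the query tape: the oracle says yes if and only if
the word on `T` belongs to `O`. -/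
def answer (O : Set (List TapeSym)) (T : Turing.Tape (Option TapeSym)) : Bool :=
  decide (∃ w ∈ O, T = tapeOf w)

/-- The next configuration, given the oracle and the result of the coin toss. -/
def next (O : Set (List TapeSym)) (c : M.Cfg) (coin : Bool) : M.Cfg :=
  match M.kind c.state with
  | .halt => c
  | .ask p q => ⟨bif answer O (c.tape .query) then p else q, c.tape⟩
  | .run =>
    let r := M.trans c.state (fun i => (c.tape i).head) coin
    ⟨r.1, fun i => actOn (c.tape i) (r.2 i)⟩

/-- One step, as a random configuration; the coin is fair. -/
def step (O : Set (List TapeSym)) (c : M.Cfg) : PMF M.Cfg :=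
  (PMF.uniformOfFintype Bool).map (M.next O c)

/-- The random configuration after `n` steps. -/
def run (O : Set (List TapeSym)) : ℕ → M.Cfg → PMF M.Cfg
  | 0, c => PMF.pure c
  | n + 1, c => (M.step O c).bind (run O n)

/-- On the input `w`, with the oracle `O`, the machine halts after at most `T` steps, whatever the
coin tosses, and its output always satisfies `R`. -/
def Surely (O : Set (List TapeSym)) (w : List TapeSym) (T : ℕ) (R : List TapeSym → Prop) : Prop :=
  ∀ c ∈ (M.run O T (M.init w)).support, M.Halted c ∧ ∃ v, M.Output c v ∧ R v

/-- The probability that on the input `w`, with the oracle `O`, the machine halts after at most `T`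
steps with an output that satisfies `R`. -/
def prob (O : Set (List TapeSym)) (w : List TapeSym) (T : ℕ) (R : List TapeSym → Prop) : ENNReal :=
  (M.run O T (M.init w)).toOuterMeasure {c | M.Halted c ∧ ∃ v, M.Output c v ∧ R v}

end OracleTM

/-! ### Implicit set problems -/

/-- An instance of an implicit set problem: a finite ground set `E`, whose elements are named by
bit strings, a family `F` of subsets of `E`, an encoding `B`, and an oracle that maps a subset of `E`
and a natural number to a bit. -/
structure SetInstance where
  E : Finset (List Bool)
  F : Set (Finset (List Bool))
  subset_of_mem : ∀ S ∈ F, S ⊆ E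
  B : List Bool
  oracle : (S : Finset (List Bool)) → S ⊆ E → ℕ → Bool

namespace SetInstance

/-- The oracle as a set of words: the query `(S, j)` is the list of the elements of `S`, a separator,
and the number `j` in binary. Words that do not encode such a query are answered by no. -/
def oracleWords (I : SetInstance) : Set (List TapeSym) :=
  {w | ∃ (S : Finset (List Bool)) (hS : S ⊆ I.E) (j : ℕ),
    w = TapeSym.ofSet S ++ TapeSym.semi :: TapeSym.binary j ∧ I.oracle S hS j = true}

/-- `S` is an `ℓ`-extension of `X`. -/
def IsExtension (I : SetInstance) (X : Finset (List Bool)) (ℓ : ℕ) (S : Finset (List Bool)) : Prop :=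
  S ⊆ I.E \ X ∧ X ∪ S ∈ I.F ∧ S.card = ℓ

end SetInstance

/-- An implicit set problem is a set of instances. -/
abbrev ImplicitSetProblem : Type := Set SetInstance

namespace ImplicitSetProblem

/-- The ground set can be computed, and membership in the family can be decided, by
(deterministic) oracle machines in time polynomial in the length of the encoding. -/
def PolyTimeComputable (P : ImplicitSetProblem) : Prop :=
  (∃ (M : OracleTM) (p : Polynomial ℕ), M.Deterministic ∧ ∀ I ∈ P,
    M.Surely I.oracleWords (TapeSym.ofBits I.B) (p.eval I.B.length) (fun v => v = TapeSym.ofSet I.E)) ∧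
  (∃ (M : OracleTM) (p : Polynomial ℕ), M.Deterministic ∧ ∀ I ∈ P, ∀ S ⊆ I.E,
    M.Surely I.oracleWords (TapeSym.ofBits I.B ++ TapeSym.semi :: TapeSym.ofSet S) (p.eval I.B.length)
      (fun v => (S ∈ I.F ∧ v = TapeSym.yes) ∨ (S ∉ I.F ∧ v = TapeSym.no)))

/-- `M` is a random extension algorithm for `P` of time `g`: on the encoding of an instance, a subset
`X` of the ground set and a number `ℓ` (in unary) it runs in time `g ℓ * poly(|B|)`; whatever it
returns is an `ℓ`-extension of `X` or the special symbol; and it returns an `ℓ`-extension with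
probability at least `1/2` if there is one. -/
def IsExtensionAlgorithm (P : ImplicitSetProblem) (g : ℕ → ℕ) (M : OracleTM) : Prop :=
  ∃ p : Polynomial ℕ, ∀ I ∈ P, ∀ X ⊆ I.E, ∀ ℓ : ℕ,
    let w := TapeSym.ofBits I.B ++ TapeSym.semi :: TapeSym.ofSet X ++ TapeSym.semi :: TapeSym.unary ℓ
    let T := g ℓ * p.eval I.B.length
    M.Surely I.oracleWords w T
      (fun v => v = TapeSym.bot ∨ ∃ S, I.IsExtension X ℓ S ∧ v = TapeSym.ofSet S) ∧
    ((∃ S, I.IsExtension X ℓ S) →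
      1 / 2 ≤ M.prob I.oracleWords w T (fun v => ∃ S, I.IsExtension X ℓ S ∧ v = TapeSym.ofSet S))

/-- `M` is a randomized algorithm for `P` whose running time on every instance `I` is at most
`time I`, whatever the coin tosses: it answers yes with probability at least `1/2` if the family is
non-empty, and no with certainty if the family is empty. -/
def IsRandomizedAlgorithm (P : ImplicitSetProblem) (time : SetInstance → ℝ) (M : OracleTM) : Prop :=
  ∀ I ∈ P, ∃ T : ℕ, (T : ℝ) ≤ time I ∧
    M.Surely I.oracleWords (TapeSym.ofBits I.B) T (fun v => v = TapeSym.yes ∨ v = TapeSym.no) ∧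
    (I.F.Nonempty → 1 / 2 ≤ M.prob I.oracleWords (TapeSym.ofBits I.B) T (fun v => v = TapeSym.yes)) ∧
    (I.F = ∅ → M.Surely I.oracleWords (TapeSym.ofBits I.B) T (fun v => v = TapeSym.no))

end ImplicitSetProblem

/-! ### Optimizable functions and the function `Φ_g` -/

/-- `t` minimizes `(n choose t) / (k choose t) * g (k - t)` over `0 ≤ t ≤ k`. -/
def IsArgmin (g : ℕ → ℕ) (n k t : ℕ) : Prop :=
  t ≤ k ∧ ∀ s ≤ k, (n.choose t : ℚ) / (k.choose t : ℚ) * (g (k - t) : ℚ) ≤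
    (n.choose s : ℚ) / (k.choose s : ℚ) * (g (k - s) : ℚ)

/-- A minimizer can be computed from `n` and `k ≤ n` by a deterministic machine (without an oracle)
in time polynomial in `n`. -/
def Optimizable (g : ℕ → ℕ) : Prop :=
  ∃ (M : OracleTM) (p : Polynomial ℕ), M.Deterministic ∧ ∀ n k : ℕ, k ≤ n →
    M.Surely ∅ (TapeSym.unary n ++ TapeSym.semi :: TapeSym.unary k) (p.eval n)
      (fun v => ∃ t, IsArgmin g n k t ∧ v = TapeSym.unary t)

/-- `Φ_g(n)`, the maximum of `ℓ * log (n / (4 * ℓ)) - log (g ℓ)` over the natural numbers `ℓ ≤ n / 4`.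
(`n / 4` in the range is the floor; the first term is `0` for `ℓ = 0`.) -/
def Phi (g : ℕ → ℕ) (n : ℕ) : ℝ :=
  (Finset.range (n / 4 + 1)).sup' Finset.nonempty_range_add_one fun ℓ =>
    (ℓ : ℝ) * Real.logb 2 ((n : ℝ) / (4 * (ℓ : ℝ))) - Real.logb 2 (g ℓ : ℝ)

/-- `f(n) = ω(log n)`. -/
def IsOmegaLog (f : ℕ → ℝ) : Prop :=
  Tendsto (fun n : ℕ => f n / Real.logb 2 (n : ℝ)) atTop atTop

end

noncomputable section

/-! ### Tapes as stacks -/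

namespace Turing

variable {Γ : Type*} [Inhabited Γ]

/-! For (1), a single fixed ℓ = K in the maximum already gives Φ_g(n) ≥ K log n − O_K(1), and K is
arbitrary (`isOmegaLog_Phi`).

For (2), let n = |E|, let b be the binary length of n and k that of b, so that k is about log log n.
The optimizer, applied to n and k, returns t; put ℓ = k − t. A trial tosses a coin. Either it draws
X ⊆ E uniformly and asks for an ℓ-extension, or it puts each element into X with probability 1/4 and
asks for a 0-extension, which is a test of X ∈ F. Fix S ∈ F. If |S| ≥ n/4 and n is not small, then
each of the C(|S|, ℓ) ≥ 2^(ℓ·gain) sets S \ D with |D| = ℓ is good for the uniform sampler, where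
gain = b − k − 3 (truncated). Otherwise the biased sampler draws S itself with probability
3^(n−|S|)/4^n, which is at least 2^(−7n/8) if |S| ≤ n/4; this is plenty, because ℓ·gain is only of
order log n · log log n. Hence 2^(n + O(1) − ℓ·gain) trials succeed with probability at least 1/2
(`one_le_mul_trialChance`, `half_le_amplified`).

Up to a polynomial factor the time is 2^(n − ℓ·gain) · (g ℓ + g 0 + 1). Minimality of t compares ℓ
with any fixed ℓ₀ ≤ k: as C(n, j) agrees with n^j up to a factor k^k for j ≤ k, it yields g(ℓ)
n^(−ℓ) ≤ 2^O(k²) g(ℓ₀) n^(−ℓ₀) (`IsBestSize.mul_pow_le`). The value of k is so small that all these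
losses together are at most one factor n (`two_pow_sizeBound_le`). Thus the work is O(2^n n^(1 −
ℓ₀)) for every fixed ℓ₀, and the exponent saved, `savings`, is ω(log n) (`isOmegaLog_savings`). If g
has a zero, a problem with an extension algorithm of time g has no instances at all
(`one_le_of_isExtensionAlgorithm`).

The remaining work is to realize this on Turing machines. `Reaches` is a Hoare triple with a time
bound and a lower bound for an expectation; such bounds compose backwards, so that the success
probability is computed along the program. Tapes are used as stacks. A given machine that is called
as a subroutine may leave its tapes in disorder; clock tapes that count its steps bound the region
to be erased afterwards (`onStacks_subroutine`). -/

theorem ListBlank.cons_default_mk_nil :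
    (ListBlank.mk ([] : List Γ)).cons default = ListBlank.mk [] := by
  rw [ListBlank.cons_mk]
  apply ListBlank.ext
  intro i
  cases i <;> simp [ListBlank.nth_mk]

theorem Tape.ext_nth {T T' : Tape Γ} (h : ∀ i, T.nth i = T'.nth i) : T = T' := by
  have h0 : T.head = T'.head := h 0
  have hr : T.right = T'.right := ListBlank.ext fun i => h (i + 1 : ℕ)
  have hl : T.left = T'.left := ListBlank.ext fun i => by
    have := h (Int.negSucc i)
    simpa [Tape.nth] using this
  cases T; cases T'; simp_all

end Turing

namespace OracleTM

open Turing

theorem tapeOf_eq_mk' (w : List TapeSym) :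
    tapeOf w = Tape.mk' (ListBlank.mk []) (ListBlank.mk (w.map some)) := rfl

@[simp] theorem head_tapeOf (w : List TapeSym) : (tapeOf w).head = w.head? := by
  cases w <;> rfl

theorem nth_tapeOf (w : List TapeSym) (i : ℕ) : (tapeOf w).nth i = w[i]? := by
  rw [tapeOf_eq_mk', Tape.mk'_nth_nat, ListBlank.nth_mk]
  simp only [List.getI_eq_getElem?_getD, List.getElem?_map]
  cases w[i]? <;> rfl

theorem nth_tapeOf_neg (w : List TapeSym) {i : ℤ} (hi : i < 0) : (tapeOf w).nth i = none := by
  obtain ⟨n, rfl⟩ := Int.eq_negSucc_of_lt_zero hi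
  cases n <;> rfl

theorem tapeOf_injective : Function.Injective tapeOf := by
  intro v w h
  apply List.ext_getElem?
  intro i
  rw [← nth_tapeOf, ← nth_tapeOf, h]

/-- A stack has its top under the head, and only blanks to the left of the head. -/
theorem push_tapeOf (w : List TapeSym) (a : TapeSym) :
    ((tapeOf w).move .left).write (some a) = tapeOf (a :: w) := by
  simp only [tapeOf_eq_mk', Tape.move_left_mk', Tape.write_mk', List.map_cons]
  rfl

/-- The top has to be erased before the head moves on, since a stack must have blanks on its left.
On the empty stack the operation has no effect. -/
theorem pop_tapeOf (w : List TapeSym) :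
    ((tapeOf w).write none).move .right = tapeOf w.tail := by
  cases w with
  | nil =>
    apply Tape.ext_nth
    intro i
    rw [Tape.move_right_nth, Tape.write_nth]
    rcases lt_trichotomy i (-1) with h | h | h
    · rw [if_neg (by omega), nth_tapeOf_neg _ (by omega), nth_tapeOf_neg _ (by omega)]
    · rw [if_pos (by omega), nth_tapeOf_neg _ (by omega)]
    · obtain ⟨n, rfl⟩ : ∃ n : ℕ, i = n := ⟨i.toNat, by omega⟩
      rw [if_neg (by omega), ← Nat.cast_succ, nth_tapeOf, List.tail_nil, nth_tapeOf]
      simp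
  | cons a w =>
    simp only [tapeOf_eq_mk', List.map_cons, ← ListBlank.cons_mk, Tape.write_mk',
      Tape.move_right_mk', ListBlank.head_cons, ListBlank.tail_cons, List.tail_cons]
    congr 1
    exact ListBlank.cons_default_mk_nil

/-- This is for the clocks: with the head parked on the blank to the left of the word, a single
ordinary step, which writes before it moves, pushes a mark and parks the head again. -/
theorem write_move_left_tapeOf (w : List TapeSym) (a : TapeSym) :
    (((tapeOf w).move .left).write (some a)).move .left = (tapeOf (a :: w)).move .left := by
  rw [push_tapeOf]

theorem actOn_stay (T : Tape (Option TapeSym)) : actOn T (T.head, none) = T := by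
  simp [actOn, Tape.write_self]

/-! ### Random computations with a bounded number of steps -/

variable (M : OracleTM) (O : Set (List TapeSym))

/-- Starting from `c`, the machine can be stopped after at most `T` steps, at a time that depends on
the computation so far, such that the configuration then always satisfies `Q` and the expectation
of `φ` is at least `r`. -/
inductive Reaches (Q : M.Cfg → Prop) (φ : M.Cfg → ENNReal) : ℕ → M.Cfg → ENNReal → Prop
  | done {T : ℕ} {c : M.Cfg} {r : ENNReal} : Q c → r ≤ φ c → Reaches Q φ T c r
  | step {T : ℕ} {c : M.Cfg} {r r₁ r₂ : ENNReal} : ¬ M.Halted c →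
      Reaches Q φ T (M.next O c true) r₁ → Reaches Q φ T (M.next O c false) r₂ →
      r ≤ (r₁ + r₂) / 2 → Reaches Q φ (T + 1) c r

variable {M O}

theorem half_add_self (r : ENNReal) : (r + r) / 2 = r := by
  rw [ENNReal.add_div, ENNReal.add_halves]

theorem Reaches.mono {Q Q' : M.Cfg → Prop} {φ φ' : M.Cfg → ENNReal} {T T' : ℕ} {c : M.Cfg}
    {r r' : ENNReal} (h : M.Reaches O Q φ T c r) (hT : T ≤ T') (hr : r' ≤ r)
    (hQ : ∀ c, Q c → Q' c) (hφ : ∀ c, Q c → φ c ≤ φ' c) : M.Reaches O Q' φ' T' c r' := by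
  induction h generalizing T' r' with
  | done hq h => exact .done (hQ _ hq) ((hr.trans h).trans (hφ _ hq))
  | step hh _ _ h ih₁ ih₂ =>
    obtain ⟨T', rfl⟩ : ∃ S, T' = S + 1 := ⟨T' - 1, by omega⟩
    exact .step hh (ih₁ (by omega) le_rfl) (ih₂ (by omega) le_rfl) (hr.trans h)

/-- The value φ of the intermediate configuration is the bound required of the rest of the
computation, as for weakest preconditions. -/
theorem Reaches.trans {Q Q' : M.Cfg → Prop} {φ φ' : M.Cfg → ENNReal} {T T' : ℕ} {c : M.Cfg}
    {r : ENNReal} (h : M.Reaches O Q φ T c r)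
    (h' : ∀ c, Q c → M.Reaches O Q' φ' T' c (φ c)) : M.Reaches O Q' φ' (T + T') c r := by
  induction h with
  | done hq h => exact (h' _ hq).mono (by omega) h (fun _ => id) fun _ _ => le_rfl
  | step hh _ _ h ih₁ ih₂ => exact Nat.succ_add _ _ ▸ .step hh ih₁ ih₂ h

theorem Reaches.step_det {Q : M.Cfg → Prop} {φ : M.Cfg → ENNReal} {T : ℕ} {c c' : M.Cfg}
    {r : ENNReal} (hc : ¬ M.Halted c) (hn : ∀ b, M.next O c b = c')
    (h : M.Reaches O Q φ T c' r) : M.Reaches O Q φ (T + 1) c r :=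
  .step hc ((hn true).symm ▸ h) ((hn false).symm ▸ h) (half_add_self r).ge

/-- The simulation only has to respect steps from configurations that have not halted. The image of
a halted configuration may go on, which is what sequencing and loops need. -/
theorem Reaches.map {M' : OracleTM} (f : M.Cfg → M'.Cfg)
    (hf : ∀ c, ¬ M.Halted c → ¬ M'.Halted (f c) ∧ ∀ b, M'.next O (f c) b = f (M.next O c b))
    {Q : M.Cfg → Prop} {Q' : M'.Cfg → Prop} {φ : M.Cfg → ENNReal} {φ' : M'.Cfg → ENNReal}
    {T : ℕ} {c : M.Cfg} {r : ENNReal} (h : M.Reaches O Q φ T c r)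
    (hQ : ∀ c, Q c → Q' (f c)) (hφ : ∀ c, Q c → φ c ≤ φ' (f c)) :
    M'.Reaches O Q' φ' T (f c) r := by
  induction h with
  | done hq h => exact .done (hQ _ hq) (h.trans (hφ _ hq))
  | step hh _ _ h ih₁ ih₂ =>
    refine .step (hf _ hh).1 ?_ ?_ h
    · rw [(hf _ hh).2]; exact ih₁
    · rw [(hf _ hh).2]; exact ih₂

/-- The expectation of `φ` under a random configuration. -/
def expect {α : Type*} (μ : PMF α) (φ : α → ENNReal) : ENNReal := ∑' a, μ a * φ a

theorem expect_pure {α : Type*} (a : α) (φ : α → ENNReal) : expect (PMF.pure a) φ = φ a := by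
  rw [expect, tsum_eq_single a]
  · simp
  · intro b hb
    simp [PMF.pure_apply, hb]

theorem expect_bind {α β : Type*} (μ : PMF α) (ν : α → PMF β) (φ : β → ENNReal) :
    expect (μ.bind ν) φ = expect μ fun a => expect (ν a) φ := by
  simp only [expect, PMF.bind_apply, ← ENNReal.tsum_mul_right, ← ENNReal.tsum_mul_left]
  rw [ENNReal.tsum_comm]
  simp only [mul_assoc]

theorem step_eq (c : M.Cfg) :
    M.step O c = (PMF.uniformOfFintype Bool).bind fun b => PMF.pure (M.next O c b) := rfl

theorem expect_run_succ (n : ℕ) (c : M.Cfg) (φ : M.Cfg → ENNReal) :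
    expect (M.run O (n + 1) c) φ =
      (expect (M.run O n (M.next O c true)) φ + expect (M.run O n (M.next O c false)) φ) / 2 := by
  rw [run, expect_bind, step_eq, expect_bind, expect]
  simp only [expect_pure, tsum_bool, PMF.uniformOfFintype_apply, Fintype.card_bool, Nat.cast_ofNat]
  rw [← mul_add, add_comm, ENNReal.div_eq_inv_mul]

theorem mem_support_run_succ (n : ℕ) (c c' : M.Cfg) :
    c' ∈ (M.run O (n + 1) c).support ↔ ∃ b, c' ∈ (M.run O n (M.next O c b)).support := by
  rw [run, PMF.mem_support_bind_iff]
  simp [step_eq]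

theorem next_of_halted {c : M.Cfg} (hc : M.Halted c) (b : Bool) : M.next O c b = c := by
  unfold Halted at hc
  simp [next, hc]

theorem run_of_halted {c : M.Cfg} (hc : M.Halted c) (n : ℕ) : M.run O n c = PMF.pure c := by
  induction n with
  | zero => rfl
  | succ n ih =>
    rw [run, step_eq, PMF.bind_bind]
    simp [next_of_halted hc, ih]

/-- Stopping only in halted configurations yields statements about `run`. -/
theorem Reaches.run {Q : M.Cfg → Prop} {φ : M.Cfg → ENNReal} {T : ℕ} {c : M.Cfg} {r : ENNReal}
    (h : M.Reaches O (fun c => M.Halted c ∧ Q c) φ T c r) :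
    (∀ c' ∈ (M.run O T c).support, M.Halted c' ∧ Q c') ∧ r ≤ expect (M.run O T c) φ := by
  induction h with
  | done hq h =>
    rw [run_of_halted hq.1, expect_pure]
    refine ⟨fun c' hc' => ?_, h⟩
    rw [PMF.mem_support_pure_iff] at hc'
    exact hc' ▸ hq
  | step hh _ _ h ih₁ ih₂ =>
    refine ⟨fun c' hc' => ?_, ?_⟩
    · obtain ⟨_ | _, hb⟩ := (mem_support_run_succ _ _ _).1 hc'
      · exact ih₂.1 _ hb
      · exact ih₁.1 _ hb
    · rw [expect_run_succ]
      exact h.trans (ENNReal.div_le_div_right (add_le_add ih₁.2 ih₂.2) _)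

theorem prob_eq_expect (w : List TapeSym) (T : ℕ) (R : List TapeSym → Prop) :
    M.prob O w T R = expect (M.run O T (M.init w))
      (Set.indicator {c | M.Halted c ∧ ∃ v, M.Output c v ∧ R v} 1) := by
  rw [prob, PMF.toOuterMeasure_apply, expect]
  refine tsum_congr fun c => ?_
  by_cases hc : c ∈ {c | M.Halted c ∧ ∃ v, M.Output c v ∧ R v} <;> simp [hc]

theorem le_expect_of_support {α : Type*} {μ : PMF α} {φ ψ : α → ENNReal}
    (h : ∀ a ∈ μ.support, φ a ≤ ψ a) : expect μ φ ≤ expect μ ψ := by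
  refine ENNReal.tsum_le_tsum fun a => ?_
  by_cases ha : a ∈ μ.support
  · exact mul_le_mul_right (h a ha) _
  · rw [PMF.mem_support_iff, not_not] at ha
    simp [ha]

theorem expect_add_mul {α : Type*} (μ : PMF α) (ρ σ : ENNReal) (φ : α → ENNReal) :
    expect μ (fun a => ρ + σ * φ a) = ρ + σ * expect μ φ := by
  simp only [expect, mul_add]
  rw [ENNReal.tsum_add, ENNReal.tsum_mul_right, PMF.tsum_coe, one_mul, ← ENNReal.tsum_mul_left]
  congr 1
  exact tsum_congr fun a => by ring

end OracleTM

end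

noncomputable section

/-! ### Programs -/

/-- The symbols under the heads. -/
abbrev Heads (W : Type) : Type := TapeName W → Option TapeSym

/-- The contents of all tapes. -/
abbrev Tapes (W : Type) : Type := TapeName W → Turing.Tape (Option TapeSym)

/-- What is done on each tape in an ordinary step. -/
abbrev TapeAction (W : Type) : Type := TapeName W → Option TapeSym × Option Turing.Dir

/-- Nothing is written and no head moves. -/
def stay {W : Type} (h : Heads W) : TapeAction W := fun i => (h i, none)

/-- An oracle machine without its work tapes, so that machines on the same tapes can be combined. -/
structure Prog (W : Type) where
  State : Type
  finite_state : Finite State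
  start : State
  kind : State → StateKind State
  trans : State → Heads W → Bool → State × TapeAction W

/-- Rename states. -/
def StateKind.map {Q Q' : Type} (f : Q → Q') : StateKind Q → StateKind Q'
  | .halt => .halt
  | .ask p q => .ask (f p) (f q)
  | .run => .run

/-- Let the machine continue when it has halted. -/
def StateKind.resume {Q : Type} : StateKind Q → StateKind Q
  | .halt => .run
  | k => k

namespace Prog

open OracleTM Turing

variable {W : Type} [Finite W]

/-- The machine of a program. -/
abbrev toTM (P : Prog W) : OracleTM where
  State := P.State
  finite_state := P.finite_state
  Work := W
  finite_work := inferInstance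
  start := P.start
  kind := P.kind
  trans := P.trans

/-- Started on the tapes `τ`, the program halts after at most `T` steps with tapes that satisfy `Q`,
and the expectation of `φ` is then at least `r`. -/
def Does (P : Prog W) (O : Set (List TapeSym)) (T : ℕ) (τ : Tapes W) (Q : Tapes W → Prop)
    (φ : Tapes W → ENNReal) (r : ENNReal) : Prop :=
  P.toTM.Reaches O (fun c => P.toTM.Halted c ∧ Q c.tape) (fun c => φ c.tape) T ⟨P.start, τ⟩ r

/-- One step without a coin toss. -/
def act (a : Heads W → TapeAction W) : Prog W where
  State := Bool
  finite_state := inferInstance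
  start := false
  kind q := if q then .halt else .run
  trans _ h _ := (true, a h)

/-- One program after the other. -/
def seq (P₁ P₂ : Prog W) : Prog W where
  State := P₁.State ⊕ P₂.State
  finite_state := have := P₁.finite_state; have := P₂.finite_state; inferInstance
  start := .inl P₁.start
  kind
    | .inl q => ((P₁.kind q).map Sum.inl).resume
    | .inr q => (P₂.kind q).map Sum.inr
  trans
    | .inl q, h, b => match P₁.kind q with
      | .halt => (.inr P₂.start, stay h)
      | _ => ((P₁.trans q h b).1 |> Sum.inl, (P₁.trans q h b).2)
    | .inr q, h, b => ((P₂.trans q h b).1 |> Sum.inr, (P₂.trans q h b).2)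

infixr:60 " ;; " => Prog.seq

/-- One of two programs, depending on the symbols under the heads and a coin toss. -/
def branch (sel : Heads W → Bool → Bool) (P₁ P₂ : Prog W) : Prog W where
  State := Option (P₁.State ⊕ P₂.State)
  finite_state := have := P₁.finite_state; have := P₂.finite_state; inferInstance
  start := none
  kind
    | none => .run
    | some (.inl q) => (P₁.kind q).map (some ∘ Sum.inl)
    | some (.inr q) => (P₂.kind q).map (some ∘ Sum.inr)
  trans
    | none, h, b => (some (bif sel h b then .inl P₁.start else .inr P₂.start), stay h)
    | some (.inl q), h, b => (some (.inl (P₁.trans q h b).1), (P₁.trans q h b).2)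
    | some (.inr q), h, b => (some (.inr (P₂.trans q h b).1), (P₂.trans q h b).2)

/-- Repeat a program as long as a condition on the symbols under the heads is satisfied. -/
def loop (cond : Heads W → Bool) (P : Prog W) : Prog W where
  State := Option (Option P.State)
  finite_state := have := P.finite_state; inferInstance
  start := some none
  kind
    | none => .halt
    | some none => .run
    | some (some q) => ((P.kind q).map (some ∘ some)).resume
  trans
    | none, h, _ => (none, stay h)
    | some none, h, _ => (bif cond h then some (some P.start) else none, stay h)
    | some (some q), h, b => match P.kind q with
      | .halt => (some none, stay h)
      | _ => (some (some (P.trans q h b).1), (P.trans q h b).2)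

variable {O : Set (List TapeSym)} {P P₁ P₂ : Prog W} {T T' T₁ T₂ : ℕ} {τ τ' : Tapes W}
  {Q Q' : Tapes W → Prop} {φ φ' : Tapes W → ENNReal} {r r' r₁ r₂ : ENNReal}

theorem Does.mono (h : P.Does O T τ Q φ r) (hT : T ≤ T') (hr : r' ≤ r)
    (hQ : ∀ τ, Q τ → Q' τ) (hφ : ∀ τ, Q τ → φ τ ≤ φ' τ) : P.Does O T' τ Q' φ' r' :=
  Reaches.mono h hT hr (fun _ hc => ⟨hc.1, hQ _ hc.2⟩) fun _ hc => hφ _ hc.2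

theorem actOn_stay_heads {V : Type} (τ : Tapes V) :
    (fun i => actOn (τ i) (stay (fun j => (τ j).head) i)) = τ :=
  funext fun _ => actOn_stay _

theorem does_act {a : Heads W → TapeAction W}
    (hQ : Q fun i => actOn (τ i) (a (fun j => (τ j).head) i))
    (hr : r ≤ φ fun i => actOn (τ i) (a (fun j => (τ j).head) i)) :
    (act a).Does O 1 τ Q φ r :=
  .step_det (c' := ⟨true, fun i => actOn (τ i) (a (fun j => (τ j).head) i)⟩)
    (by simp [Halted, act]) (fun _ => rfl) (.done ⟨by simp [Halted, act], hQ⟩ hr)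

/-- The additional step leads from a halting state of `P₁` to the start of `P₂`. -/
theorem Does.seq (h₁ : P₁.Does O T₁ τ Q φ r)
    (h₂ : ∀ τ, Q τ → P₂.Does O T₂ τ Q' φ' (φ τ)) :
    (P₁.seq P₂).Does O (T₁ + T₂ + 1) τ Q' φ' r := by
  have h := Reaches.map (M := P₁.toTM) (M' := (P₁.seq P₂).toTM)
    (Q' := fun c => ∃ q τ, c = ⟨.inl q, τ⟩ ∧ P₁.kind q = .halt ∧ Q τ) (φ' := fun c => φ c.tape)
    (fun c => ⟨Sum.inl c.state, c.tape⟩) ?_ h₁ ?_ fun _ _ => le_rfl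
  · rw [add_assoc]
    refine h.trans ?_
    rintro _ ⟨q, τ, rfl, hq, hτ⟩
    refine .step_det (M := (P₁.seq P₂).toTM)
      (c' := ⟨(Sum.inr P₂.start : P₁.State ⊕ P₂.State), τ⟩) ?_ ?_ ?_
    · simp [Halted, Prog.seq, hq, StateKind.map, StateKind.resume]
    · intro b
      simp only [next, Prog.seq, hq, StateKind.map, StateKind.resume, actOn_stay_heads]
    · refine Reaches.map (M := P₂.toTM) (M' := (P₁.seq P₂).toTM) (φ' := fun c => φ' c.tape)
        (fun c => ⟨Sum.inr c.state, c.tape⟩) ?_ (h₂ τ hτ) ?_ fun _ _ => le_rfl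
      · rintro ⟨q, τ⟩ hc
        simp only [Halted] at hc
        cases hk : P₂.kind q with
        | halt => exact absurd hk hc
        | ask p p' =>
          refine ⟨by simp [Halted, Prog.seq, hk, StateKind.map], fun b => ?_⟩
          simp only [next, Prog.seq, hk, StateKind.map]
          cases answer O (τ .query) <;> rfl
        | run =>
          refine ⟨by simp [Halted, Prog.seq, hk, StateKind.map], fun b => ?_⟩
          simp only [next, Prog.seq, hk, StateKind.map]
      · rintro ⟨q, τ⟩ ⟨hc, hQ⟩
        refine ⟨?_, hQ⟩
        simp only [Halted] at hc
        simp [Halted, Prog.seq, hc, StateKind.map]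
  · rintro ⟨q, τ⟩ hc
    simp only [Halted] at hc
    cases hk : P₁.kind q with
    | halt => exact absurd hk hc
    | ask p p' =>
      refine ⟨by simp [Halted, Prog.seq, hk, StateKind.map, StateKind.resume], fun b => ?_⟩
      simp only [next, Prog.seq, hk, StateKind.map, StateKind.resume]
      cases answer O (τ .query) <;> rfl
    | run =>
      refine ⟨by simp [Halted, Prog.seq, hk, StateKind.map, StateKind.resume], fun b => ?_⟩
      simp only [next, Prog.seq, hk, StateKind.map, StateKind.resume]
  · rintro ⟨q, τ⟩ ⟨hc, hQ⟩
    exact ⟨q, τ, rfl, hc, hQ⟩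

theorem reaches_branch_left {sel : Heads W → Bool → Bool} (h₁ : P₁.Does O T τ Q φ r) :
    (branch sel P₁ P₂).toTM.Reaches O
      (fun c => (branch sel P₁ P₂).toTM.Halted c ∧ Q c.tape) (fun c => φ c.tape) T
      ⟨some (.inl P₁.start), τ⟩ r := by
  refine Reaches.map (M := P₁.toTM) (M' := (branch sel P₁ P₂).toTM)
    (fun c => ⟨some (Sum.inl c.state), c.tape⟩) ?_ h₁ ?_ fun _ _ => le_rfl
  · rintro ⟨q, τ⟩ hc
    simp only [Halted] at hc
    cases hk : P₁.kind q with
    | halt => exact absurd hk hc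
    | ask p p' =>
      refine ⟨by simp [Halted, branch, hk, StateKind.map], fun b => ?_⟩
      simp only [next, branch, hk, StateKind.map]
      cases answer O (τ .query) <;> rfl
    | run =>
      refine ⟨by simp [Halted, branch, hk, StateKind.map], fun b => ?_⟩
      simp only [next, branch, hk, StateKind.map]
  · rintro ⟨q, τ⟩ ⟨hc, hQ⟩
    refine ⟨?_, hQ⟩
    simp only [Halted] at hc
    simp [Halted, branch, hc, StateKind.map]

theorem reaches_branch_right {sel : Heads W → Bool → Bool} (h₂ : P₂.Does O T τ Q φ r) :
    (branch sel P₁ P₂).toTM.Reaches O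
      (fun c => (branch sel P₁ P₂).toTM.Halted c ∧ Q c.tape) (fun c => φ c.tape) T
      ⟨some (.inr P₂.start), τ⟩ r := by
  refine Reaches.map (M := P₂.toTM) (M' := (branch sel P₁ P₂).toTM)
    (fun c => ⟨some (Sum.inr c.state), c.tape⟩) ?_ h₂ ?_ fun _ _ => le_rfl
  · rintro ⟨q, τ⟩ hc
    simp only [Halted] at hc
    cases hk : P₂.kind q with
    | halt => exact absurd hk hc
    | ask p p' =>
      refine ⟨by simp [Halted, branch, hk, StateKind.map], fun b => ?_⟩
      simp only [next, branch, hk, StateKind.map]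
      cases answer O (τ .query) <;> rfl
    | run =>
      refine ⟨by simp [Halted, branch, hk, StateKind.map], fun b => ?_⟩
      simp only [next, branch, hk, StateKind.map]
  · rintro ⟨q, τ⟩ ⟨hc, hQ⟩
    refine ⟨?_, hQ⟩
    simp only [Halted] at hc
    simp [Halted, branch, hc, StateKind.map]

/-- The values `r₁` and `r₂` belong to the two results of the toss and not to the two programs. A
selection that ignores the coin is the case `r₁ = r₂`. -/
theorem Does.branch {sel : Heads W → Bool → Bool}
    (h : ∀ b, bif sel (fun j => (τ j).head) b
      then P₁.Does O T τ Q φ (bif b then r₁ else r₂)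
      else P₂.Does O T τ Q φ (bif b then r₁ else r₂)) :
    (branch sel P₁ P₂).Does O (T + 1) τ Q φ ((r₁ + r₂) / 2) := by
  have key : ∀ b, (Prog.branch sel P₁ P₂).toTM.Reaches O
      (fun c => (Prog.branch sel P₁ P₂).toTM.Halted c ∧ Q c.tape) (fun c => φ c.tape) T
      ((Prog.branch sel P₁ P₂).toTM.next O ⟨none, τ⟩ b) (bif b then r₁ else r₂) := by
    intro b
    have hb := h b
    simp only [next, Prog.branch, actOn_stay_heads]
    cases hs : sel (fun j => (τ j).head) b
    · rw [hs] at hb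
      exact reaches_branch_right hb
    · rw [hs] at hb
      exact reaches_branch_left hb
  exact .step (by simp [Halted, Prog.branch]) (key true) (key false) le_rfl

theorem Does.loop_stop {cond : Heads W → Bool} (hc : cond (fun j => (τ j).head) = false)
    (hQ : Q τ) (hr : r ≤ φ τ) : (loop cond P).Does O 1 τ Q φ r := by
  refine .step_det (c' := ⟨none, τ⟩) ?_ (fun b => ?_) (.done ⟨?_, hQ⟩ hr)
  · simp [Halted, loop]
  · simp only [next, loop, hc, actOn_stay_heads]
    rfl
  · simp [Halted, loop]

theorem Does.loop_step {cond : Heads W → Bool} (hc : cond (fun j => (τ j).head) = true)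
    (h₁ : P.Does O T₁ τ Q φ r) (h₂ : ∀ τ, Q τ → (loop cond P).Does O T₂ τ Q' φ' (φ τ)) :
    (loop cond P).Does O (T₁ + T₂ + 2) τ Q' φ' r := by
  have h := Reaches.map (M := P.toTM) (M' := (loop cond P).toTM)
    (Q' := fun c => ∃ q τ, c = ⟨some (some q), τ⟩ ∧ P.kind q = .halt ∧ Q τ) (φ' := fun c => φ c.tape)
    (fun c => ⟨some (some c.state), c.tape⟩) ?_ h₁ ?_ fun _ _ => le_rfl
  · refine .step_det (T := T₁ + (T₂ + 1)) (c' := ⟨some (some P.start), τ⟩) ?_ (fun b => ?_)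
      (h.trans ?_)
    · simp [Halted, loop]
    · simp only [next, loop, hc, actOn_stay_heads]
      rfl
    rintro _ ⟨q, τ, rfl, hq, hτ⟩
    refine .step_det (M := (loop cond P).toTM) (c' := ⟨(loop cond P).start, τ⟩) ?_ (fun b => ?_)
      (h₂ τ hτ)
    · simp [Halted, loop, hq, StateKind.map, StateKind.resume]
    · simp only [next, loop, hq, StateKind.map, StateKind.resume, actOn_stay_heads]
  · rintro ⟨q, τ⟩ hc
    simp only [Halted] at hc
    cases hk : P.kind q with
    | halt => exact absurd hk hc
    | ask p p' =>
      refine ⟨by simp [Halted, loop, hk, StateKind.map, StateKind.resume], fun b => ?_⟩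
      simp only [next, loop, hk, StateKind.map, StateKind.resume]
      cases answer O (τ .query) <;> rfl
    | run =>
      refine ⟨by simp [Halted, loop, hk, StateKind.map, StateKind.resume], fun b => ?_⟩
      simp only [next, loop, hk, StateKind.map, StateKind.resume]
  · rintro ⟨q, τ⟩ ⟨hc, hQ⟩
    exact ⟨q, τ, rfl, hc, hQ⟩

end Prog

end

noncomputable section

/-! ### Stack programs -/

/-- The contents of all tapes, if every tape holds a word that starts at the position of the head. -/
abbrev Stacks (W : Type) : Type := TapeName W → List TapeSym

namespace Stacks

variable {W : Type}

/-- The tapes that hold the given words. -/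
def lift (s : Stacks W) : Tapes W := fun i => OracleTM.tapeOf (s i)

theorem lift_injective : Function.Injective (lift (W := W)) := fun _ _ h =>
  funext fun i => OracleTM.tapeOf_injective (congrFun h i)

/-- The words on the tapes. -/
def unlift (τ : Tapes W) : Stacks W := Function.invFun lift τ

@[simp] theorem unlift_lift (s : Stacks W) : unlift (lift s) = s :=
  Function.leftInverse_invFun lift_injective s

@[simp] theorem head_lift (s : Stacks W) (i : TapeName W) : (lift s i).head = (s i).head? :=
  OracleTM.head_tapeOf _

end Stacks

namespace Prog

open OracleTM Turing Stacks
open scoped Classical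

section

variable {W : Type}

/-- Push a symbol on a stack. -/
def push (i : TapeName W) (a : TapeSym) : Prog W :=
  act (fun h => Function.update (stay h) i (h i, some .left)) ;;
    act (fun h => Function.update (stay h) i (some a, none))

/-- Push the top of the stack `i` on the stack `j`. -/
def cpy (i j : TapeName W) : Prog W :=
  act (fun h => Function.update (stay h) j (h j, some .left)) ;;
    act (fun h => Function.update (stay h) j (h i, none))

/-- Remove the top of a stack. -/
def pop (i : TapeName W) : Prog W :=
  act fun h => Function.update (stay h) i (none, some .right)

/-- Toss a coin. -/
def coin (P₁ P₂ : Prog W) : Prog W := branch (fun _ b => b) P₁ P₂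

/-- Look at the top of a stack. -/
def ifTop (i : TapeName W) (p : Option TapeSym → Bool) (P₁ P₂ : Prog W) : Prog W :=
  branch (fun h _ => p (h i)) P₁ P₂

/-- Repeat a program as long as the top of a stack satisfies a condition. -/
def whileTop (i : TapeName W) (p : Option TapeSym → Bool) (P : Prog W) : Prog W :=
  loop (fun h => p (h i)) P

end

variable {W : Type} [Finite W]

/-- The specification of a program on stacks, see `Prog.Does`. -/
def OnStacks (P : Prog W) (O : Set (List TapeSym)) (T : ℕ) (s : Stacks W) (Q : Stacks W → Prop)
    (φ : Stacks W → ENNReal) (r : ENNReal) : Prop :=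
  P.Does O T s.lift (fun τ => ∃ s', Q s' ∧ τ = lift s') (fun τ => φ (unlift τ)) r

/-- The program turns the stacks `s` into `s'` in at most `T` steps. -/
def Evals (P : Prog W) (O : Set (List TapeSym)) (T : ℕ) (s s' : Stacks W) : Prop :=
  ∀ φ, P.OnStacks O T s (· = s') φ (φ s')

variable {O : Set (List TapeSym)} {P P₁ P₂ : Prog W} {T T' T₁ T₂ : ℕ} {s s' s'' : Stacks W}
  {Q Q' : Stacks W → Prop} {φ φ' : Stacks W → ENNReal} {r r' r₁ r₂ : ENNReal}
  {i j t : TapeName W} {p : Option TapeSym → Bool}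

theorem OnStacks.mono (h : P.OnStacks O T s Q φ r) (hT : T ≤ T') (hr : r' ≤ r)
    (hQ : ∀ s, Q s → Q' s) (hφ : ∀ s, Q s → φ s ≤ φ' s) : P.OnStacks O T' s Q' φ' r' := by
  refine Does.mono h hT hr ?_ ?_
  · rintro _ ⟨s, hs, rfl⟩
    exact ⟨s, hQ s hs, rfl⟩
  · rintro _ ⟨s, hs, rfl⟩
    simpa using hφ s hs

theorem OnStacks.mono_time (h : P.OnStacks O T s Q φ r) (hT : T ≤ T') : P.OnStacks O T' s Q φ r :=
  h.mono hT le_rfl (fun _ => id) fun _ _ => le_rfl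

theorem OnStacks.seq (h₁ : P₁.OnStacks O T₁ s Q φ r)
    (h₂ : ∀ s, Q s → P₂.OnStacks O T₂ s Q' φ' (φ s)) :
    (P₁ ;; P₂).OnStacks O (T₁ + T₂ + 1) s Q' φ' r := by
  refine Does.seq h₁ ?_
  rintro _ ⟨s, hs, rfl⟩
  simp only [unlift_lift]
  exact h₂ s hs

theorem Evals.then (h₁ : P₁.Evals O T₁ s s') (h₂ : P₂.OnStacks O T₂ s' Q φ r) :
    (P₁ ;; P₂).OnStacks O (T₁ + T₂ + 1) s Q φ r :=
  (h₁ fun _ => r).seq fun _ hs => hs ▸ h₂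

theorem Evals.seq (h₁ : P₁.Evals O T₁ s s') (h₂ : P₂.Evals O T₂ s' s'') :
    (P₁ ;; P₂).Evals O (T₁ + T₂ + 1) s s'' :=
  fun φ => h₁.then (h₂ φ)

theorem Evals.mono (h : P.Evals O T s s') (hT : T ≤ T') (hs : s' = s'' := by rfl) :
    P.Evals O T' s s'' :=
  hs ▸ fun φ => (h φ).mono_time hT

theorem Evals.start (h : P.Evals O T s' s'') (hs : s = s') : P.Evals O T s s'' := hs ▸ h

theorem Evals.onStacks (h : P.Evals O T s s') (hQ : Q s') (hr : r ≤ φ s') :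
    P.OnStacks O T s Q φ r :=
  (h φ).mono le_rfl hr (fun _ hs => hs ▸ hQ) fun _ _ => le_rfl

theorem evals_act {a : Heads W → TapeAction W}
    (h : (fun i => actOn (tapeOf (s i)) (a (fun j => (s j).head?) i)) = lift s') :
    (act a).Evals O 1 s s' := by
  intro φ
  have h' : (fun i => actOn (s.lift i) (a (fun j => (s.lift j).head) i)) = lift s' := by
    simp only [head_lift]
    exact h
  refine does_act ⟨s', rfl, h'⟩ ?_
  rw [h', unlift_lift]

theorem evals_pop : (pop i).Evals O 1 s (Function.update s i (s i).tail) := by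
  refine evals_act (funext fun j => ?_)
  by_cases hj : j = i
  · subst hj
    simpa [lift, actOn] using pop_tapeOf (s j)
  · simp only [lift, Function.update_of_ne hj, stay]
    exact (head_tapeOf (s j)) ▸ actOn_stay (tapeOf (s j))

/-- The symbol is chosen after the head of tape `i` has moved, so the hypothesis must hold whatever
is under that head. Both `push` and `cpy` are instances. -/
theorem does_push {f : Heads W → Option TapeSym} {a : TapeSym}
    (hf : ∀ T, f (Function.update (fun j => (s j).head?) i T) = some a) :
    (act (fun h => Function.update (stay h) i (h i, some .left)) ;;
      act (fun h => Function.update (stay h) i (f h, none))).Evals O 3 s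
      (Function.update s i (a :: s i)) := by
  intro φ
  refine Does.seq (T₁ := 1) (T₂ := 1)
    (Q := fun τ => τ = Function.update s.lift i ((s.lift i).move .left))
    (φ := fun _ => φ (Function.update s i (a :: s i))) (does_act (funext fun j => ?_) le_rfl) ?_
  · by_cases hj : j = i
    · subst hj
      simp only [Function.update_self, actOn, Tape.write_self]
    · simp only [Function.update_of_ne hj, stay]
      exact actOn_stay _
  · rintro _ rfl
    have h : (fun k => actOn (Function.update s.lift i ((s.lift i).move .left) k)
        (Function.update (stay fun j =>
          (Function.update s.lift i ((s.lift i).move .left) j).head) i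
          (f fun j => (Function.update s.lift i ((s.lift i).move .left) j).head, none) k)) =
        lift (Function.update s i (a :: s i)) := by
      funext j
      by_cases hj : j = i
      · subst hj
        have : (fun k => (Function.update s.lift j ((s.lift j).move .left) k).head) =
            Function.update (fun j => (s j).head?) j ((s.lift j).move .left).head := by
          funext k
          by_cases hk : k = j
          · subst hk; simp
          · simp [Function.update_of_ne hk]
        rw [this, Function.update_self, Function.update_self, hf]
        simpa [lift, actOn] using push_tapeOf (s j) a
      · simp only [lift, Function.update_of_ne hj, stay]
        exact actOn_stay _
    refine does_act ⟨_, rfl, h⟩ ?_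
    rw [h, unlift_lift]

theorem evals_push {a : TapeSym} : (push i a).Evals O 3 s (Function.update s i (a :: s i)) :=
  does_push fun _ => rfl

theorem evals_cpy (hij : i ≠ j) {a : TapeSym} {l : List TapeSym} (hi : s i = a :: l) :
    (cpy i j).Evals O 3 s (Function.update s j (a :: s j)) :=
  does_push (f := fun h => h i) fun T => by simp [Function.update_of_ne hij, hi]

theorem OnStacks.coin (h₁ : P₁.OnStacks O T s Q φ r₁) (h₂ : P₂.OnStacks O T s Q φ r₂) :
    (coin P₁ P₂).OnStacks O (T + 1) s Q φ ((r₁ + r₂) / 2) :=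
  Does.branch (by rintro (_ | _); exacts [h₂, h₁])

theorem OnStacks.ifTop_true (hp : p (s i).head? = true) (h : P₁.OnStacks O T s Q φ r) :
    (ifTop i p P₁ P₂).OnStacks O (T + 1) s Q φ r := by
  refine (Does.branch (r₁ := r) (r₂ := r) fun b => ?_).mono le_rfl (half_add_self r).ge
    (fun _ => id) fun _ _ => le_rfl
  cases b <;> simp only [head_lift, hp] <;> exact h

theorem OnStacks.ifTop_false (hp : p (s i).head? = false) (h : P₂.OnStacks O T s Q φ r) :
    (ifTop i p P₁ P₂).OnStacks O (T + 1) s Q φ r := by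
  refine (Does.branch (r₁ := r) (r₂ := r) fun b => ?_).mono le_rfl (half_add_self r).ge
    (fun _ => id) fun _ _ => le_rfl
  cases b <;> simp only [head_lift, hp] <;> exact h

theorem Evals.ifTop_true (hp : p (s i).head? = true) (h : P₁.Evals O T s s') :
    (ifTop i p P₁ P₂).Evals O (T + 1) s s' := fun φ => (h φ).ifTop_true hp

theorem Evals.ifTop_false (hp : p (s i).head? = false) (h : P₂.Evals O T s s') :
    (ifTop i p P₁ P₂).Evals O (T + 1) s s' := fun φ => (h φ).ifTop_false hp

theorem OnStacks.while_step (hp : p (s i).head? = true) (h₁ : P.OnStacks O T₁ s Q φ r)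
    (h₂ : ∀ s, Q s → (whileTop i p P).OnStacks O T₂ s Q' φ' (φ s)) :
    (whileTop i p P).OnStacks O (T₁ + T₂ + 2) s Q' φ' r := by
  refine Does.loop_step (by simpa using hp) h₁ ?_
  rintro _ ⟨s, hs, rfl⟩
  simp only [unlift_lift]
  exact h₂ s hs

theorem Evals.while_then (hp : p (s i).head? = true) (h₁ : P.Evals O T₁ s s')
    (h₂ : (whileTop i p P).OnStacks O T₂ s' Q φ r) :
    (whileTop i p P).OnStacks O (T₁ + T₂ + 2) s Q φ r :=
  OnStacks.while_step hp (h₁ fun _ => r) fun _ hs => hs ▸ h₂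

theorem Evals.while_step (hp : p (s i).head? = true) (h₁ : P.Evals O T₁ s s')
    (h₂ : (whileTop i p P).Evals O T₂ s' s'') :
    (whileTop i p P).Evals O (T₁ + T₂ + 2) s s'' := fun φ => h₁.while_then hp (h₂ φ)

theorem Evals.while_stop (hp : p (s i).head? = false) : (whileTop i p P).Evals O 1 s s :=
  fun φ => Does.loop_stop (by simpa using hp) ⟨s, rfl, rfl⟩ (by rw [unlift_lift])

/-- Remove everything from a stack. -/
def clear (i : TapeName W) : Prog W := whileTop i Option.isSome (pop i)

theorem evals_clear : (clear i).Evals O (3 * (s i).length + 1) s (Function.update s i []) := by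
  generalize hl : s i = l
  induction l generalizing s with
  | nil => exact (Evals.while_stop (by simp [hl])).mono (by simp) (by simp [← hl])
  | cons a l ih =>
    refine (Evals.while_step (by simp [hl]) evals_pop (ih (by simp [hl]))).mono ?_ (by simp)
    simp only [List.length_cons]
    omega

/-- Move the contents of the stack `i` to the stack `j`, in reverse order. -/
def moveAll (i j : TapeName W) : Prog W := whileTop i Option.isSome (cpy i j ;; pop i)

theorem evals_moveAll (hij : i ≠ j) : (moveAll i j).Evals O (7 * (s i).length + 1) s
    (Function.update (Function.update s i []) j ((s i).reverse ++ s j)) := by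
  generalize hl : s i = l
  induction l generalizing s with
  | nil =>
    have h : Function.update s i [] = s := by rw [← hl, Function.update_eq_self]
    refine (Evals.while_stop (by simp [hl])).mono (by simp) ?_
    simp [h]
  | cons a l ih =>
    refine (Evals.while_step (by simp [hl]) ((evals_cpy hij hl).seq evals_pop)
      (ih ?_)).mono ?_ ?_
    · simp [Function.update_of_ne hij, hl]
    · simp only [List.length_cons]
      omega
    · funext k
      by_cases hk : k = j
      · subst hk; simp [Function.update_of_ne hij.symm]
      · by_cases hk' : k = i
        · subst hk'; simp [hij]
        · simp [hk, hk']

/-- Push the contents of the stack `i` on the stack `j`, in reverse order; `t` must be empty. -/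
def dup (i j t : TapeName W) : Prog W :=
  whileTop i Option.isSome (cpy i j ;; cpy i t ;; pop i) ;; moveAll t i

theorem evals_dup_aux (hij : i ≠ j) (hit : i ≠ t) (hjt : j ≠ t) :
    (whileTop i Option.isSome (cpy i j ;; cpy i t ;; pop i)).Evals O (11 * (s i).length + 1) s
    (Function.update (Function.update (Function.update s i []) j ((s i).reverse ++ s j))
      t ((s i).reverse ++ s t)) := by
  generalize hl : s i = l
  induction l generalizing s with
  | nil =>
    have h : Function.update s i [] = s := by rw [← hl, Function.update_eq_self]
    refine (Evals.while_stop (by simp [hl])).mono (by simp) ?_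
    simp [h]
  | cons a l ih =>
    refine (Evals.while_step (by simp [hl]) ((evals_cpy hij hl).seq
      ((evals_cpy (a := a) (l := l) hit ?_).seq evals_pop)) (ih ?_)).mono ?_ ?_
    · simp [Function.update_of_ne hij, hl]
    · simp [Function.update_of_ne hij, Function.update_of_ne hit, hl]
    · simp only [List.length_cons]
      omega
    · funext k
      by_cases hk : k = j
      · subst hk; simp [hij.symm, hjt]
      · by_cases hk' : k = i
        · subst hk'; simp [hij, hit]
        · by_cases hk'' : k = t
          · subst hk''; simp [hit.symm, hjt.symm]
          · simp [hk, hk', hk'']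

/-- The stack `t` receives the reverse of `i` and is then reversed back onto `i`, while `j` keeps
the reversed copy. -/
theorem evals_dup (hij : i ≠ j) (hit : i ≠ t) (hjt : j ≠ t) (ht : s t = []) :
    (dup i j t).Evals O (18 * (s i).length + 3) s (Function.update s j ((s i).reverse ++ s j)) := by
  refine ((evals_dup_aux hij hit hjt).seq (evals_moveAll hit.symm)).mono ?_ ?_
  · simp [ht]
    omega
  · funext k
    by_cases hk : k = j
    · subst hk; simp [hij.symm, hjt]
    · by_cases hk' : k = i
      · subst hk'; simp [hij, hit, ht]
      · by_cases hk'' : k = t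
        · subst hk''; simp [hit.symm, hjt.symm, ht]
        · simp [hk, hk', hk'']

end Prog

end

noncomputable section

/-! ### Calling a machine as a subroutine -/

namespace OracleTM

open Turing

/-- All nonblank cells of the tape are at distance less than `m` from the head. -/
def Near (m : ℕ) (T : Tape (Option TapeSym)) : Prop := ∀ i : ℤ, (m : ℤ) ≤ |i| → T.nth i = none

/-- The head moves by at most one cell. The bound `1 ≤ m` is needed because the cell under the head
may become nonblank. -/
theorem Near.actOn {m : ℕ} (hm : 1 ≤ m) {T : Tape (Option TapeSym)} (h : Near m T)
    (a : Option TapeSym × Option Dir) : Near (m + 1) (actOn T a) := by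
  have hw : ∀ i : ℤ, (m : ℤ) ≤ |i| → (T.write a.1).nth i = none := by
    intro i hi
    have hi0 : i ≠ 0 := by rintro rfl; simp at hi; omega
    rw [Tape.write_nth, if_neg hi0]
    exact h i hi
  intro i hi
  push_cast at hi
  rcases a with ⟨a, _ | _ | _⟩
  · exact hw i (by omega)
  · simp only [OracleTM.actOn, Tape.move_left_nth]
    refine hw _ ?_
    rcases abs_cases i with h | h <;> rcases abs_cases (i - 1) with h' | h' <;> omega
  · simp only [OracleTM.actOn, Tape.move_right_nth]
    refine hw _ ?_
    rcases abs_cases i with h | h <;> rcases abs_cases (i + 1) with h' | h' <;> omega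

theorem near_tapeOf (w : List TapeSym) : Near (w.length + 1) (tapeOf w) := by
  intro i hi
  push_cast at hi
  rcases lt_or_ge i 0 with h | h
  · exact nth_tapeOf_neg _ h
  · obtain ⟨n, rfl⟩ := Int.eq_ofNat_of_zero_le h
    rw [abs_of_nonneg h] at hi
    rw [nth_tapeOf]
    exact List.getElem?_eq_none (by omega)

theorem length_le_of_near {m : ℕ} {w : List TapeSym} (h : Near m (tapeOf w)) : w.length ≤ m := by
  by_contra hw
  have := h m (by simp)
  rw [nth_tapeOf, List.getElem?_eq_getElem (by omega)] at this
  simp at this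

/-- The action that erases a cell and goes right. -/
def eraseRight (_ : Option TapeSym) : Option TapeSym × Option Dir := (none, some .right)

/-- The action that goes left. -/
def goLeft (a : Option TapeSym) : Option TapeSym × Option Dir := (a, some .left)

theorem nth_iterate_goLeft (m : ℕ) (T : Tape (Option TapeSym)) (i : ℤ) :
    ((fun T => actOn T (goLeft T.head))^[m] T).nth i = T.nth (i - m) := by
  induction m generalizing T with
  | zero => simp
  | succ m ih =>
    rw [Function.iterate_succ_apply, ih]
    simp only [goLeft, actOn, Tape.write_self, Tape.move_left_nth]
    congr 1
    push_cast
    ring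

theorem nth_iterate_eraseRight (m : ℕ) (T : Tape (Option TapeSym)) (i : ℤ) :
    ((fun T => actOn T (eraseRight T.head))^[m] T).nth i =
      if -m ≤ i ∧ i < 0 then none else T.nth (i + m) := by
  induction m generalizing T with
  | zero => simp
  | succ m ih =>
    rw [Function.iterate_succ_apply, ih]
    simp only [eraseRight, actOn, Tape.move_right_nth, Tape.write_nth]
    push_cast
    by_cases h1 : -(m : ℤ) ≤ i ∧ i < 0
    · rw [if_pos h1, if_pos (by omega)]
    · rw [if_neg h1]
      by_cases h2 : i + m + 1 = 0
      · rw [if_pos h2, if_pos (by omega)]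
      · rw [if_neg h2, if_neg (by omega), add_assoc]

/-- After m moves to the left, two erasing passes of m cells each cover the positions −m, …, m − 1
relative to the original head. Each of the three passes uses up one copy of m, hence the three
clocks. -/
theorem eq_blank_of_near {m : ℕ} {T : Tape (Option TapeSym)} (h : Near m T) :
    (fun T => actOn T (eraseRight T.head))^[m] ((fun T => actOn T (eraseRight T.head))^[m]
      ((fun T => actOn T (goLeft T.head))^[m] T)) = tapeOf [] := by
  apply Tape.ext_nth
  intro i
  have : (tapeOf []).nth i = none := by
    rcases lt_or_ge i 0 with h | h
    · exact nth_tapeOf_neg _ h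
    · obtain ⟨n, rfl⟩ := Int.eq_ofNat_of_zero_le h
      rw [nth_tapeOf]
      rfl
  rw [this, nth_iterate_eraseRight, nth_iterate_eraseRight, nth_iterate_goLeft]
  split_ifs with h1 h2
  · rfl
  · rfl
  · refine h _ ?_
    rcases abs_cases (i + m + m - m) with h' | h' <;> omega

end OracleTM

/-! ### Simulating a machine in lockstep with clocks. -/

namespace Prog

open OracleTM Turing Stacks
open scoped Classical

variable {W : Type}

/-- In lockstep with another machine, a clock tape records the time. -/
def clockAction (ck : Set (TapeName W)) (h : Heads W) : TapeAction W :=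
  fun i => if i ∈ ck then (some (.bit true), some .left) else (h i, none)

/-- Run a machine on the tapes given by `e`, and record the time on the tapes `ck`. If `useOracle`
is false, then all questions are answered by no. -/
def call (M : OracleTM) (e : TapeName M.Work → TapeName W) (ck : Set (TapeName W))
    (useOracle : Bool) : Prog W where
  State := M.State
  finite_state := M.finite_state
  start := M.start
  kind q := match M.kind q with
    | .halt => .halt
    | .ask p p' => bif useOracle then .ask p p' else .run
    | .run => .run
  trans q h b := match M.kind q with
    | .ask _ p' => (p', stay h)
    | _ => ((M.trans q (fun j => h (e j)) b).1,
      Function.extend e (M.trans q (fun j => h (e j)) b).2 (clockAction ck h))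

/-- The tapes of a machine, clock tapes that show `m`, and other tapes. -/
def embedTapes {V : Type} (e : TapeName V → TapeName W) (ck : Set (TapeName W)) (τ : Tapes V)
    (m : ℕ) (s : Stacks W) : Tapes W :=
  Function.extend e τ fun i =>
    if i ∈ ck then (tapeOf (TapeSym.unary m)).move .left else tapeOf (s i)

theorem actOn_embedTapes {V : Type} {e : TapeName V → TapeName W} (he : Function.Injective e)
    (ck : Set (TapeName W)) (τ : Tapes V) (m : ℕ) (s : Stacks W) (a : TapeAction V) :
    (fun i => actOn (embedTapes e ck τ m s i)
      (Function.extend e a (clockAction ck fun j => (embedTapes e ck τ m s j).head) i)) =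
    embedTapes e ck (fun j => actOn (τ j) (a j)) (m + 1) s := by
  funext i
  by_cases hi : ∃ j, e j = i
  · obtain ⟨j, rfl⟩ := hi
    simp only [embedTapes, he.extend_apply]
  · by_cases hc : i ∈ ck
    · simp only [embedTapes, Function.extend_apply' _ _ _ hi, clockAction, if_pos hc]
      exact write_move_left_tapeOf _ _
    · simp only [embedTapes, Function.extend_apply' _ _ _ hi, clockAction, if_neg hc]
      exact actOn_stay _

variable [Finite W]

/-- The number m on the clocks always bounds the distance of nonblank cells from the heads: an
ordinary step raises both by at most one, and a question to the oracle changes no tape. Since `ψ`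
looks only at the output tape, the expectation over the runs of `M` carries over to the caller. -/
theorem reaches_call {M : OracleTM} {e : TapeName M.Work → TapeName W} (he : Function.Injective e)
    (hq : e .query = .query) (ck : Set (TapeName W)) {useOracle : Bool} {O O' : Set (List TapeSym)}
    (hO : ∀ T, answer O' T = (useOracle && answer O T)) (s : Stacks W) {R : M.Cfg → Prop}
    (ψ : Tape (Option TapeSym) → ENNReal) (T m : ℕ) (c : M.Cfg) (hm1 : 1 ≤ m)
    (hR : ∀ c' ∈ (M.run O' T c).support, M.Halted c' ∧ R c') (hm : ∀ j, Near m (c.tape j)) :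
    (call M e ck useOracle).toTM.Reaches O
      (fun d => (call M e ck useOracle).toTM.Halted d ∧ ∃ (c' : M.Cfg) (m' : ℕ), R c' ∧
        m' ≤ m + T ∧ (∀ j, Near m' (c'.tape j)) ∧ d.tape = embedTapes e ck c'.tape m' s)
      (fun d => ψ (d.tape (e .output))) T ⟨c.state, embedTapes e ck c.tape m s⟩
      (expect (M.run O' T c) fun c' => ψ (c'.tape .output)) := by
  have key : ∀ (T m : ℕ) (c : M.Cfg) (_ : M.Halted c)
      (_ : ∀ c' ∈ (M.run O' T c).support, M.Halted c' ∧ R c') (_ : ∀ j, Near m (c.tape j)),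
      (call M e ck useOracle).toTM.Reaches O
      (fun d => (call M e ck useOracle).toTM.Halted d ∧ ∃ (c' : M.Cfg) (m' : ℕ), R c' ∧
        m' ≤ m + T ∧ (∀ j, Near m' (c'.tape j)) ∧ d.tape = embedTapes e ck c'.tape m' s)
      (fun d => ψ (d.tape (e .output))) T ⟨c.state, embedTapes e ck c.tape m s⟩
      (expect (M.run O' T c) fun c' => ψ (c'.tape .output)) := by
    intro T m c hc hR hm
    rw [run_of_halted hc, expect_pure]
    rw [run_of_halted hc] at hR
    refine .done ⟨?_, c, m, (hR c (by simp)).2, by omega, hm, rfl⟩ ?_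
    · unfold Halted at hc
      simp [Halted, call, hc]
    · simp [embedTapes, he.extend_apply]
  induction T generalizing m c with
  | zero => exact key 0 m c (hR c (by simp [run])).1 hR hm
  | succ T ih =>
    by_cases hc : M.Halted c
    · exact key _ m c hc hR hm
    rw [expect_run_succ]
    have step : ∀ b, ∃ m' ≤ m + 1, 1 ≤ m' ∧ (∀ j, Near m' ((M.next O' c b).tape j)) ∧
        (call M e ck useOracle).toTM.next O ⟨c.state, embedTapes e ck c.tape m s⟩ b =
        ⟨(M.next O' c b).state, embedTapes e ck (M.next O' c b).tape m' s⟩ := by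
      intro b
      unfold Halted at hc
      cases hk : M.kind c.state with
      | halt => exact absurd hk hc
      | ask p p' =>
        refine ⟨m, by omega, hm1, by simpa [next, hk] using hm, ?_⟩
        have hqt : embedTapes e ck c.tape m s .query = c.tape .query := by
          rw [← hq, embedTapes, he.extend_apply]
        cases useOracle
        · simp [next, call, hk, hO, actOn_stay_heads]
        · simp [next, call, hk, hO, hqt]
      | run =>
        refine ⟨m + 1, le_rfl, by omega, fun j => ?_, ?_⟩
        · simp only [next, hk]
          exact (hm j).actOn hm1 _
        · have hh : (fun j => (embedTapes e ck c.tape m s (e j)).head) =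
              fun j => (c.tape j).head := by
            funext j
            rw [embedTapes, he.extend_apply]
          simp only [next, call, hk, hh, actOn_embedTapes he]
    have half : ∀ b, (call M e ck useOracle).toTM.Reaches O
        (fun d => (call M e ck useOracle).toTM.Halted d ∧ ∃ (c' : M.Cfg) (m' : ℕ), R c' ∧
        m' ≤ m + (T + 1) ∧ (∀ j, Near m' (c'.tape j)) ∧ d.tape = embedTapes e ck c'.tape m' s)
        (fun d => ψ (d.tape (e .output))) T
        ((call M e ck useOracle).toTM.next O ⟨c.state, embedTapes e ck c.tape m s⟩ b)
        (expect (M.run O' T (M.next O' c b)) fun c' => ψ (c'.tape .output)) := by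
      intro b
      obtain ⟨m', hm', hm1', hn, h⟩ := step b
      rw [h]
      refine (ih m' _ hm1' (fun c' hc' => hR c' ((mem_support_run_succ _ _ _).2 ⟨b, hc'⟩)) hn).mono le_rfl
        le_rfl ?_ fun _ _ => le_rfl
      rintro d ⟨hd, c', m'', h1, h2, h3, h4⟩
      exact ⟨hd, c', m'', h1, by omega, h3, h4⟩
    refine .step ?_ (half true) (half false) le_rfl
    unfold Halted at hc ⊢
    cases hk : M.kind c.state with
    | halt => exact absurd hk hc
    | ask p p' => cases useOracle <;> simp [call, hk]
    | run => simp [call, hk]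

/-- The program turns the tapes `τ` into `τ'` in at most `T` steps. -/
def Converts (P : Prog W) (O : Set (List TapeSym)) (T : ℕ) (τ τ' : Tapes W) : Prop :=
  ∀ φ, P.Does O T τ (· = τ') φ (φ τ')

variable {O : Set (List TapeSym)} {P P₁ P₂ : Prog W} {T T' T₁ T₂ : ℕ} {τ τ' τ'' : Tapes W}
  {s s' : Stacks W}

theorem Converts.seq (h₁ : P₁.Converts O T₁ τ τ') (h₂ : P₂.Converts O T₂ τ' τ'') :
    (P₁ ;; P₂).Converts O (T₁ + T₂ + 1) τ τ'' :=
  fun φ => (h₁ fun _ => φ τ'').seq fun _ hτ => hτ ▸ h₂ φ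

theorem Converts.mono (h : P.Converts O T τ τ') (hT : T ≤ T') (hτ : τ' = τ'' := by rfl) :
    P.Converts O T' τ τ'' :=
  hτ ▸ fun φ => (h φ).mono hT le_rfl (fun _ => id) fun _ _ => le_rfl

theorem converts_act {a : Heads W → TapeAction W}
    (h : (fun i => actOn (τ i) (a (fun j => (τ j).head) i)) = τ') :
    (act a).Converts O 1 τ τ' := fun _ => does_act h (h ▸ le_rfl)

/-- Empty a stack, and perform an action on the tapes in `D` for each of its members. -/
def sweep (c : TapeName W) (D : Set (TapeName W))
    (a : Option TapeSym → Option TapeSym × Option Dir) : Prog W :=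
  loop (fun h => (h c).isSome) (act fun h i =>
    if i = c then (none, some .right) else if i ∈ D then a (h i) else (h i, none))

/-- The stack `c` serves as a loop counter: only the length of its word matters. -/
theorem converts_sweep {c : TapeName W} {D : Set (TapeName W)}
    {a : Option TapeSym → Option TapeSym × Option Dir} {w : List TapeSym} (h : τ c = tapeOf w) :
    (sweep c D a).Converts O (3 * w.length + 1) τ fun i => if i = c then tapeOf [] else
      if i ∈ D then (fun T => actOn T (a T.head))^[w.length] (τ i) else τ i := by
  induction w generalizing τ with
  | nil =>
    have : τ = fun i => if i = c then tapeOf [] else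
      if i ∈ D then (fun T => actOn T (a T.head))^[([] : List TapeSym).length] (τ i) else τ i := by
      funext i
      split_ifs with h1
      · rw [h1, h]
      · rfl
      · rfl
    rw [← this]
    exact fun φ => Does.loop_stop (by simp [h]) rfl le_rfl
  | cons b w ih =>
    intro φ
    refine Does.mono (Does.loop_step (T₁ := 1) (r := φ _) (by simp [h]) (converts_act rfl fun _ => φ _) ?_)
      (T := 1 + (3 * w.length + 1) + 2) (by simp; omega) le_rfl (fun _ => id) fun _ _ => le_rfl
    rintro _ rfl
    refine (Converts.mono (ih ?_) le_rfl ?_) φ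
    · simp only [if_true, h]
      exact pop_tapeOf (b :: w)
    · funext i
      by_cases h1 : i = c
      · simp [h1]
      · by_cases h2 : i ∈ D
        · simp [h1, h2]
        · simp only [if_neg h1, if_neg h2]
          exact actOn_stay _

end Prog

end

/-! ### Subroutine calls that leave blank tapes. -/

noncomputable section

namespace Prog

open OracleTM Turing Stacks
open scoped Classical

variable {W : Type}

/-- Three tapes that serve as clocks. -/
structure Clocks (W : Type) where
  c₁ : TapeName W
  c₂ : TapeName W
  c₃ : TapeName W
  ne₁₂ : c₁ ≠ c₂
  ne₁₃ : c₁ ≠ c₃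
  ne₂₃ : c₂ ≠ c₃

/-- The set of the clocks. -/
def Clocks.toSet (ck : Clocks W) : Set (TapeName W) := {ck.c₁, ck.c₂, ck.c₃}

/-- Move the heads of all clocks. -/
def moveClocks (ck : Clocks W) (d : Turing.Dir) : Prog W :=
  act fun h i => (h i, if i ∈ ck.toSet then some d else none)

/-- Erase the clocks, and all tapes in `D` up to the distance that the clocks show. -/
def clean (ck : Clocks W) (D : Set (TapeName W)) : Prog W :=
  moveClocks ck .right ;; sweep ck.c₁ D goLeft ;; sweep ck.c₂ D eraseRight ;;
    sweep ck.c₃ D eraseRight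

variable [Finite W] {O : Set (List TapeSym)}

/-- The output tape is spared; by `hv` it already is a stack. -/
theorem converts_clean {V : Type} {e : TapeName V → TapeName W} (he : Function.Injective e)
    {ck : Clocks W} (hck : ∀ i ∈ ck.toSet, i ∉ Set.range e) {τ : Tapes V} {m : ℕ} {s : Stacks W}
    (hτ : ∀ j, Near m (τ j)) {v : List TapeSym} (hv : τ .output = tapeOf v) :
    (clean ck (Set.range e \ {e .output})).Converts O (9 * m + 10) (embedTapes e ck.toSet τ m s)
      (lift fun i => if i = e .output then v else if i ∈ Set.range e ∪ ck.toSet then [] else s i) := by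
  have h0 : (moveClocks ck .right).Converts O 1 (embedTapes e ck.toSet τ m s)
      (Function.extend e τ fun i =>
        if i ∈ ck.toSet then tapeOf (TapeSym.unary m) else tapeOf (s i)) := by
    refine converts_act (funext fun i => ?_)
    by_cases hc : i ∈ ck.toSet
    · have hi : ¬ ∃ j, e j = i := hck i hc
      simp only [if_pos hc, embedTapes, Function.extend_apply' _ _ _ hi, actOn, Tape.write_self]
      exact Tape.move_left_right _
    · by_cases hi : ∃ j, e j = i
      · obtain ⟨j, rfl⟩ := hi
        simp only [if_neg hc, embedTapes, he.extend_apply, actOn, Tape.write_self]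
      · simp only [if_neg hc, embedTapes, Function.extend_apply' _ _ _ hi, actOn, Tape.write_self]
  have hc₁ : ck.c₁ ∈ ck.toSet := by simp [Clocks.toSet]
  have hc₂ : ck.c₂ ∈ ck.toSet := by simp [Clocks.toSet]
  have hc₃ : ck.c₃ ∈ ck.toSet := by simp [Clocks.toSet]
  have ext (i) (hi : i ∈ ck.toSet) (f g) : Function.extend e (f : Tapes V) g i = g i :=
    Function.extend_apply' _ _ _ (hck i hi)
  have hl : (TapeSym.unary m).length = m := by simp [TapeSym.unary]
  refine (h0.seq ((converts_sweep (w := TapeSym.unary m) ?_).seq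
    ((converts_sweep (w := TapeSym.unary m) ?_).seq
      (converts_sweep (w := TapeSym.unary m) ?_)))).mono ?_ ?_
  · rw [ext _ hc₁, if_pos hc₁]
  · rw [if_neg ck.ne₁₂.symm, if_neg (fun h => hck _ hc₂ h.1), ext _ hc₂, if_pos hc₂]
  · rw [if_neg ck.ne₂₃.symm, if_neg (fun h => hck _ hc₃ h.1), if_neg ck.ne₁₃.symm,
      if_neg (fun h => hck _ hc₃ h.1), ext _ hc₃, if_pos hc₃]
  · rw [hl]
    omega
  · funext i
    rw [hl]
    by_cases hi : i ∈ Set.range e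
    · have n₁ : i ≠ ck.c₁ := fun h => hck _ hc₁ (h ▸ hi)
      have n₂ : i ≠ ck.c₂ := fun h => hck _ hc₂ (h ▸ hi)
      have n₃ : i ≠ ck.c₃ := fun h => hck _ hc₃ (h ▸ hi)
      obtain ⟨j, rfl⟩ := hi
      simp only [if_neg n₁, if_neg n₂, if_neg n₃, he.extend_apply, lift]
      by_cases hj : j = .output
      · subst hj
        simp [hv]
      · have hj' : e j ≠ e .output := fun h => hj (he h)
        rw [if_pos, if_pos, if_pos, if_neg hj', if_pos]
        · exact eq_blank_of_near (hτ j)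
        all_goals simp [hj']
    · have ho : i ≠ e .output := fun h => hi ⟨_, h.symm⟩
      have hd : i ∉ Set.range e \ {e .output} := fun h => hi h.1
      have hi' : ¬ ∃ j, e j = i := hi
      simp only [if_neg hd, lift, Function.extend_apply' _ _ _ hi', if_neg ho]
      by_cases h₁ : i = ck.c₁
      · simp [h₁, hc₁]
      by_cases h₂ : i = ck.c₂
      · simp [h₂, hc₂]
      by_cases h₃ : i = ck.c₃
      · simp [h₃, hc₃]
      have hc : i ∉ ck.toSet := by simp [Clocks.toSet, h₁, h₂, h₃]
      have : i ∉ Set.range e ∪ ck.toSet := by simp [hc, hi']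
      simp only [if_neg h₁, if_neg h₂, if_neg h₃, if_neg hc, if_neg this]

/-- Push a mark on each clock. -/
def tick (ck : Clocks W) : Prog W :=
  push ck.c₁ (.bit true) ;; push ck.c₂ (.bit true) ;; push ck.c₃ (.bit true)

/-- Move the word on `arg` to `inp`, in reverse order, and push equally many marks on the clocks. -/
def load (ck : Clocks W) (arg inp : TapeName W) : Prog W :=
  whileTop arg Option.isSome (cpy arg inp ;; tick ck ;; pop arg)

/-- Clock stacks that show `m`. -/
def setClocks (ck : Clocks W) (m : ℕ) (s : Stacks W) : Stacks W :=
  fun i => if i ∈ ck.toSet then TapeSym.unary m else s i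

theorem evals_tick {ck : Clocks W} {m : ℕ} {s : Stacks W} :
    (tick ck).Evals O 11 (setClocks ck m s) (setClocks ck (m + 1) s) := by
  refine (evals_push.seq (evals_push.seq evals_push)).mono (by omega) (funext fun i => ?_)
  have h12 := ck.ne₁₂
  have h13 := ck.ne₁₃
  have h23 := ck.ne₂₃
  by_cases h₁ : i = ck.c₁
  · subst h₁
    simp [setClocks, Clocks.toSet, h12, h13, TapeSym.unary, List.replicate_succ]
  by_cases h₂ : i = ck.c₂
  · subst h₂
    simp [setClocks, Clocks.toSet, h12, h12.symm, h23, TapeSym.unary, List.replicate_succ]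
  by_cases h₃ : i = ck.c₃
  · subst h₃
    simp [setClocks, Clocks.toSet, h13.symm, h23.symm, TapeSym.unary, List.replicate_succ]
  simp [setClocks, Clocks.toSet, h₁, h₂, h₃]

theorem evals_load {ck : Clocks W} {arg inp : TapeName W} (hai : arg ≠ inp) (ha : arg ∉ ck.toSet)
    (hi : inp ∉ ck.toSet) {m : ℕ} {s : Stacks W} :
    (load ck arg inp).Evals O (19 * (s arg).length + 1) (setClocks ck m s)
      (setClocks ck (m + (s arg).length)
        (Function.update (Function.update s arg []) inp ((s arg).reverse ++ s inp))) := by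
  generalize hl : s arg = l
  induction l generalizing s m with
  | nil =>
    have h : Function.update s arg [] = s := by rw [← hl, Function.update_eq_self]
    exact (Evals.while_stop (by simp [setClocks, ha, hl])).mono (by simp) (by simp [h])
  | cons a l ih =>
    have hs : ∀ (m : ℕ) (s : Stacks W) (i) (_ : i ∉ ck.toSet) (w : List TapeSym),
        Function.update (setClocks ck m s) i w = setClocks ck m (Function.update s i w) := by
      intro m s i hi w
      funext j
      by_cases hj : j = i
      · subst hj; simp [setClocks, hi]
      · simp [setClocks, hj]
    have h1 := evals_cpy (O := O) (s := setClocks ck m s) hai (a := a) (l := l)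
      (by simp [setClocks, ha, hl])
    rw [hs _ _ _ hi] at h1
    have h2 := evals_pop (O := O) (i := arg) (s := setClocks ck (m + 1)
      (Function.update s inp (a :: setClocks ck m s inp)))
    rw [hs _ _ _ ha] at h2
    refine (Evals.while_step (by simp [setClocks, ha, hl]) (h1.seq (evals_tick.seq h2))
      (ih ?_)).mono ?_ ?_
    · simp [setClocks, ha, hai, hl]
    · simp only [List.length_cons]; omega
    · rw [List.length_cons, add_right_comm, add_assoc]
      congr 1
      funext k
      by_cases hk : k = inp
      · subst hk; simp [hai.symm, setClocks, hi]
      · by_cases hk' : k = arg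
        · subst hk'; simp [hai]
        · simp [hk, hk']

/-- Call a machine with the reverse of the word on the tape `arg`; afterwards, its output is on the
tape `e .output`, and its other tapes are blank. -/
def subroutine (M : OracleTM) (e : TapeName M.Work → TapeName W) (ck : Clocks W)
    (arg : TapeName W) (useOracle : Bool) : Prog W :=
  load ck arg (e .input) ;; tick ck ;; moveClocks ck .left ;; call M e ck.toSet useOracle ;;
    clean ck (Set.range e \ {e .output})

/-- Here ρ is the value secured by every admissible output and σ the additional value of an output
in `A`. Averaging over the runs gives ρ + σ · Pr[A]. -/
theorem onStacks_subroutine {M : OracleTM} {e : TapeName M.Work → TapeName W}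
    (he : Function.Injective e) (hq : e .query = .query) {ck : Clocks W}
    (hck : ∀ i ∈ ck.toSet, i ∉ Set.range e) {arg : TapeName W} (ha : arg ∉ Set.range e)
    (ha' : arg ∉ ck.toSet) {useOracle : Bool} {O' : Set (List TapeSym)}
    (hO : ∀ T, answer O' T = (useOracle && answer O T)) {w : List TapeSym} {T : ℕ}
    {R A : List TapeSym → Prop} (hR : M.Surely O' w T R) {s : Stacks W}
    (hs : ∀ i ∈ Set.range e ∪ ck.toSet, s i = []) (hw : s arg = w.reverse)
    {φ : Stacks W → ENNReal} {ρ σ : ENNReal}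
    (hρ : ∀ v, R v → ρ ≤ φ (Function.update (Function.update s arg []) (e .output) v))
    (hσ : ∀ v, R v → A v →
      ρ + σ ≤ φ (Function.update (Function.update s arg []) (e .output) v)) :
    (subroutine M e ck arg useOracle).OnStacks O (28 * w.length + 10 * T + 39) s
      (fun s' => ∃ v, R v ∧ v.length ≤ w.length + T + 1 ∧
        s' = Function.update (Function.update s arg []) (e .output) v) φ
      (ρ + σ * M.prob O' w T A) := by
  have hai : arg ≠ e .input := fun h => ha ⟨_, h.symm⟩
  have hi : e .input ∉ ck.toSet := fun h => hck _ h ⟨_, rfl⟩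
  have hs0 : setClocks ck 0 s = s := by
    funext i
    by_cases hc : i ∈ ck.toSet
    · simp [setClocks, hc, hs i (.inr hc), TapeSym.unary]
    · simp [setClocks, hc]
  have h1 := evals_load (O := O) (s := s) (m := 0) hai ha' hi
  rw [hs0, hw, List.reverse_reverse, List.length_reverse, zero_add,
    hs (e .input) (.inl ⟨_, rfl⟩), List.append_nil] at h1
  -- `load` makes |w| marks and `tick` one more. This is the distance in `near_tapeOf` for the input
  -- tape, and it is positive even for the empty word.
  set m := w.length + 1 with hm
  set s₁ := Function.update s arg [] with hs₁
  have h2 : (moveClocks ck .left).Converts O 1 (lift (setClocks ck m (Function.update s₁ (e .input) w)))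
      (embedTapes e ck.toSet (M.init w).tape m s₁) := by
    refine converts_act (funext fun i => ?_)
    by_cases hc : i ∈ ck.toSet
    · have hi : ¬ ∃ j, e j = i := hck i hc
      simp only [if_pos hc, embedTapes, Function.extend_apply' _ _ _ hi, actOn, Tape.write_self,
        lift, setClocks]
    · by_cases hi : ∃ j, e j = i
      · obtain ⟨j, rfl⟩ := hi
        simp only [if_neg hc, embedTapes, he.extend_apply, actOn, Tape.write_self, lift, setClocks]
        have hj : s₁ (e j) = [] := by
          rw [hs₁, Function.update_of_ne (fun h => ha ⟨_, h⟩)]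
          exact hs _ (.inl ⟨j, rfl⟩)
        cases j with
        | input => simp [init]
        | _ => rw [Function.update_of_ne (by simp [he.eq_iff]), hj]; rfl
      · have hi' : i ≠ e .input := fun h => hi ⟨_, h.symm⟩
        simp only [if_neg hc, embedTapes, Function.extend_apply' _ _ _ hi, actOn, Tape.write_self,
          lift, setClocks, Function.update_of_ne hi']
  -- The caller's value as a function of the output tape. It is needed only on tapes of the form
  -- `tapeOf v`, where `Function.invFun` recovers v.
  set ψ : Tape (Option TapeSym) → ENNReal := fun t =>
    φ (Function.update s₁ (e .output) (Function.invFun tapeOf t)) with hψ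
  have hψv (v) : ψ (tapeOf v) = φ (Function.update s₁ (e .output) v) := by
    rw [hψ]
    simp only [Function.leftInverse_invFun tapeOf_injective v]
  have h3 : (call M e ck.toSet useOracle).Does O T (embedTapes e ck.toSet (M.init w).tape m s₁)
      (fun τ => ∃ (c' : M.Cfg) (m' : ℕ), (∃ v, M.Output c' v ∧ R v) ∧ m' ≤ m + T ∧
        (∀ j, Near m' (c'.tape j)) ∧ τ = embedTapes e ck.toSet c'.tape m' s₁)
      (fun τ => ψ (τ (e .output)))
      (expect (M.run O' T (M.init w)) fun c' => ψ (c'.tape .output)) := by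
    refine reaches_call he hq ck.toSet hO s₁ ψ T m (M.init w) (by omega) hR fun j => ?_
    cases j with
    | input => exact near_tapeOf w
    | _ => exact fun i hi => near_tapeOf [] i (by simp; omega)
  have h4 : ρ + σ * M.prob O' w T A ≤
      expect (M.run O' T (M.init w)) fun c' => ψ (c'.tape .output) := by
    rw [prob_eq_expect, ← expect_add_mul]
    refine le_expect_of_support fun c hc => ?_
    obtain ⟨hh, v, hv, hRv⟩ := hR c hc
    rw [show c.tape .output = tapeOf v from hv, hψv]
    by_cases hA : c ∈ {c | M.Halted c ∧ ∃ v, M.Output c v ∧ A v}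
    · obtain ⟨-, v', hv', hA⟩ := id hA
      obtain rfl : v' = v := tapeOf_injective (hv'.symm.trans hv)
      rw [Set.indicator_of_mem (by assumption)]
      simpa using hσ _ hRv hA
    · rw [Set.indicator_of_notMem hA]
      simpa using hρ _ hRv
  have h5 : ∀ τ, (∃ (c' : M.Cfg) (m' : ℕ), (∃ v, M.Output c' v ∧ R v) ∧ m' ≤ m + T ∧
        (∀ j, Near m' (c'.tape j)) ∧ τ = embedTapes e ck.toSet c'.tape m' s₁) →
      (clean ck (Set.range e \ {e .output})).Does O (9 * (m + T) + 10) τ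
        (fun τ => ∃ s', (∃ v, R v ∧ v.length ≤ w.length + T + 1 ∧
          s' = Function.update s₁ (e .output) v) ∧ τ = lift s')
        (fun τ => φ (unlift τ)) (ψ (τ (e .output))) := by
    rintro _ ⟨c', m', ⟨v, hv, hRv⟩, hm', hn, rfl⟩
    have hf : (fun i => if i = e .output then v else
        if i ∈ Set.range e ∪ ck.toSet then [] else s₁ i) = Function.update s₁ (e .output) v := by
      funext i
      by_cases ho : i = e .output
      · subst ho; simp
      · rw [if_neg ho, Function.update_of_ne ho]
        split_ifs with h
        · rw [hs₁, Function.update_of_ne, hs i h]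
          rintro rfl
          exact h.elim ha ha'
        · rfl
    have hc := converts_clean (O := O) he hck (s := s₁) hn hv
    rw [hf] at hc
    refine (hc fun τ => φ (unlift τ)).mono (by omega) ?_ ?_ fun _ _ => le_rfl
    · rw [unlift_lift, embedTapes, he.extend_apply, show c'.tape .output = tapeOf v from hv, hψv]
    · rintro _ rfl
      have := hn .output
      rw [show c'.tape .output = tapeOf v from hv] at this
      have := length_le_of_near this
      exact ⟨_, ⟨v, hRv, by omega, rfl⟩, rfl⟩
  have h6 : (moveClocks ck .left ;; call M e ck.toSet useOracle ;;
      clean ck (Set.range e \ {e .output})).OnStacks O (1 + (T + (9 * (m + T) + 10) + 1) + 1)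
      (setClocks ck m (Function.update s₁ (e .input) w))
      (fun s' => ∃ v, R v ∧ v.length ≤ w.length + T + 1 ∧
        s' = Function.update s₁ (e .output) v) φ (ρ + σ * M.prob O' w T A) := by
    refine Does.seq (h2 fun _ => ρ + σ * M.prob O' w T A) ?_
    rintro _ rfl
    exact (h3.seq h5).mono le_rfl h4 (fun _ => id) fun _ _ => le_rfl
  refine (h1.then (evals_tick.then h6)).mono_time ?_
  omega

end Prog

end

noncomputable section

/-! ### The tapes of the algorithm -/

/-- Names of work tapes. -/
inductive Var where
  | arg | inn | out | c₁ | c₂ | c₃ | el | un | lb | lk | la | ll | cn | t | u | v | zr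

instance : Finite Var :=
  @Finite.of_fintype Var (@Fintype.ofList Var (Classical.decEq _)
    [.arg, .inn, .out, .c₁, .c₂, .c₃, .el, .un, .lb, .lk, .la, .ll, .cn, .t, .u, .v, .zr]
    (by rintro (_ | _) <;> simp))

/-- The stacks of the algorithm; the other tapes are blank between calls of subroutines. -/
structure Mem where
  inp : List TapeSym := []
  flag : List TapeSym := []
  arg : List TapeSym := []
  out : List TapeSym := []
  el : List TapeSym := []
  un : List TapeSym := []
  lb : List TapeSym := []
  lk : List TapeSym := []
  la : List TapeSym := []
  ll : List TapeSym := []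
  cn : List TapeSym := []
  t : List TapeSym := []
  u : List TapeSym := []
  v : List TapeSym := []

namespace Mem

open TapeName Var
open scoped Classical

variable {X : Type} (m : Mem) (l : List TapeSym)

/-- The contents of the tapes. -/
def st (m : Mem) : Stacks (Var ⊕ X)
  | .input => m.inp
  | .output => m.flag
  | .query => []
  | .work (.inl .arg) => m.arg
  | .work (.inl .out) => m.out
  | .work (.inl .el) => m.el
  | .work (.inl .un) => m.un
  | .work (.inl .lb) => m.lb
  | .work (.inl .lk) => m.lk
  | .work (.inl .la) => m.la
  | .work (.inl .ll) => m.ll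
  | .work (.inl .cn) => m.cn
  | .work (.inl .t) => m.t
  | .work (.inl .u) => m.u
  | .work (.inl .v) => m.v
  | .work _ => []

/-- A work tape. -/
abbrev tp (x : Var) : TapeName (Var ⊕ X) := .work (.inl x)

@[simp] theorem st_input : m.st (X := X) .input = m.inp := rfl
@[simp] theorem st_output : m.st (X := X) .output = m.flag := rfl
@[simp] theorem st_arg : m.st (X := X) (.work (.inl .arg)) = m.arg := rfl
@[simp] theorem st_out : m.st (X := X) (.work (.inl .out)) = m.out := rfl
@[simp] theorem st_el : m.st (X := X) (.work (.inl .el)) = m.el := rfl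
@[simp] theorem st_un : m.st (X := X) (.work (.inl .un)) = m.un := rfl
@[simp] theorem st_lb : m.st (X := X) (.work (.inl .lb)) = m.lb := rfl
@[simp] theorem st_lk : m.st (X := X) (.work (.inl .lk)) = m.lk := rfl
@[simp] theorem st_la : m.st (X := X) (.work (.inl .la)) = m.la := rfl
@[simp] theorem st_ll : m.st (X := X) (.work (.inl .ll)) = m.ll := rfl
@[simp] theorem st_cn : m.st (X := X) (.work (.inl .cn)) = m.cn := rfl
@[simp] theorem st_t : m.st (X := X) (.work (.inl .t)) = m.t := rfl
@[simp] theorem st_u : m.st (X := X) (.work (.inl .u)) = m.u := rfl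
@[simp] theorem st_v : m.st (X := X) (.work (.inl .v)) = m.v := rfl
@[simp] theorem st_zr : m.st (X := X) (.work (.inl .zr)) = [] := rfl

theorem update_st {m m' : Mem} {i : TapeName (Var ⊕ X)} (h : m'.st i = l)
    (h' : ∀ j ≠ i, m'.st j = m.st j) : Function.update (m.st (X := X)) i l = m'.st := by
  funext j
  by_cases hj : j = i
  · subst hj
    rw [Function.update_self, h]
  · rw [Function.update_of_ne hj, h' j hj]

@[simp] theorem update_output :
    Function.update (m.st (X := X)) .output l = { m with flag := l }.st :=
  update_st _ rfl (by rintro (_ | _ | _ | ⟨x | x⟩) h <;> [rfl; simp at h; rfl; (cases x <;> rfl); rfl])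

@[simp] theorem update_arg :
    Function.update (m.st (X := X)) (.work (.inl .arg)) l = { m with arg := l }.st :=
  update_st _ rfl (by
    rintro (_ | _ | _ | ⟨x | x⟩) h <;> [rfl; rfl; rfl; (cases x <;> first | rfl | simp at h); rfl])

@[simp] theorem update_out :
    Function.update (m.st (X := X)) (.work (.inl .out)) l = { m with out := l }.st :=
  update_st _ rfl (by
    rintro (_ | _ | _ | ⟨x | x⟩) h <;> [rfl; rfl; rfl; (cases x <;> first | rfl | simp at h); rfl])

@[simp] theorem update_el :
    Function.update (m.st (X := X)) (.work (.inl .el)) l = { m with el := l }.st :=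
  update_st _ rfl (by
    rintro (_ | _ | _ | ⟨x | x⟩) h <;> [rfl; rfl; rfl; (cases x <;> first | rfl | simp at h); rfl])

@[simp] theorem update_un :
    Function.update (m.st (X := X)) (.work (.inl .un)) l = { m with un := l }.st :=
  update_st _ rfl (by
    rintro (_ | _ | _ | ⟨x | x⟩) h <;> [rfl; rfl; rfl; (cases x <;> first | rfl | simp at h); rfl])

@[simp] theorem update_lb :
    Function.update (m.st (X := X)) (.work (.inl .lb)) l = { m with lb := l }.st :=
  update_st _ rfl (by
    rintro (_ | _ | _ | ⟨x | x⟩) h <;> [rfl; rfl; rfl; (cases x <;> first | rfl | simp at h); rfl])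

@[simp] theorem update_lk :
    Function.update (m.st (X := X)) (.work (.inl .lk)) l = { m with lk := l }.st :=
  update_st _ rfl (by
    rintro (_ | _ | _ | ⟨x | x⟩) h <;> [rfl; rfl; rfl; (cases x <;> first | rfl | simp at h); rfl])

@[simp] theorem update_la :
    Function.update (m.st (X := X)) (.work (.inl .la)) l = { m with la := l }.st :=
  update_st _ rfl (by
    rintro (_ | _ | _ | ⟨x | x⟩) h <;> [rfl; rfl; rfl; (cases x <;> first | rfl | simp at h); rfl])

@[simp] theorem update_ll :
    Function.update (m.st (X := X)) (.work (.inl .ll)) l = { m with ll := l }.st :=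
  update_st _ rfl (by
    rintro (_ | _ | _ | ⟨x | x⟩) h <;> [rfl; rfl; rfl; (cases x <;> first | rfl | simp at h); rfl])

@[simp] theorem update_cn :
    Function.update (m.st (X := X)) (.work (.inl .cn)) l = { m with cn := l }.st :=
  update_st _ rfl (by
    rintro (_ | _ | _ | ⟨x | x⟩) h <;> [rfl; rfl; rfl; (cases x <;> first | rfl | simp at h); rfl])

@[simp] theorem update_t :
    Function.update (m.st (X := X)) (.work (.inl .t)) l = { m with t := l }.st :=
  update_st _ rfl (by
    rintro (_ | _ | _ | ⟨x | x⟩) h <;> [rfl; rfl; rfl; (cases x <;> first | rfl | simp at h); rfl])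

@[simp] theorem update_u :
    Function.update (m.st (X := X)) (.work (.inl .u)) l = { m with u := l }.st :=
  update_st _ rfl (by
    rintro (_ | _ | _ | ⟨x | x⟩) h <;> [rfl; rfl; rfl; (cases x <;> first | rfl | simp at h); rfl])

@[simp] theorem update_v :
    Function.update (m.st (X := X)) (.work (.inl .v)) l = { m with v := l }.st :=
  update_st _ rfl (by
    rintro (_ | _ | _ | ⟨x | x⟩) h <;> [rfl; rfl; rfl; (cases x <;> first | rfl | simp at h); rfl])

end Mem

end

noncomputable section

/-! ### Deterministic parts of the algorithm -/

namespace Prog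

open OracleTM Turing Stacks TapeSym Mem
open scoped Classical

section

variable {W : Type}

/-- Remove from the stack `j` as many members as there are on the stack `i`. -/
def subtract (i j : TapeName W) : Prog W := whileTop i Option.isSome (pop i ;; pop j)

/-- Halve the unary number on `i`; the result is on `t`. -/
def halve (i t : TapeName W) : Prog W :=
  whileTop i Option.isSome (pop i ;; ifTop i Option.isSome (pop i ;; push t (bit true)) (pop i))

/-- Compute the binary length of a unary number. -/
def binaryLength (i j t : TapeName W) : Prog W :=
  whileTop i Option.isSome (halve i t ;; moveAll t i ;; push j (bit true))

/-- Push several marks on a stack. -/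
def pushMany (i : TapeName W) : ℕ → Prog W
  | 0 => push i (bit true)
  | c + 1 => push i (bit true) ;; pushMany i c

end

/-- The symbol is a bit. -/
def isBit : Option TapeSym → Bool
  | some (bit _) => true
  | _ => false

/-- The symbol is the bit `b`. -/
def isBitOf (b : Bool) : Option TapeSym → Bool
  | some (bit b') => b == b'
  | _ => false

/-- The symbol is a comma. -/
def isComma : Option TapeSym → Bool
  | some comma => true
  | _ => false

/-- The symbol is a separator. -/
def isSemi : Option TapeSym → Bool
  | some semi => true
  | _ => false

section

variable {W : Type} [Finite W] {O : Set (List TapeSym)} {s : Stacks W} {i j t : TapeName W}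

theorem evals_subtract (hij : i ≠ j) : (subtract i j).Evals O (5 * (s i).length + 1) s
    (Function.update (Function.update s i []) j ((s j).drop (s i).length)) := by
  generalize hl : s i = l
  induction l generalizing s with
  | nil =>
    have h : Function.update s i [] = s := by rw [← hl, Function.update_eq_self]
    exact (Evals.while_stop (by simp [hl])).mono (by simp) (by simp [h])
  | cons a l ih =>
    refine (Evals.while_step (by simp [hl]) (evals_pop.seq evals_pop) (ih ?_)).mono ?_ ?_
    · simp [hij, hl]
    · simp only [List.length_cons]
      omega
    · funext k
      by_cases hk : k = j
      · subst hk; simp [hij.symm]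
      · by_cases hk' : k = i
        · subst hk'; simp [hij]
        · simp [hk, hk']

theorem unary_succ (n : ℕ) : unary (n + 1) = bit true :: unary n := rfl

theorem unary_append_cons (n : ℕ) (l : List TapeSym) :
    unary n ++ bit true :: l = bit true :: (unary n ++ l) := by
  rw [unary, ← List.singleton_append, ← List.append_assoc, ← List.replicate_succ']
  rfl

@[simp] theorem length_unary (n : ℕ) : (unary n).length = n := by simp [unary]

@[simp] theorem reverse_unary (n : ℕ) : (unary n).reverse = unary n := by simp [unary]

@[simp] theorem drop_unary (n k : ℕ) : (unary n).drop k = unary (n - k) := by simp [unary]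

@[simp] theorem unary_zero : unary 0 = [] := rfl

theorem evals_halve (hit : i ≠ t) {n : ℕ} (hi : s i = unary n) :
    (halve i t).Evals O (5 * n + 2) s
      (Function.update (Function.update s i []) t (unary (n / 2) ++ s t)) := by
  induction n using Nat.twoStepInduction generalizing s with
  | zero =>
    have h : Function.update s i [] = s := by rw [← unary_zero, ← hi, Function.update_eq_self]
    exact (Evals.while_stop (by simp [hi])).mono (by simp) (by simp [h])
  | one =>
    refine (Evals.while_step (by simp [hi, unary_succ])
      (evals_pop.seq (Evals.ifTop_false (by simp [hi, unary_succ]) evals_pop))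
      (Evals.while_stop (by simp [hi, unary_succ]))).mono (by omega) ?_
    funext k
    by_cases hk' : k = i
    · subst hk'; simp [hit, hi, unary_succ]
    · by_cases hk : k = t
      · subst hk; simp [hk']
      · simp [hk, hk']
  | more n ih _ =>
    refine (Evals.while_step (by simp [hi, unary_succ])
      (evals_pop.seq (Evals.ifTop_true (by simp [hi, unary_succ]) (evals_pop.seq evals_push)))
      (ih ?_)).mono (by omega) ?_
    · simp [hit, hi, unary_succ]
    · funext k
      by_cases hk' : k = i
      · subst hk'; simp [hit]
      · by_cases hk : k = t
        · subst hk; simp [hk', unary_append_cons, unary_succ]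
        · simp [hk, hk']

/-- The binary length is the number of halvings until zero is reached. The lengths form a geometric
series, so the total time is linear. -/
theorem evals_binaryLength (hit : i ≠ t) (hij : i ≠ j) (hjt : j ≠ t) {n : ℕ} (hi : s i = unary n)
    (ht : s t = []) : (binaryLength i j t).Evals O (60 * n + 1) s
      (Function.update (Function.update s i []) j (unary n.size ++ s j)) := by
  induction n using Nat.strong_induction_on generalizing s with
  | _ n ih =>
    obtain rfl | hn := Nat.eq_zero_or_pos n
    · have h : Function.update s i [] = s := by rw [← unary_zero, ← hi, Function.update_eq_self]
      exact (Evals.while_stop (by simp [hi])).mono (by simp) (by simp [h])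
    · have hsz : n.size = (n / 2).size + 1 := by
        have h := Nat.size_bit (b := n.bodd) (n := n.div2) (by simpa using hn.ne')
        rwa [Nat.bit_bodd_div2, Nat.div2_val] at h
      have h0 : (unary n).head?.isSome := by
        cases n with
        | zero => omega
        | succ n => simp [unary_succ]
      refine (Evals.while_step (by simpa [hi] using h0) ((evals_halve hit hi).seq
        ((evals_moveAll hit.symm).seq evals_push)) (ih (n / 2) (by omega) ?_ ?_)).mono ?_ ?_
      · simp [hij, hit, ht]
      · simp [hjt.symm, hit.symm]
      · simp [ht]
        omega
      · funext k
        by_cases hk' : k = i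
        · subst hk'; simp [hij]
        · by_cases hk : k = t
          · subst hk; simp [hk', ht, hjt.symm]
          · by_cases hk'' : k = j
            · subst hk''; simp [hk', hk, hsz, unary_append_cons, unary_succ]
            · simp [hk, hk', hk'']

theorem evals_pushMany (c : ℕ) : (pushMany i c).Evals O (4 * c + 3) s
    (Function.update s i (unary (c + 1) ++ s i)) := by
  induction c generalizing s with
  | zero => exact evals_push
  | succ c ih =>
    refine (evals_push.seq ih).mono (by omega) ?_
    simp [unary_append_cons, unary_succ]

end

variable {X : Type} [Finite X] {O : Set (List TapeSym)} (m : Mem)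

/-- The list that encodes a list of bit strings. -/
def encode (L : List (List Bool)) : List TapeSym := L.flatMap fun a => ofBits a ++ [comma]

theorem encode_cons (a : List Bool) (L : List (List Bool)) :
    encode (a :: L) = ofBits a ++ comma :: encode L := by
  simp [encode]

theorem length_le_length_encode (L : List (List Bool)) : L.length ≤ (encode L).length := by
  induction L with
  | nil => simp
  | cons a L ih =>
    simp [encode_cons]
    omega

/-- Move the ground set from `out` to `el`, and count its elements on `un`. -/
def loadGround : Prog (Var ⊕ X) :=
  whileTop (tp .out) Option.isSome (cpy (tp .out) (tp .t) ;;
    ifTop (tp .out) isComma (push (tp .un) (bit true) ;; pop (tp .out)) (pop (tp .out))) ;;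
  moveAll (tp .t) (tp .el)

/-- The number of commas. -/
def commas (l : List TapeSym) : ℕ := l.countP fun a => isComma (some a)

theorem commas_append (l l' : List TapeSym) : commas (l ++ l') = commas l + commas l' :=
  List.countP_append

theorem commas_cons (a : TapeSym) (l : List TapeSym) :
    commas (a :: l) = commas l + if isComma (some a) then 1 else 0 :=
  List.countP_cons

theorem commas_ofBits (a : List Bool) : commas (ofBits a) = 0 := by
  simp [commas, ofBits, List.countP_map, isComma, Function.comp_def]

/-- Every member is closed by a comma, so counting commas yields |E| in unary. -/
theorem commas_encode (L : List (List Bool)) : commas (encode L) = L.length := by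
  induction L with
  | nil => rfl
  | cons a L ih =>
    rw [encode_cons, commas_append, commas_ofBits, commas_cons, ih]
    simp [isComma]

theorem evals_loadGround_aux {w : List TapeSym} (hw : m.out = w) :
    (whileTop (tp .out) Option.isSome (cpy (tp .out) (tp .t) ;;
    ifTop (tp .out) isComma (push (tp .un) (bit true) ;; pop (tp .out)) (pop (tp .out)))).Evals O
      (12 * w.length + 1) (m.st (X := X))
      { m with out := [], t := w.reverse ++ m.t, un := unary (commas w) ++ m.un }.st := by
  induction w generalizing m with
  | nil =>
    obtain ⟨⟩ := m
    cases hw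
    exact (Evals.while_stop (by simp)).mono (by simp)
  | cons a w ih =>
    by_cases ha : isComma (some a) = true
    · refine (Evals.while_step (by simp [hw])
        ((evals_cpy (a := a) (l := w) (by simp) (by simp [hw])).seq
          (Evals.ifTop_true (by simp [hw, ha]) (evals_push.seq evals_pop)))
        ((ih { m with out := w, t := a :: m.t, un := bit true :: m.un } rfl).start
          (by simp [hw]))).mono ?_ ?_
      · simp only [List.length_cons]; omega
      · simp [commas_cons, ha, unary_append_cons, unary_succ]
    · refine (Evals.while_step (by simp [hw])
        ((evals_cpy (a := a) (l := w) (by simp) (by simp [hw])).seq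
          (Evals.ifTop_false (by simpa [hw] using ha) evals_pop))
        ((ih { m with out := w, t := a :: m.t } rfl).start (by simp [hw]))).mono ?_ ?_
      · simp only [List.length_cons]; omega
      · simp [commas_cons, ha]

theorem evals_loadGround {L : List (List Bool)} (ho : m.out = encode L) (ht : m.t = [])
    (hu : m.un = []) (he : m.el = []) :
    (loadGround (X := X)).Evals O (19 * (encode L).length + 3) m.st
      { m with out := [], el := encode L, un := unary L.length }.st := by
  refine ((evals_loadGround_aux m ho).seq (evals_moveAll (by simp))).mono ?_ ?_
  · simp [ht]
    omega
  · simp [ht, hu, he, commas_encode]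

/-- Compute the parameters `b` and `k`. -/
def computeParams : Prog (Var ⊕ X) :=
  dup (tp .un) (tp .u) (tp .t) ;; binaryLength (tp .u) (tp .lb) (tp .t) ;;
  dup (tp .lb) (tp .u) (tp .t) ;; binaryLength (tp .u) (tp .lk) (tp .t)

theorem size_le (n : ℕ) : n.size ≤ n := Nat.size_le.2 n.lt_two_pow_self

theorem evals_computeParams {n : ℕ} (hn : m.un = unary n) (hu : m.u = []) (ht : m.t = [])
    (hb : m.lb = []) (hk : m.lk = []) :
    (computeParams (X := X)).Evals O (160 * n + 20) m.st
      { m with lb := unary n.size, lk := unary n.size.size }.st := by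
  have h := size_le n
  refine ((evals_dup (by simp) (by simp) (by simp) (by simp [ht])).seq
    ((evals_binaryLength (n := n) (by simp) (by simp) (by simp) (by simp [hn, hu])
      (by simp [ht])).seq ((evals_dup (by simp) (by simp) (by simp) (by simp [ht])).seq
      (evals_binaryLength (n := n.size) (by simp) (by simp) (by simp) (by simp [hb])
      (by simp [ht]))))).mono ?_ ?_
  · simp [hn, hb]
    omega
  · simp [hb, hk, hu]

/-- The argument for the optimizer. -/
def optimizerArg : Prog (Var ⊕ X) :=
  dup (tp .un) (tp .arg) (tp .t) ;; push (tp .arg) semi ;; dup (tp .lk) (tp .arg) (tp .t)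

theorem evals_optimizerArg {n k : ℕ} (hn : m.un = unary n) (hk : m.lk = unary k) (ht : m.t = [])
    (ha : m.arg = []) :
    (optimizerArg (X := X)).Evals O (18 * n + 18 * k + 20) m.st
      { m with arg := (unary n ++ semi :: unary k).reverse }.st := by
  refine ((evals_dup (by simp) (by simp) (by simp) (by simp [ht])).seq (evals_push.seq
    (evals_dup (by simp) (by simp) (by simp) (by simp [ht])))).mono ?_ ?_
  · simp [hn, hk]
    omega
  · simp [hn, hk, ha]

/-- Compute `ℓ = k - t` and `a = b - k - 3`. -/
def computeStep : Prog (Var ⊕ X) :=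
  dup (tp .lk) (tp .ll) (tp .t) ;; subtract (tp .out) (tp .ll) ;;
  dup (tp .lb) (tp .la) (tp .t) ;; dup (tp .lk) (tp .u) (tp .t) ;; subtract (tp .u) (tp .la) ;;
  pop (tp .la) ;; pop (tp .la) ;; pop (tp .la)

theorem tail_unary (n : ℕ) : (unary n).tail = unary (n - 1) := by
  cases n <;> simp [unary_succ]

/-- When b and k are the iterated binary lengths of n, the stack `la` receives `gain n`; the three
final pops are the 3 in its definition. -/
theorem evals_computeStep {b k t : ℕ} (hb : m.lb = unary b) (hk : m.lk = unary k)
    (ho : m.out = unary t) (ht : m.t = []) (hl : m.ll = []) (ha : m.la = []) (hu : m.u = []) :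
    (computeStep (X := X)).Evals O (18 * b + 50 * k + 5 * t + 30) m.st
      { m with out := [], ll := unary (k - t), la := unary (b - k - 3) }.st := by
  refine ((evals_dup (by simp) (by simp) (by simp) (by simp [ht])).seq
    ((evals_subtract (by simp)).seq ((evals_dup (by simp) (by simp) (by simp) (by simp [ht])).seq
    ((evals_dup (by simp) (by simp) (by simp) (by simp [ht])).seq ((evals_subtract (by simp)).seq
    (evals_pop.seq (evals_pop.seq evals_pop))))))).mono ?_ ?_
  · simp [hb, hk, ho, hu]
    omega
  · simp [hb, hk, ho, hu, hl, ha, tail_unary, Nat.sub_sub]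

/-- Fill the counter with `n + (c + 1) - ℓ * a` marks. -/
def fillCounter (c : ℕ) : Prog (Var ⊕ X) :=
  dup (tp .un) (tp .cn) (tp .t) ;; pushMany (tp .cn) c ;; dup (tp .ll) (tp .v) (tp .t) ;;
  whileTop (tp .v) Option.isSome
    (dup (tp .la) (tp .u) (tp .t) ;; subtract (tp .u) (tp .cn) ;; pop (tp .v))

theorem evals_fillCounter_aux {a l N : ℕ} (ha : m.la = unary a) (hv : m.v = unary l)
    (hc : m.cn = unary N) (hu : m.u = []) (ht : m.t = []) :
    (whileTop (tp .v) Option.isSome (dup (tp .la) (tp .u) (tp .t) ;;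
      subtract (tp .u) (tp .cn) ;; pop (tp .v))).Evals O (l * (23 * a + 20) + 1) (m.st (X := X))
      { m with v := [], cn := unary (N - l * a) }.st := by
  induction l generalizing m N with
  | zero =>
    obtain ⟨⟩ := m
    dsimp only at hv hc
    subst hv hc
    exact (Evals.while_stop (by simp)).mono (by simp) (by simp)
  | succ l ih =>
    refine (Evals.while_step (by simp [hv, unary_succ])
      ((evals_dup (by simp) (by simp) (by simp) (by simp [ht])).seq
        ((evals_subtract (by simp)).seq evals_pop))
      ((ih { m with v := unary l, cn := unary (N - a) } ha rfl rfl hu ht).start ?_)).mono ?_ ?_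
    · simp [hv, hc, hu, ha, unary_succ]
    · simp [ha, hu]
      ring_nf
      omega
    · simp [Nat.sub_sub, Nat.succ_mul, add_comm]

/-- The marks are later read as binary digits: a unary number L becomes the counter value 2^L − 1
without any computation. -/
theorem evals_fillCounter {n a l c : ℕ} (hn : m.un = unary n) (ha : m.la = unary a)
    (hl : m.ll = unary l) (hc : m.cn = []) (hu : m.u = []) (ht : m.t = []) (hv : m.v = []) :
    (fillCounter (X := X) c).Evals O (18 * n + 4 * c + l * (23 * a + 38) + 20) m.st
      { m with cn := unary (n + (c + 1) - l * a) }.st := by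
  refine ((evals_dup (by simp) (by simp) (by simp) (by simp [ht])).seq
    ((evals_pushMany c).seq ((evals_dup (by simp) (by simp) (by simp) (by simp [ht])).seq
    ((evals_fillCounter_aux { m with cn := unary (n + (c + 1)), v := unary l } ha rfl rfl hu
      ht).start ?_)))).mono ?_ ?_
  · simp [hn, hl, hc, hv]
    simp [unary, List.replicate_append_replicate, add_comm]
  · simp [hn, hl]
    ring_nf
    omega
  · simp [hv]

/-- The number with the given bits, least significant bit first. -/
def bitVal : List Bool → ℕ
  | [] => 0
  | b :: l => b.toNat + 2 * bitVal l

/-- Decrement the binary counter; empty it if it is zero. -/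
def decrement : Prog (Var ⊕ X) :=
  whileTop (tp .cn) (isBitOf false) (pop (tp .cn) ;; push (tp .t) (bit true)) ;;
  ifTop (tp .cn) Option.isSome
    (pop (tp .cn) ;; push (tp .cn) (bit false) ;; moveAll (tp .t) (tp .cn)) (clear (tp .t))

theorem evals_decrement_aux (z : ℕ) {l : List TapeSym}
    (hl : isBitOf false l.head? = false)
    (hc : m.cn = ofBits (List.replicate z false) ++ l) :
    (whileTop (tp .cn) (isBitOf false) (pop (tp .cn) ;; push (tp .t) (bit true))).Evals O
      (7 * z + 1) (m.st (X := X)) { m with cn := l, t := unary z ++ m.t }.st := by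
  induction z generalizing m with
  | zero =>
    obtain ⟨⟩ := m
    cases hc
    exact (Evals.while_stop (by simpa using hl)).mono (by simp) (by simp)
  | succ z ih =>
    refine (Evals.while_step (by simp [hc, ofBits, List.replicate_succ, isBitOf])
      (evals_pop.seq evals_push) ((ih
      { m with cn := ofBits (List.replicate z false) ++ l, t := bit true :: m.t } rfl).start ?_)).mono (by omega) ?_
    · simp [hc, ofBits, List.replicate_succ]
    · simp [unary_append_cons, unary_succ]

theorem bitVal_eq_zero {l : List Bool} (h : bitVal l = 0) : l = List.replicate l.length false := by
  induction l with
  | nil => rfl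
  | cons b l ih =>
    cases b
    · simp only [bitVal, Bool.toNat_false] at h
      rw [List.length_cons, List.replicate_succ, ← ih (by omega)]
    · simp [bitVal] at h

/-- Subtraction of one with borrow: the zeros below the lowest one turn into ones, and that one
turns into a zero. -/
theorem exists_of_bitVal {l : List Bool} (h : bitVal l ≠ 0) :
    ∃ z l', l = List.replicate z false ++ true :: l' ∧
      bitVal (List.replicate z true ++ false :: l') + 1 = bitVal l := by
  induction l with
  | nil => simp [bitVal] at h
  | cons b l ih =>
    cases b
    · obtain ⟨z, l', h1, h2⟩ := ih (by simpa [bitVal] using h)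
      refine ⟨z + 1, l', by rw [h1]; rfl, ?_⟩
      simp only [List.replicate_succ, List.cons_append, bitVal, Bool.toNat_true, Bool.toNat_false]
      omega
    · exact ⟨0, l, rfl, by simp [bitVal, add_comm]⟩

theorem evals_decrement_zero {l : List Bool} (hc : m.cn = ofBits l) (hl : bitVal l = 0)
    (ht : m.t = []) : (decrement (X := X)).Evals O (10 * l.length + 5) m.st
      { m with cn := [] }.st := by
  refine ((evals_decrement_aux m l.length (l := []) rfl ?_).seq
    (Evals.ifTop_false (by simp) evals_clear)).mono ?_ ?_
  · rw [hc, List.append_nil, ← bitVal_eq_zero hl]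
  · simp [ht]
    omega
  · simp [ht]

end Prog

end

noncomputable section

/-! ### Random parts of the algorithm -/

namespace Prog

open OracleTM Turing Stacks TapeSym Mem
open scoped Classical

/-- The expectation of `f` for a random sublist that contains each member with probability `α`,
where `β` is the probability that a member is left out. -/
def weightedSum (α β : ENNReal) :
    List (List Bool) → (List (List Bool) → ENNReal) → ENNReal
  | [], f => f []
  | a :: L, f => α * weightedSum α β L (fun Y => f (a :: Y)) + β * weightedSum α β L f

theorem weightedSum_add_mul {α β : ENNReal} (h : α + β = 1) (ρ σ : ENNReal)
    (L : List (List Bool)) (f : List (List Bool) → ENNReal) :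
    weightedSum α β L (fun Y => ρ + σ * f Y) = ρ + σ * weightedSum α β L f := by
  induction L generalizing f with
  | nil => rfl
  | cons a L ih =>
    simp only [weightedSum, ih]
    calc α * (ρ + σ * weightedSum α β L fun Y => f (a :: Y)) + β * (ρ + σ * weightedSum α β L f)
        = (α + β) * ρ + σ * (α * weightedSum α β L (fun Y => f (a :: Y)) +
            β * weightedSum α β L f) := by ring
      _ = _ := by rw [h, one_mul]

theorem weightedSum_mono {α β : ENNReal} {L : List (List Bool)}
    {f g : List (List Bool) → ENNReal} (h : ∀ Y, Y.Sublist L → f Y ≤ g Y) :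
    weightedSum α β L f ≤ weightedSum α β L g := by
  induction L generalizing f g with
  | nil => exact h [] (List.Sublist.refl _)
  | cons a L ih =>
    exact add_le_add (mul_le_mul_right (ih fun Y hY => h _ (hY.cons_cons a)) _)
      (mul_le_mul_right (ih fun Y hY => h _ (hY.cons a)) _)

/-- The recursive form follows the machine, which tosses for one element after the other; the sum
over subsets is the form in which good sets can be counted. -/
theorem weightedSum_eq_sum (α β : ENNReal) {L : List (List Bool)} (hL : L.Nodup)
    (f : List (List Bool) → ENNReal) :
    weightedSum α β L f = ∑ X ∈ L.toFinset.powerset,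
      α ^ X.card * β ^ (L.length - X.card) * f (L.filter (· ∈ X)) := by
  induction L generalizing f with
  | nil => simp [weightedSum]
  | cons a L ih =>
    have ha : a ∉ L.toFinset := by simpa using (List.nodup_cons.1 hL).1
    have hcard : L.toFinset.card = L.length := List.toFinset_card_of_nodup (List.nodup_cons.1 hL).2
    rw [List.toFinset_cons, Finset.sum_powerset_insert ha, weightedSum, ih (List.nodup_cons.1 hL).2,
      ih (List.nodup_cons.1 hL).2, add_comm, Finset.mul_sum, Finset.mul_sum]
    congr 1
    · refine Finset.sum_congr rfl fun X hX => ?_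
      have hX := Finset.mem_powerset.1 hX
      have haX : a ∉ X := fun h => ha (hX h)
      have := Finset.card_le_card hX
      rw [List.filter_cons_of_neg (by simpa using haX), List.length_cons,
        show L.length + 1 - X.card = (L.length - X.card) + 1 by omega, pow_succ]
      ring
    · refine Finset.sum_congr rfl fun X hX => ?_
      have hX := Finset.mem_powerset.1 hX
      have haX : a ∉ X := fun h => ha (hX h)
      have hf : L.filter (· ∈ insert a X) = L.filter (· ∈ X) := by
        refine List.filter_congr fun b hb => ?_
        have : b ≠ a := by rintro rfl; exact ha (by simpa using hb)
        simp [this]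
      rw [List.filter_cons_of_pos (by simp), hf, Finset.card_insert_of_notMem haX,
        List.length_cons, Nat.add_sub_add_right, pow_succ]
      ring

variable {X : Type} [Finite X] {O : Set (List TapeSym)} (m : Mem)

/-- Move an element from `el` to `t` and to `arg`. -/
def takeElem : Prog (Var ⊕ X) :=
  whileTop (tp .el) isBit (cpy (tp .el) (tp .arg) ;; cpy (tp .el) (tp .t) ;; pop (tp .el)) ;;
    cpy (tp .el) (tp .arg) ;; cpy (tp .el) (tp .t) ;; pop (tp .el)

/-- Move an element from `el` to `t`. -/
def skipElem : Prog (Var ⊕ X) :=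
  whileTop (tp .el) isBit (cpy (tp .el) (tp .t) ;; pop (tp .el)) ;;
    cpy (tp .el) (tp .t) ;; pop (tp .el)

theorem evals_takeElem_aux {a : List Bool} {w : List TapeSym}
    (h : m.el = ofBits a ++ comma :: w) :
    (whileTop (tp .el) isBit (cpy (tp .el) (tp .arg) ;; cpy (tp .el) (tp .t) ;;
      pop (tp .el))).Evals O (11 * a.length + 1) (m.st (X := X))
      { m with el := comma :: w, arg := (ofBits a).reverse ++ m.arg,
               t := (ofBits a).reverse ++ m.t }.st := by
  induction a generalizing m with
  | nil =>
    obtain ⟨⟩ := m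
    cases h
    exact (Evals.while_stop (by simp [isBit])).mono (by simp) (by simp [ofBits])
  | cons b a ih =>
    have h' : m.el = bit b :: (ofBits a ++ comma :: w) := h
    refine (Evals.while_step (by simp [h', isBit])
      ((evals_cpy (a := bit b) (l := ofBits a ++ comma :: w) (by simp) (by simp [h'])).seq
        ((evals_cpy (a := bit b) (l := ofBits a ++ comma :: w) (by simp) (by simp [h'])).seq
          evals_pop))
      ((ih { m with el := ofBits a ++ comma :: w, arg := bit b :: m.arg, t := bit b :: m.t }
        rfl).start ?_)).mono ?_ ?_
    · simp [h']
    · simp only [List.length_cons]; omega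
    · simp [ofBits]

theorem evals_takeElem {a : List Bool} {w : List TapeSym} (h : m.el = ofBits a ++ comma :: w) :
    (takeElem (X := X)).Evals O (11 * a.length + 11) m.st
      { m with el := w, arg := (ofBits a ++ [comma]).reverse ++ m.arg,
               t := (ofBits a ++ [comma]).reverse ++ m.t }.st := by
  refine ((evals_takeElem_aux m h).seq
    ((evals_cpy (a := comma) (l := w) (by simp) (by simp)).seq
      ((evals_cpy (a := comma) (l := w) (by simp) (by simp)).seq evals_pop))).mono (by omega) ?_
  simp

theorem evals_skipElem_aux {a : List Bool} {w : List TapeSym}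
    (h : m.el = ofBits a ++ comma :: w) :
    (whileTop (tp .el) isBit (cpy (tp .el) (tp .t) ;; pop (tp .el))).Evals O (7 * a.length + 1)
      (m.st (X := X)) { m with el := comma :: w, t := (ofBits a).reverse ++ m.t }.st := by
  induction a generalizing m with
  | nil =>
    obtain ⟨⟩ := m
    cases h
    exact (Evals.while_stop (by simp [isBit])).mono (by simp) (by simp [ofBits])
  | cons b a ih =>
    have h' : m.el = bit b :: (ofBits a ++ comma :: w) := h
    refine (Evals.while_step (by simp [h', isBit])
      ((evals_cpy (a := bit b) (l := ofBits a ++ comma :: w) (by simp) (by simp [h'])).seq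
          evals_pop)
      ((ih { m with el := ofBits a ++ comma :: w, t := bit b :: m.t } rfl).start ?_)).mono ?_ ?_
    · simp [h']
    · simp only [List.length_cons]; omega
    · simp [ofBits]

theorem evals_skipElem {a : List Bool} {w : List TapeSym} (h : m.el = ofBits a ++ comma :: w) :
    (skipElem (X := X)).Evals O (11 * a.length + 11) m.st
      { m with el := w, t := (ofBits a ++ [comma]).reverse ++ m.t }.st := by
  refine ((evals_skipElem_aux m h).seq
    ((evals_cpy (a := comma) (l := w) (by simp) (by simp)).seq evals_pop)).mono (by omega) ?_
  simp

/-- A random choice between two programs, with probabilities `α` and `β`. -/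
def IsChoice (O : Set (List TapeSym)) (α β : ENNReal)
    (pick : Prog (Var ⊕ X) → Prog (Var ⊕ X) → Prog (Var ⊕ X)) : Prop :=
  ∀ ⦃P₁ P₂ T s Q φ r₁ r₂⦄, P₁.OnStacks O T s Q φ r₁ → P₂.OnStacks O T s Q φ r₂ →
    (pick P₁ P₂).OnStacks O (T + 2) s Q φ (α * r₁ + β * r₂)

theorem isChoice_coin : IsChoice (X := X) O (1 / 2) (1 / 2) coin := by
  intro P₁ P₂ T s Q φ r₁ r₂ h₁ h₂
  refine (h₁.coin h₂).mono (by omega) (le_of_eq ?_) (fun _ => id) fun _ _ => le_rfl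
  rw [ENNReal.add_div, one_div, ENNReal.div_eq_inv_mul, ENNReal.div_eq_inv_mul]

/-- Two heads in a row have probability 1/4; in all other cases `P₂` is run. -/
theorem isChoice_coin_coin :
    IsChoice (X := X) O (1 / 4) (3 / 4) fun P₁ P₂ => coin (coin P₁ P₂) P₂ := by
  intro P₁ P₂ T s Q φ r₁ r₂ h₁ h₂
  refine ((h₁.coin h₂).coin (h₂.mono_time (by omega))).mono (by omega) (le_of_eq ?_)
    (fun _ => id) fun _ _ => le_rfl
  have h4 : (2 : ENNReal)⁻¹ * 2⁻¹ = 4⁻¹ := by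
    rw [← ENNReal.mul_inv (by simp) (by simp)]; norm_num
  have h3 : (3 : ENNReal) / 4 = 4⁻¹ + 2⁻¹ := by
    have : (2 : ENNReal)⁻¹ = 2 * 4⁻¹ := by
      rw [← h4, ← mul_assoc, ENNReal.mul_inv_cancel (by simp) (by simp), one_mul]
    rw [this, ENNReal.div_eq_inv_mul]
    ring
  rw [h3, one_div, ENNReal.div_eq_inv_mul, ENNReal.div_eq_inv_mul, ← h4]
  ring

/-- Push a random sublist of the list on `el` on the stack `arg`. -/
def sample (pick : Prog (Var ⊕ X) → Prog (Var ⊕ X) → Prog (Var ⊕ X)) : Prog (Var ⊕ X) :=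
  whileTop (tp .el) Option.isSome (pick takeElem skipElem) ;; moveAll (tp .t) (tp .el)

theorem onStacks_sample_aux {α β : ENNReal}
    {pick : Prog (Var ⊕ X) → Prog (Var ⊕ X) → Prog (Var ⊕ X)} (hp : IsChoice O α β pick)
    {φ : Stacks (Var ⊕ X) → ENNReal} {L : List (List Bool)} (hL : m.el = encode L) :
    (whileTop (tp .el) Option.isSome (pick takeElem skipElem)).OnStacks O
      (15 * (encode L).length + 1) m.st
      (fun s => ∃ Y, Y.Sublist L ∧ s = { m with
        el := [], arg := (encode Y).reverse ++ m.arg, t := (encode L).reverse ++ m.t }.st) φ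
      (weightedSum α β L fun Y => φ { m with
        el := [], arg := (encode Y).reverse ++ m.arg, t := (encode L).reverse ++ m.t }.st) := by
  induction L generalizing m with
  | nil =>
    refine ((Evals.while_stop ?_).mono (by simp) rfl).onStacks ⟨[], .refl _, ?_⟩ (le_of_eq ?_)
    · simp [hL, encode]
    all_goals
      obtain ⟨⟩ := m
      cases hL
      simp [encode, weightedSum]
  | cons a L ih =>
    rw [encode_cons] at hL
    set m₁ : Mem := { m with
      el := encode L, arg := (ofBits a ++ [comma]).reverse ++ m.arg,
      t := (ofBits a ++ [comma]).reverse ++ m.t } with hm₁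
    set m₂ : Mem := { m with el := encode L, t := (ofBits a ++ [comma]).reverse ++ m.t } with hm₂
    set v₁ := weightedSum α β L fun Y => φ { m₁ with
        el := [], arg := (encode Y).reverse ++ m₁.arg, t := (encode L).reverse ++ m₁.t }.st with hv₁
    set v₂ := weightedSum α β L fun Y => φ { m₂ with
        el := [], arg := (encode Y).reverse ++ m₂.arg, t := (encode L).reverse ++ m₂.t }.st with hv₂
    have h0 : (ofBits a ++ comma :: encode L).head?.isSome = true := by
      cases a <;> simp [ofBits]
    -- The value after the treatment of one element must be a function of the stacks. Written by
    -- means of updates, one formula serves both outcomes.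
    set ψ : Stacks (Var ⊕ X) → ENNReal := fun s => weightedSum α β L fun Y =>
      φ (Function.update (Function.update (Function.update s (tp .el) []) (tp .arg)
        ((encode Y).reverse ++ s (tp .arg))) (tp .t) ((encode L).reverse ++ s (tp .t))) with hψ
    have hψ₁ : ψ m₁.st = v₁ := by simp [hψ, hv₁]
    have hψ₂ : ψ m₂.st = v₂ := by simp [hψ, hv₂]
    have hbody := hp (T := 11 * a.length + 11) (φ := ψ) (r₁ := v₁) (r₂ := v₂)
      (Q := fun s => s = m₁.st ∨ s = m₂.st) ((evals_takeElem m hL).onStacks (.inl rfl) hψ₁.ge)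
      ((evals_skipElem m hL).onStacks (.inr rfl) hψ₂.ge)
    refine (OnStacks.while_step (T₂ := 15 * (encode L).length + 1) (by simp [hL, ofBits])
      hbody ?_).mono ?_ (le_of_eq ?_) (fun _ => id) fun _ _ => le_rfl
    · rintro s (rfl | rfl)
      · rw [hψ₁]
        refine (ih m₁ rfl).mono le_rfl le_rfl ?_ fun _ _ => le_rfl
        rintro _ ⟨Y, hY, rfl⟩
        exact ⟨a :: Y, hY.cons_cons a, by simp [hm₁, encode_cons]⟩
      · rw [hψ₂]
        refine (ih m₂ rfl).mono le_rfl le_rfl ?_ fun _ _ => le_rfl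
        rintro _ ⟨Y, hY, rfl⟩
        exact ⟨Y, hY.cons a, by simp [hm₂, encode_cons]⟩
    · simp [encode_cons, ofBits]
      omega
    · rw [weightedSum, hv₁, hv₂]
      simp [hm₁, hm₂, encode_cons]

theorem onStacks_sample {α β : ENNReal}
    {pick : Prog (Var ⊕ X) → Prog (Var ⊕ X) → Prog (Var ⊕ X)} (hp : IsChoice O α β pick)
    {φ : Stacks (Var ⊕ X) → ENNReal} {L : List (List Bool)} (hL : m.el = encode L)
    (ht : m.t = []) :
    (sample pick).OnStacks O (22 * (encode L).length + 3) m.st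
      (fun s => ∃ Y, Y.Sublist L ∧ s = { m with arg := (encode Y).reverse ++ m.arg }.st) φ
      (weightedSum α β L fun Y => φ { m with arg := (encode Y).reverse ++ m.arg }.st) := by
  refine ((onStacks_sample_aux m hp (φ := fun s => φ (Function.update (Function.update s (tp .t) [])
    (tp .el) (encode L))) hL).seq (T₂ := 7 * (encode L).length + 1) (φ' := φ) ?_).mono
    (by omega) (le_of_eq ?_) (fun _ => id) fun _ _ => le_rfl
  · rintro _ ⟨Y, hY, rfl⟩
    refine ((evals_moveAll (by simp)).mono ?_ rfl).onStacks ⟨Y, hY, ?_⟩ (le_of_eq ?_)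
    · simp [ht]
    · simp [ht, hL]
    · simp [ht]
  · obtain ⟨⟩ := m
    dsimp only at hL ht
    subst hL ht
    simp

/-- The tapes of a machine that is called as a subroutine. -/
def callTapes {V : Type} (κ : V → X) : TapeName V → TapeName (Var ⊕ X)
  | .input => tp .inn
  | .output => tp .out
  | .query => .query
  | .work i => .work (.inr (κ i))

theorem callTapes_injective {V Y : Type} {κ : V → Y} (hκ : Function.Injective κ) :
    Function.Injective (callTapes κ) := by
  rintro (_ | _ | _ | i) (_ | _ | _ | j) h <;> simp [callTapes] at h ⊢
  exact hκ h

/-- The clocks. -/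
def clocks (X : Type) : Clocks (Var ⊕ X) where
  c₁ := tp .c₁
  c₂ := tp .c₂
  c₃ := tp .c₃
  ne₁₂ := by simp
  ne₁₃ := by simp
  ne₂₃ := by simp

/-- Call a machine. -/
def callSub (M : OracleTM) (κ : M.Work → X) (useOracle : Bool) : Prog (Var ⊕ X) :=
  subroutine M (callTapes κ) (clocks X) (tp .arg) useOracle

theorem onStacks_callSub {M : OracleTM} {κ : M.Work → X} (hκ : Function.Injective κ)
    {useOracle : Bool} {O' : Set (List TapeSym)}
    (hO : ∀ T, answer O' T = (useOracle && answer O T)) {w : List TapeSym} {T : ℕ}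
    {R A : List TapeSym → Prop} (hR : M.Surely O' w T R) (ho : m.out = [])
    (hw : m.arg = w.reverse) {φ : Stacks (Var ⊕ X) → ENNReal} {ρ σ : ENNReal}
    (hρ : ∀ v, R v → ρ ≤ φ { m with arg := [], out := v }.st)
    (hσ : ∀ v, R v → A v → ρ + σ ≤ φ { m with arg := [], out := v }.st) :
    (callSub M κ useOracle).OnStacks O (28 * w.length + 10 * T + 39) m.st
      (fun s => ∃ v, R v ∧ v.length ≤ w.length + T + 1 ∧ s = { m with arg := [], out := v }.st) φ
      (ρ + σ * M.prob O' w T A) := by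
  have hu (v) : Function.update (Function.update (m.st (X := X)) (tp .arg) [])
      (callTapes κ .output) v = { m with arg := [], out := v }.st := by
    simp [callTapes]
  simp only [← hu] at hρ hσ ⊢
  refine onStacks_subroutine (callTapes_injective hκ) rfl ?_ ?_ ?_ hO hR ?_ (by simpa using hw) hρ hσ
  · rintro _ (rfl | rfl | rfl) ⟨_ | _ | _ | i, h⟩ <;> simp [callTapes, clocks] at h
  · rintro ⟨_ | _ | _ | i, h⟩ <;> simp [callTapes] at h
  · rintro (h | h | h) <;> simp [clocks] at h
  · rintro _ (⟨_ | _ | _ | i, rfl⟩ | rfl | rfl | rfl)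
    · rfl
    · exact ho
    all_goals rfl

end Prog

end

noncomputable section

/-! ### One trial -/

namespace SetInstance

open TapeSym

/-- The input of the extension algorithm. -/
def extensionInput (I : SetInstance) (X : Finset (List Bool)) (ℓ : ℕ) : List TapeSym :=
  ofBits I.B ++ semi :: ofSet X ++ semi :: unary ℓ

/-- What the extension algorithm may return. -/
def IsAnswer (I : SetInstance) (X : Finset (List Bool)) (ℓ : ℕ) (v : List TapeSym) : Prop :=
  ∃ S, I.IsExtension X ℓ S ∧ v = ofSet S

/-- The specification of an extension algorithm on one instance and for one value of `ℓ`. -/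
def Extends (I : SetInstance) (M : OracleTM) (ℓ T : ℕ) : Prop :=
  ∀ X ⊆ I.E,
    M.Surely I.oracleWords (I.extensionInput X ℓ) T (fun v => v = bot ∨ I.IsAnswer X ℓ v) ∧
    ((∃ S, I.IsExtension X ℓ S) →
      1 / 2 ≤ M.prob I.oracleWords (I.extensionInput X ℓ) T (I.IsAnswer X ℓ))

open Classical in
/-- A lower bound for the probability that the extension algorithm succeeds. -/
def chance (I : SetInstance) (ℓ : ℕ) (Y : List (List Bool)) : ENNReal :=
  if ∃ S, I.IsExtension Y.toFinset ℓ S then 1 / 2 else 0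

/-- The ground set as a list. -/
def ground (I : SetInstance) : List (List Bool) := I.E.sort (· ≤ ·)

theorem nodup_ground (I : SetInstance) : I.ground.Nodup := Finset.sort_nodup _ _

theorem length_ground (I : SetInstance) : I.ground.length = I.E.card := Finset.length_sort _

end SetInstance

namespace Prog

open OracleTM Turing Stacks TapeSym Mem
open scoped Classical

theorem ofSet_eq (S : Finset (List Bool)) : ofSet S = encode (S.sort (· ≤ ·)) := rfl

/-- A sublist of a sorted list is sorted, so the sampled list is already the canonical encoding of
its set. -/
theorem ofSet_toFinset {I : SetInstance} {Y : List (List Bool)} (hY : Y.Sublist I.ground) :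
    Y.toFinset ⊆ I.E ∧ ofSet Y.toFinset = encode Y := by
  refine ⟨fun a ha => ?_, ?_⟩
  · have := hY.subset (List.mem_toFinset.1 ha)
    simpa [SetInstance.ground] using this
  · rw [ofSet_eq, (List.toFinset_sort (· ≤ ·) (I.nodup_ground.sublist hY)).2]
    exact List.Pairwise.sublist hY (Finset.pairwise_sort _ _)

/-- The first symbol thus distinguishes a returned set from `bot`. No further test of the answer is
made, because a returned set is always a correct extension. -/
theorem not_isSemi_ofSet (S : Finset (List Bool)) : isSemi (ofSet S).head? = false := by
  rw [ofSet_eq]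
  cases S.sort (· ≤ ·) with
  | nil => rfl
  | cons a L =>
    rw [encode_cons]
    cases a <;> rfl

theorem ofBits_append_comma_inj {a b : List Bool} {w w' : List TapeSym}
    (h : ofBits a ++ comma :: w = ofBits b ++ comma :: w') : a = b ∧ w = w' := by
  induction a generalizing b with
  | nil =>
    cases b with
    | nil => simpa [ofBits] using h
    | cons c b => simp [ofBits] at h
  | cons c a ih =>
    cases b with
    | nil => simp [ofBits] at h
    | cons d b =>
      simp only [ofBits, List.map_cons, List.cons_append, List.cons.injEq, bit.injEq] at h
      obtain ⟨rfl, rfl⟩ := ih h.2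
      exact ⟨by rw [h.1], rfl⟩

theorem encode_injective : Function.Injective encode := by
  intro L L' h
  induction L generalizing L' with
  | nil =>
    cases L' with
    | nil => rfl
    | cons a L' => simp [encode] at h
  | cons a L ih =>
    cases L' with
    | nil => simp [encode] at h
    | cons b L' =>
      rw [encode_cons, encode_cons] at h
      obtain ⟨rfl, h'⟩ := ofBits_append_comma_inj h
      rw [ih h']

theorem answer_self (O : Set (List TapeSym)) (T : Tape (Option TapeSym)) :
    answer O T = (true && answer O T) := by simp

theorem answer_empty (O : Set (List TapeSym)) (T : Tape (Option TapeSym)) :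
    answer ∅ T = (false && answer O T) := by simp [answer]

variable {X : Type} [Finite X] (m : Mem)

/-- Record success if an extension has been found. -/
def recordAnswer : Prog (Var ⊕ X) :=
  ifTop (tp .out) isSemi (clear (tp .out))
    (clear (tp .out) ;; pop .output ;; push .output (bit true))

/-- Sample a set and try to extend it. -/
def trialWith (pick : Prog (Var ⊕ X) → Prog (Var ⊕ X) → Prog (Var ⊕ X))
    (loadSize : Prog (Var ⊕ X)) (M : OracleTM) (κ : M.Work → X) : Prog (Var ⊕ X) :=
  dup .input (tp .arg) (tp .t) ;; push (tp .arg) semi ;; sample pick ;; push (tp .arg) semi ;;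
    loadSize ;; callSub M κ true ;; recordAnswer

theorem evals_recordAnswer_bot {O : Set (List TapeSym)} (ho : m.out = bot) :
    (recordAnswer (X := X)).Evals O 5 m.st { m with out := [] }.st :=
  (Evals.ifTop_true (by simp [ho, bot, isSemi]) evals_clear).mono (by simp [ho, bot]) (by simp)

theorem evals_recordAnswer {O : Set (List TapeSym)} {S : Finset (List Bool)} (ho : m.out = ofSet S)
    (hf : m.flag.tail = []) :
    (recordAnswer (X := X)).Evals O (3 * (ofSet S).length + 10) m.st
      { m with out := [], flag := [bit true] }.st :=
  (Evals.ifTop_false (by simpa [ho] using not_isSemi_ofSet S)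
    (evals_clear.seq (evals_pop.seq evals_push))).mono (by simp [ho]) (by simp [hf])

/-- For a sampled Y the value is at least ρ + σ · chance(Y), and the average over Y commutes with
this affine expression since α + β = 1. The flag is raised only by an actual extension, which
witnesses that the family is nonempty. -/
theorem onStacks_trialWith {I : SetInstance} {M : OracleTM} {κ : M.Work → X}
    (hκ : Function.Injective κ) {ℓ T : ℕ} (hM : I.Extends M ℓ T) {α β : ENNReal} (hαβ : α + β = 1)
    {pick : Prog (Var ⊕ X) → Prog (Var ⊕ X) → Prog (Var ⊕ X)}
    (hp : IsChoice I.oracleWords α β pick) {loadSize : Prog (Var ⊕ X)}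
    (hl : ∀ arg, loadSize.Evals I.oracleWords (18 * ℓ + 3) { m with arg := arg }.st
      { m with arg := unary ℓ ++ arg }.st)
    (hi : m.inp = ofBits I.B) (he : m.el = ofSet I.E) (ha : m.arg = []) (ho : m.out = [])
    (ht : m.t = []) (hf : m.flag.tail = []) {φ : Stacks (Var ⊕ X) → ENNReal} {ρ σ : ENNReal}
    (hρ : ρ ≤ φ m.st) (hσ : ρ + σ ≤ φ { m with flag := [bit true] }.st) :
    (trialWith pick loadSize M κ).OnStacks I.oracleWords
      (60 * (I.B.length + (ofSet I.E).length + ℓ + T) + 300) m.st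
      (fun s => s = m.st ∨ I.F.Nonempty ∧ s = { m with flag := [bit true] }.st) φ
      (ρ + σ * weightedSum α β I.ground (I.chance ℓ)) := by
  have hm : m = { m with arg := [] } := by obtain ⟨⟩ := m; cases ha; rfl
  have hm' : m = { m with arg := [], out := [] } := by
    obtain ⟨⟩ := m; cases ha; cases ho; rfl
  set arg₁ := semi :: (ofBits I.B).reverse with harg₁
  have h1 : (dup (W := Var ⊕ X) .input (tp .arg) (tp .t)).Evals I.oracleWords
      (18 * I.B.length + 3) m.st { m with arg := (ofBits I.B).reverse }.st := by
    refine (evals_dup (by simp) (by simp) (by simp) (by simp [ht])).mono ?_ ?_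
    · simp [hi, ofBits]
    · simp [hi, ha]
  have h2 : (push (W := Var ⊕ X) (tp .arg) semi).Evals I.oracleWords 3
      { m with arg := (ofBits I.B).reverse }.st { m with arg := arg₁ }.st :=
    evals_push.mono le_rfl (by simp [harg₁])
  -- The value after sampling depends on Y, but has to be a function of the stacks; so Y must be
  -- recoverable from `arg`.
  have hinj : Function.Injective fun Y => (encode Y).reverse ++ arg₁ := fun Y Y' h =>
    encode_injective (List.reverse_injective (List.append_cancel_right h))
  set ψ : Stacks (Var ⊕ X) → ENNReal := fun s =>
    ρ + σ * I.chance ℓ (Function.invFun (fun Y => (encode Y).reverse ++ arg₁) (s (tp .arg)))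
    with hψ
  have hψY (Y : List (List Bool)) : ψ { m with arg := (encode Y).reverse ++ arg₁ }.st =
      ρ + σ * I.chance ℓ Y := by
    simp only [hψ, st_arg]
    rw [Function.leftInverse_invFun hinj Y]
  have h3 := onStacks_sample { m with arg := arg₁ } hp (φ := ψ) (L := I.ground) he ht
  have h4 : ∀ s, (∃ Y : List (List Bool), Y.Sublist I.ground ∧
        s = { m with arg := (encode Y).reverse ++ arg₁ }.st) →
      (push (tp .arg) semi ;; loadSize ;; callSub M κ true ;; recordAnswer).OnStacks I.oracleWords
      (31 * I.B.length + 32 * (ofSet I.E).length + 50 * ℓ + 20 * T + 200) s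
      (fun s => s = m.st ∨ I.F.Nonempty ∧ s = { m with flag := [bit true] }.st) φ (ψ s) := by
    rintro _ ⟨Y, hY, rfl⟩
    rw [hψY]
    obtain ⟨hYE, hYs⟩ := ofSet_toFinset hY
    have hlen : (ofSet Y.toFinset).length ≤ (ofSet I.E).length := by
      rw [hYs]
      exact (hY.flatMap _).length_le
    have h5 : (push (W := Var ⊕ X) (tp .arg) semi).Evals I.oracleWords 3
        { m with arg := (encode Y).reverse ++ arg₁ }.st
        { m with arg := semi :: ((encode Y).reverse ++ arg₁) }.st :=
      evals_push.mono le_rfl (by simp)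
    set w := I.extensionInput Y.toFinset ℓ with hw
    have hwl : w.length = I.B.length + (ofSet Y.toFinset).length + ℓ + 2 := by
      simp [hw, SetInstance.extensionInput, ofBits]
      omega
    have hA : ∀ v, (v = bot ∨ I.IsAnswer Y.toFinset ℓ v) → I.IsAnswer Y.toFinset ℓ v →
        I.F.Nonempty ∧ ∃ S, v = ofSet S := by
      rintro v - ⟨S, hS, rfl⟩
      exact ⟨⟨_, hS.2.1⟩, S, rfl⟩
    set ψ' : Stacks (Var ⊕ X) → ENNReal := fun s =>
      if s (tp .out) = bot then ρ else ρ + σ with hψ'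
    have hbot (S : Finset (List Bool)) : ofSet S ≠ bot := by
      intro h
      have := not_isSemi_ofSet S
      rw [h] at this
      simp [bot, isSemi] at this
    have h6 := onStacks_callSub (O := I.oracleWords) { m with
      arg := unary ℓ ++ semi :: ((encode Y).reverse ++ arg₁) } hκ (answer_self I.oracleWords)
      (hM Y.toFinset hYE).1 (A := I.IsAnswer Y.toFinset ℓ) ho (φ := ψ') (ρ := ρ) (σ := σ)
      (by simp [SetInstance.extensionInput, hYs, harg₁])
      (by
        intro v _
        by_cases hv : v = bot <;> simp [hψ', hv])
      (by
        rintro v - ⟨S, hS, rfl⟩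
        simp [hψ', hbot S])
    have h7 : ∀ s, (∃ v, (v = bot ∨ I.IsAnswer Y.toFinset ℓ v) ∧ v.length ≤ w.length + T + 1 ∧
        s = { m with arg := [], out := v }.st) →
        (recordAnswer (X := X)).OnStacks I.oracleWords (3 * (w.length + T + 1) + 10) s
        (fun s => s = m.st ∨ I.F.Nonempty ∧ s = { m with flag := [bit true] }.st) φ (ψ' s) := by
      rintro _ ⟨v, hv | ⟨S, hS, hv⟩, hl, rfl⟩
      · have := evals_recordAnswer_bot (X := X) (O := I.oracleWords)
          { m with arg := [], out := v } hv
        refine (this.mono (by omega) (congrArg st hm'.symm)).onStacks (.inl rfl) ?_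
        simpa [hψ', hv] using hρ
      · have := evals_recordAnswer (X := X) (O := I.oracleWords)
          { m with arg := [], out := v } hv hf
        refine (this.mono (by rw [hv] at hl; omega) (s'' := { m with flag := [bit true] }.st)
          ?_).onStacks (.inr ⟨⟨_, hS.2.1⟩, rfl⟩) ?_
        · simp only [ha, ho]
        · simpa [hψ', hv, hbot] using hσ
    refine (h5.then ((hl _).then (h6.seq h7))).mono ?_ ?_ (fun _ => id) fun _ _ => le_rfl
    · change 3 + (18 * ℓ + 3 + (28 * w.length + 10 * T + 39 +
        (3 * (w.length + T + 1) + 10) + 1) + 1) + 1 ≤ _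
      omega
    · refine add_le_add le_rfl (mul_le_mul_right ?_ _)
      rw [SetInstance.chance]
      split_ifs with h
      · exact (hM Y.toFinset hYE).2 h
      · exact zero_le
  refine (h1.then (h2.then (h3.seq h4))).mono ?_ (le_of_eq ?_) (fun _ => id) fun _ _ => le_rfl
  · change 18 * I.B.length + 3 + (3 + (22 * (ofSet I.E).length + 3 + (31 * I.B.length +
      32 * (ofSet I.E).length + 50 * ℓ + 20 * T + 200) + 1) + 1) + 1 ≤ _
    omega
  · rw [← weightedSum_add_mul hαβ]
    simp only [hψY]

end Prog

end

noncomputable section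

/-! ### The main loop -/

/-- The probability that one of `j` independent trials succeeds. -/
def amplified (q : ENNReal) : ℕ → ENNReal
  | 0 => 0
  | j + 1 => amplified q j + (1 - amplified q j) * q

/-- The failure probabilities of independent trials multiply. The additive form avoids truncated
subtraction. -/
theorem amplified_add_pow {q : ENNReal} (hq : q ≤ 1) (j : ℕ) :
    amplified q j + (1 - q) ^ j = 1 := by
  induction j with
  | zero => simp [amplified]
  | succ j ih =>
    have hle : amplified q j ≤ 1 := ih ▸ le_self_add
    have hU : 1 - amplified q j = (1 - q) ^ j := by
      conv_lhs => rw [← ih]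
      exact ENNReal.add_sub_cancel_left (ne_top_of_le_ne_top ENNReal.one_ne_top hle)
    rw [amplified, hU, add_assoc, pow_succ, ← mul_add, add_tsub_cancel_of_le hq, mul_one, ih]

theorem amplified_le_one {q : ENNReal} (hq : q ≤ 1) (j : ℕ) : amplified q j ≤ 1 :=
  amplified_add_pow hq j ▸ le_self_add

/-- A substitute for (1 − q)^j ≤ exp(−jq), obtained from (1 − q)(1 + (j + 1)q) ≤ 1 + jq. For jq ≥ 1
the second factor is at least 2, so failure has probability at most 1/2. -/
theorem pow_mul_le_one {q : ENNReal} (hq : q ≤ 1) (j : ℕ) : (1 - q) ^ j * (1 + j * q) ≤ 1 := by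
  induction j with
  | zero => simp
  | succ j ih =>
    refine le_trans ?_ ih
    rw [pow_succ, mul_assoc]
    refine mul_le_mul_right ?_ _
    have h : 1 - q + q = 1 := tsub_add_cancel_of_le hq
    calc (1 - q) * (1 + (j + 1 : ℕ) * q) = (1 - q) * (1 + j * q) + (1 - q) * q := by
          push_cast; ring
      _ ≤ (1 - q) * (1 + j * q) + (1 + j * q) * q := by
          gcongr
          exact tsub_le_self.trans le_self_add
      _ = (1 - q + q) * (1 + j * q) := by ring
      _ = 1 + j * q := by rw [h, one_mul]

theorem half_le_amplified {q : ENNReal} (hq : q ≤ 1) {N : ℕ} (hN : 1 ≤ N * q) :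
    1 / 2 ≤ amplified q N := by
  have h : (1 - q) ^ N ≤ 1 / 2 := by
    rw [ENNReal.le_div_iff_mul_le (by simp) (by simp)]
    refine le_trans (mul_le_mul_right ?_ _) (pow_mul_le_one hq N)
    rw [← one_add_one_eq_two]
    exact add_le_add le_rfl hN
  refine (ENNReal.add_le_add_iff_right (a := 1 / 2) (by simp)).1 ?_
  rw [ENNReal.add_halves]
  exact (amplified_add_pow hq N).ge.trans (add_le_add le_rfl h)

namespace Prog

open OracleTM Turing Stacks TapeSym Mem
open scoped Classical

/-- The invariant of the main loop. -/
structure Ready (I : SetInstance) (ℓ : ℕ) (m : Mem) : Prop where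
  inp : m.inp = ofBits I.B
  el : m.el = ofSet I.E
  ll : m.ll = unary ℓ
  arg : m.arg = []
  out : m.out = []
  t : m.t = []

variable {X : Type} [Finite X] (m : Mem)

/-- One trial of the algorithm. -/
def trial (M : OracleTM) (κ : M.Work → X) : Prog (Var ⊕ X) :=
  coin (trialWith coin (dup (tp .ll) (tp .arg) (tp .t)) M κ)
    (trialWith (fun P₁ P₂ => coin (coin P₁ P₂) P₂) (dup (tp .zr) (tp .arg) (tp .t)) M κ)

/-- A lower bound for the probability that a trial succeeds. -/
def trialChance (I : SetInstance) (ℓ : ℕ) : ENNReal :=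
  (weightedSum (1 / 2) (1 / 2) I.ground (I.chance ℓ) +
    weightedSum (1 / 4) (3 / 4) I.ground (I.chance 0)) / 2

theorem half_add_half : (1 / 2 + 1 / 2 : ENNReal) = 1 := ENNReal.add_halves 1

theorem quarter_add : (1 / 4 + 3 / 4 : ENNReal) = 1 := by
  rw [← ENNReal.add_div, show (1 + 3 : ENNReal) = 4 by norm_num]
  exact ENNReal.div_self (by simp) (by simp)

theorem chance_le_one (I : SetInstance) (ℓ : ℕ) (Y : List (List Bool)) : I.chance ℓ Y ≤ 1 := by
  rw [SetInstance.chance]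
  split_ifs
  · simp
  · simp

theorem weightedSum_le_one {α β : ENNReal} (h : α + β = 1) (I : SetInstance) (ℓ : ℕ) :
    weightedSum α β I.ground (I.chance ℓ) ≤ 1 := by
  refine (weightedSum_mono (g := fun _ => 1 + 0 * 0) fun Y _ => ?_).trans
    (weightedSum_add_mul h 1 0 _ fun _ => 0).le |>.trans ?_
  · simpa using chance_le_one I ℓ Y
  · simp

theorem trialChance_le_one (I : SetInstance) (ℓ : ℕ) : trialChance I ℓ ≤ 1 := by
  rw [trialChance]
  refine (ENNReal.div_le_div_right (add_le_add (weightedSum_le_one half_add_half I ℓ)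
    (weightedSum_le_one quarter_add I 0)) 2).trans ?_
  rw [half_add_self]

theorem onStacks_trial {I : SetInstance} {M : OracleTM} {κ : M.Work → X}
    (hκ : Function.Injective κ) {ℓ T T₀ : ℕ} (hM : I.Extends M ℓ T) (hM₀ : I.Extends M 0 T₀)
    (hm : Ready I ℓ m) (hf : m.flag.tail = []) {φ : Stacks (Var ⊕ X) → ENNReal} {ρ σ : ENNReal}
    (hρ : ρ ≤ φ m.st) (hσ : ρ + σ ≤ φ { m with flag := [bit true] }.st) :
    (trial M κ).OnStacks I.oracleWords
      (60 * (I.B.length + (ofSet I.E).length + ℓ + T + T₀) + 301) m.st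
      (fun s => s = m.st ∨ I.F.Nonempty ∧ s = { m with flag := [bit true] }.st) φ
      (ρ + σ * trialChance I ℓ) := by
  have h1 := onStacks_trialWith m hκ hM half_add_half isChoice_coin
    (loadSize := dup (tp .ll) (tp .arg) (tp .t)) (fun arg => ?_) hm.inp hm.el hm.arg hm.out hm.t hf
    hρ hσ
  -- The stack `zr` is always empty, so its copy is the number ℓ = 0 in unary.
  · have h2 := onStacks_trialWith m hκ hM₀ quarter_add isChoice_coin_coin
      (loadSize := dup (tp .zr) (tp .arg) (tp .t)) (fun arg => ?_) hm.inp hm.el hm.arg hm.out hm.t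
      hf hρ hσ
    · refine ((h1.mono_time ?_).coin (h2.mono_time ?_)).mono
        (T := 60 * (I.B.length + (ofSet I.E).length + ℓ + T + T₀) + 300 + 1) le_rfl (le_of_eq ?_)
        (fun _ => id) fun _ _ => le_rfl
      · omega
      · omega
      · rw [add_add_add_comm, ← mul_add, ENNReal.add_div, half_add_self, mul_div_assoc]
        rfl
    · refine (evals_dup (by simp) (by simp) (by simp) (by simp [hm.t])).mono ?_ ?_
      · simp
      · simp
  · refine (evals_dup (by simp) (by simp) (by simp) (by simp [hm.t])).mono ?_ ?_
    · simp [hm.ll]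
    · simp [hm.ll]

/-- The main loop of the algorithm. -/
def mainLoop (M : OracleTM) (κ : M.Work → X) : Prog (Var ⊕ X) :=
  whileTop (tp .cn) Option.isSome (trial M κ ;; decrement)

/-- The algorithm has found a solution. -/
def success (s : Stacks (Var ⊕ X)) : ENNReal := if s .output = [bit true] then 1 else 0

/-- The flag is set correctly. -/
def Sound (I : SetInstance) (s : Stacks (Var ⊕ X)) : Prop :=
  s .output = no ∨ I.F.Nonempty ∧ s .output = yes

/-- The number of trials that are still to be made. -/
def remaining (l : List Bool) : ℕ := if l = [] then 0 else bitVal l + 1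

theorem exists_decrement {O : Set (List TapeSym)} {l : List Bool} (hl : l ≠ []) :
    ∃ l', remaining l' + 1 = remaining l ∧ l'.length ≤ l.length ∧
      ∀ m : Mem, m.cn = ofBits l → m.t = [] → (decrement (X := X)).Evals O (14 * l.length + 15) m.st
        { m with cn := ofBits l' }.st := by
  by_cases h : bitVal l = 0
  · exact ⟨[], by simp [remaining, hl, h], by simp, fun m hc ht =>
      (evals_decrement_zero m hc h ht).mono (by omega)⟩
  · obtain ⟨z, l', rfl, hv⟩ := exists_of_bitVal h
    refine ⟨List.replicate z true ++ false :: l', ?_, by simp, fun m hc ht => ?_⟩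
    · simpa [remaining] using hv
    · refine ((evals_decrement_aux m z (l := bit true :: ofBits l') rfl ?_).seq
        (Evals.ifTop_true (by simp)
          (evals_pop.seq (evals_push.seq (evals_moveAll (by simp)))))).mono ?_ ?_
      · simp [hc, ofBits]
      · simp [ht]
        omega
      · simp [ht, ofBits, unary]

/-- The trials continue after a success, and the flag is never lowered. The recursion of `amplified`
is read backwards: after a failure the value is v = `amplified` at N, and a success adds 1 − v. -/
theorem onStacks_mainLoop {I : SetInstance} {M : OracleTM} {κ : M.Work → X}
    (hκ : Function.Injective κ) {ℓ T T₀ D : ℕ} (hM : I.Extends M ℓ T) (hM₀ : I.Extends M 0 T₀)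
    (N : ℕ) {l : List Bool} (hl : remaining l = N) (hD : l.length ≤ D) (hm : Ready I ℓ m)
    (hc : m.cn = ofBits l) {b : Bool} (hf : m.flag = [bit b])
    (hb : b = true → I.F.Nonempty) :
    (mainLoop M κ).OnStacks I.oracleWords
      (N * (60 * (I.B.length + (ofSet I.E).length + ℓ + T + T₀) + 14 * D + 320) + 1) m.st
      (Sound I) success (bif b then 1 else amplified (trialChance I ℓ) N) := by
  induction N generalizing m l b with
  | zero =>
    have hl' : l = [] := by
      by_contra h
      simp [remaining, h] at hl
    refine ((Evals.while_stop ?_).mono (by simp) rfl).onStacks ?_ ?_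
    · simp [hc, hl', ofBits]
    · cases b
      · exact .inl (by simp [hf, no])
      · exact .inr ⟨hb rfl, by simp [hf, yes]⟩
    · cases b
      · simp [amplified]
      · simp [success, hf]
  | succ N ih =>
    have hl' : l ≠ [] := by
      rintro rfl
      simp [remaining] at hl
    obtain ⟨l', hr, hlen, hdec⟩ := exists_decrement (X := X) (O := I.oracleWords) hl'
    have hr' : remaining l' = N := by omega
    set v := amplified (trialChance I ℓ) N with hv
    have hv1 : v ≤ 1 := amplified_le_one (trialChance_le_one I ℓ) N
    set ψ : Stacks (Var ⊕ X) → ENNReal := fun s => if s .output = [bit true] then 1 else v with hψ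
    have h1 : (trial M κ).OnStacks I.oracleWords
        (60 * (I.B.length + (ofSet I.E).length + ℓ + T + T₀) + 301) m.st
        (fun s => s = m.st ∨ I.F.Nonempty ∧ s = { m with flag := [bit true] }.st) ψ
        (bif b then 1 else amplified (trialChance I ℓ) (N + 1)) := by
      cases b
      · refine onStacks_trial m hκ hM hM₀ hm (by simp [hf]) ?_ ?_
        · simp [hψ, hf, hv]
        · simp [hψ, ← hv, add_tsub_cancel_of_le hv1]
      -- Once the flag is raised, the value 1 is secured whatever the trial does.
      · refine (onStacks_trial m hκ hM hM₀ hm (ρ := 1) (σ := 0) (φ := ψ) (by simp [hf]) ?_ ?_).mono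
          le_rfl (by simp) (fun _ => id) fun _ _ => le_rfl
        · simp [hψ, hf]
        · simp [hψ]
    have key : ∀ (m' : Mem) (b' : Bool), Ready I ℓ m' → m'.cn = ofBits l' → m'.flag = [bit b'] →
        (b' = true → I.F.Nonempty) → (mainLoop M κ).OnStacks I.oracleWords
          (N * (60 * (I.B.length + (ofSet I.E).length + ℓ + T + T₀) + 14 * D + 320) + 1) m'.st
          (Sound I) success (ψ m'.st) := by
      intro m' b' hm' hc' hf' hb'
      refine (ih m' hr' (hlen.trans hD) hm' hc' hf' hb').mono le_rfl (le_of_eq ?_) (fun _ => id)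
        fun _ _ => le_rfl
      cases b' <;> simp [hψ, hf', hv]
    have h2 : (trial M κ ;; decrement).OnStacks I.oracleWords
        (60 * (I.B.length + (ofSet I.E).length + ℓ + T + T₀) + 301 + (14 * l.length + 15) + 1) m.st
        (fun s => s = { m with cn := ofBits l' }.st ∨
          I.F.Nonempty ∧ s = { m with cn := ofBits l', flag := [bit true] }.st) ψ
        (bif b then 1 else amplified (trialChance I ℓ) (N + 1)) := by
      refine h1.seq ?_
      rintro _ (rfl | ⟨hF, rfl⟩)
      · exact (hdec m hc hm.t).onStacks (.inl rfl) le_rfl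
      · exact (hdec { m with flag := [bit true] } hc hm.t).onStacks (.inr ⟨hF, rfl⟩) le_rfl
    refine (OnStacks.while_step ?_ h2 ?_).mono_time ?_ (T := 60 * (I.B.length +
      (ofSet I.E).length + ℓ + T + T₀) + 301 + (14 * l.length + 15) + 1 +
      (N * (60 * (I.B.length + (ofSet I.E).length + ℓ + T + T₀) + 14 * D + 320) + 1) + 2)
    · obtain ⟨c, l, rfl⟩ := List.exists_cons_of_ne_nil hl'
      simp [hc, ofBits]
    · rintro _ (rfl | ⟨hF, rfl⟩)
      · exact key _ b ⟨hm.inp, hm.el, hm.ll, hm.arg, hm.out, hm.t⟩ rfl hf hb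
      · exact key _ true ⟨hm.inp, hm.el, hm.ll, hm.arg, hm.out, hm.t⟩ rfl rfl fun _ => hF
    · rw [add_mul N 1]
      omega

end Prog

end

noncomputable section

/-! ### The algorithm -/

/-- The parameter that is passed to the optimizer; it is about `log log n`. -/
def sizeBound (n : ℕ) : ℕ := n.size.size

/-- The binary logarithm of the number of sets saved by one more element of the extension. -/
def gain (n : ℕ) : ℕ := n.size - sizeBound n - 3

/-- The binary logarithm of the number of trials. -/
def trialBits (c n ℓ : ℕ) : ℕ := n + (c + 1) - ℓ * gain n

/-- The sizes of extensions that an optimizer for `g` may suggest. -/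
def IsBestSize (g : ℕ → ℕ) (n ℓ : ℕ) : Prop :=
  ℓ ≤ sizeBound n ∧ IsArgmin g n (sizeBound n) (sizeBound n - ℓ)

namespace Prog

open OracleTM Turing Stacks TapeSym Mem
open scoped Classical

/-- The counter starts at 2^L − 1, and a trial is also made at the value zero. For L = 0 the counter
would be empty and no trial would be made. -/
theorem remaining_replicate {L : ℕ} (hL : 1 ≤ L) : remaining (List.replicate L true) = 2 ^ L := by
  have h : ∀ L, bitVal (List.replicate L true) + 1 = 2 ^ L := by
    intro L
    induction L with
    | zero => rfl
    | succ L ih =>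
      rw [List.replicate_succ, bitVal, pow_succ, ← ih, Bool.toNat_true]
      ring
  rw [remaining, if_neg, h]
  simp
  omega

variable {X : Type} [Finite X]

/-- The algorithm for `P`. -/
def algorithm (c : ℕ) (M₁ M₂ M₃ : OracleTM) (κ₁ : M₁.Work → X) (κ₂ : M₂.Work → X)
    (κ₃ : M₃.Work → X) : Prog (Var ⊕ X) :=
  dup .input (tp .arg) (tp .t) ;; callSub M₁ κ₁ true ;; loadGround ;; computeParams ;;
    optimizerArg ;; callSub M₂ κ₂ false ;; computeStep ;; fillCounter c ;;
    push .output (bit false) ;; mainLoop M₃ κ₃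

/-- A bound for the time that passes before the main loop. -/
def setupTime (c B T₁ T₂ : ℕ) : ℕ :=
  600 * ((B + T₁ + 1) * (B + T₁ + 1) + T₂ + c + 1)

/-- Minimizers need not be unique, and different runs may return different ones; hence the
hypotheses on ℓ range over all of `IsBestSize`. -/
theorem onStacks_algorithm {g : ℕ → ℕ} {c : ℕ} {M₁ M₂ M₃ : OracleTM} {κ₁ : M₁.Work → X}
    {κ₂ : M₂.Work → X} {κ₃ : M₃.Work → X} (hκ₁ : Function.Injective κ₁)
    (hκ₂ : Function.Injective κ₂) (hκ₃ : Function.Injective κ₃) {I : SetInstance}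
    {T₁ T₂ : ℕ} {T₃ : ℕ → ℕ} {n : ℕ} (hn : I.E.card = n)
    (h₁ : M₁.Surely I.oracleWords (ofBits I.B) T₁ (fun v => v = ofSet I.E))
    (h₂ : M₂.Surely ∅ (unary n ++ semi :: unary (sizeBound n)) T₂
      (fun v => ∃ t, IsArgmin g n (sizeBound n) t ∧ v = unary t))
    (h₃ : ∀ ℓ, I.Extends M₃ ℓ (T₃ ℓ)) (hL : ∀ ℓ, IsBestSize g n ℓ → 1 ≤ trialBits c n ℓ)
    {T : ℕ} (hT : ∀ ℓ, IsBestSize g n ℓ →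
      2 ^ trialBits c n ℓ * (60 * (I.B.length + (I.B.length + T₁ + 1) + ℓ + T₃ ℓ + T₃ 0) +
        14 * trialBits c n ℓ + 320) + 1 ≤ T)
    {r : ENNReal} (hr : ∀ ℓ, IsBestSize g n ℓ →
      r ≤ amplified (trialChance I ℓ) (2 ^ trialBits c n ℓ)) :
    (algorithm c M₁ M₂ M₃ κ₁ κ₂ κ₃).OnStacks I.oracleWords
      (setupTime c I.B.length T₁ T₂ + T) ({ inp := ofBits I.B } : Mem).st (Sound I) success r := by
  set B := I.B.length with hB
  set D := B + T₁ + 1 with hD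
  have s1 : (dup (W := Var ⊕ X) .input (tp .arg) (tp .t)).Evals I.oracleWords (18 * B + 3)
      ({ inp := ofBits I.B } : Mem).st
      ({ inp := ofBits I.B, arg := (ofBits I.B).reverse } : Mem).st := by
    refine (evals_dup (by simp) (by simp) (by simp) (by simp)).mono ?_ ?_
    · simp [ofBits, hB]
    · simp
  -- Only the guaranteed output matters here, so the event `A` is empty and σ = 0.
  have s2 := onStacks_callSub (O := I.oracleWords)
    { inp := ofBits I.B, arg := (ofBits I.B).reverse } hκ₁ (answer_self I.oracleWords) h₁
    (A := fun _ => False) rfl rfl (φ := fun _ => r) (ρ := r) (σ := 0) (fun _ _ => le_rfl)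
    (fun _ _ h => h.elim)
  have hl : (ofBits I.B).length = B := by simp [ofBits, hB]
  rw [zero_mul, add_zero, hl] at s2
  refine (s1.then (s2.seq (T₂ := 490 * (D * D + T₂ + c + 1) + T) ?_)).mono_time ?_
  swap
  · rw [setupTime, ← hD]
    have : D ≤ D * D := Nat.le_mul_self D
    omega
  rintro _ ⟨v, rfl, hlen, rfl⟩
  have hnD : n ≤ D := by
    rw [← hn, ← I.length_ground]
    exact (length_le_length_encode _).trans hlen
  have hkb : n.size ≤ n := size_le n
  have hk : sizeBound n ≤ n := (size_le _).trans hkb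
  have hgl : I.ground.length = n := by rw [I.length_ground, hn]
  have s3 := evals_loadGround (X := X) (O := I.oracleWords)
    { inp := ofBits I.B, out := ofSet I.E } (L := I.ground) rfl rfl rfl rfl
  rw [hgl] at s3
  have s4 := evals_computeParams (X := X) (O := I.oracleWords)
    { inp := ofBits I.B, el := encode I.ground, un := unary n } (n := n) rfl rfl rfl rfl rfl
  have s5 := evals_optimizerArg (X := X) (O := I.oracleWords)
    { inp := ofBits I.B, el := encode I.ground, un := unary n, lb := unary n.size,
      lk := unary (sizeBound n) } (n := n) (k := sizeBound n) rfl rfl rfl rfl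
  -- The optimizer is specified for the empty oracle, so its questions are all answered by no.
  have s6 := onStacks_callSub (O := I.oracleWords)
    { inp := ofBits I.B, el := encode I.ground, un := unary n, lb := unary n.size,
      lk := unary (sizeBound n), arg := (unary n ++ semi :: unary (sizeBound n)).reverse } hκ₂
    (answer_empty I.oracleWords) h₂
    (A := fun _ => False) rfl rfl (φ := fun _ => r) (ρ := r) (σ := 0) (fun _ _ => le_rfl)
    (fun _ _ h => h.elim)
  have hl' : (unary n ++ semi :: unary (sizeBound n)).length = n + sizeBound n + 1 := by
    simp
    omega
  rw [zero_mul, add_zero, hl'] at s6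
  refine (s3.then (s4.then (s5.then (s6.seq (T₂ := 120 * (D * D + c + 1) + T) ?_)))).mono_time ?_
  swap
  · change 19 * (ofSet I.E).length + 3 + (160 * n + 20 + (18 * n + 18 * sizeBound n + 20 +
      (28 * (n + sizeBound n + 1) + 10 * T₂ + 39 + (120 * (D * D + c + 1) + T) + 1) + 1) + 1) + 1 ≤ _
    have hlen' : (ofSet I.E).length ≤ D := hlen
    have hD1 : 1 ≤ D := by omega
    nlinarith
  rintro _ ⟨_, ⟨t, ht, rfl⟩, -, rfl⟩
  set ℓ := sizeBound n - t with hℓ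
  have hbest : IsBestSize g n ℓ := by
    refine ⟨Nat.sub_le _ _, ?_⟩
    rwa [hℓ, Nat.sub_sub_self ht.1]
  have hg : gain n ≤ n := by rw [gain]; omega
  have hℓn : ℓ ≤ n := by omega
  have htn : t ≤ n := ht.1.trans hk
  have s7 := evals_computeStep (X := X) (O := I.oracleWords)
    { inp := ofBits I.B, el := encode I.ground, un := unary n, lb := unary n.size,
      lk := unary (sizeBound n), out := unary t } (b := n.size) (k := sizeBound n) (t := t)
      rfl rfl rfl rfl rfl rfl rfl
  have s8 := evals_fillCounter (X := X) (O := I.oracleWords)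
    { inp := ofBits I.B, el := encode I.ground, un := unary n, lb := unary n.size,
      lk := unary (sizeBound n), ll := unary ℓ, la := unary (gain n) } (n := n) (a := gain n)
      (l := ℓ) (c := c) rfl rfl rfl rfl rfl rfl rfl
  have s9 : (push (W := Var ⊕ X) .output (bit false)).Evals I.oracleWords 3
      ({ inp := ofBits I.B, el := encode I.ground, un := unary n, lb := unary n.size,
         lk := unary (sizeBound n), ll := unary ℓ, la := unary (gain n),
         cn := unary (trialBits c n ℓ) } : Mem).st
      ({ inp := ofBits I.B, el := encode I.ground, un := unary n, lb := unary n.size,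
         lk := unary (sizeBound n), ll := unary ℓ, la := unary (gain n),
         cn := unary (trialBits c n ℓ), flag := [bit false] } : Mem).st :=
    evals_push.mono le_rfl (by simp)
  have s10 := onStacks_mainLoop
    { inp := ofBits I.B, el := encode I.ground, un := unary n, lb := unary n.size,
        lk := unary (sizeBound n), ll := unary ℓ, la := unary (gain n),
        cn := unary (trialBits c n ℓ), flag := [bit false] } hκ₃ (h₃ ℓ) (h₃ 0)
    (2 ^ trialBits c n ℓ) (l := List.replicate (trialBits c n ℓ) true) (D := trialBits c n ℓ)
    (remaining_replicate (hL ℓ hbest)) (by simp) ⟨rfl, rfl, rfl, rfl, rfl, rfl⟩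
    (by simp [ofBits, unary]) (b := false) rfl (by simp)
  refine (s7.then (s8.then (s9.then s10))).mono ?_ (hr ℓ hbest) (fun _ => id) fun _ _ => le_rfl
  have h1 := hT ℓ hbest
  have h2 : 2 ^ trialBits c n ℓ * (60 * (B + (ofSet I.E).length + ℓ + T₃ ℓ + T₃ 0) +
      14 * trialBits c n ℓ + 320) + 1 ≤ T := by
    refine le_trans ?_ h1
    gcongr
  have h3 : ℓ * (23 * gain n + 38) ≤ D * (23 * D + 38) := by
    gcongr <;> omega
  have hD1 : 1 ≤ D := by omega
  change 18 * n.size + 50 * sizeBound n + 5 * t + 30 + (18 * n + 4 * c +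
    ℓ * (23 * gain n + 38) + 20 + (3 + (2 ^ trialBits c n ℓ *
    (60 * (B + (ofSet I.E).length + ℓ + T₃ ℓ + T₃ 0) + 14 * trialBits c n ℓ + 320) + 1) + 1)
    + 1) + 1 ≤ _
  nlinarith

end Prog

end

noncomputable section

/-! ### Estimates -/

/-- This is (n/j)^j ≤ C(n, j). The induction rests on (n + 1)/(j + 1) ≤ n/j for 0 < j ≤ n. -/
theorem pow_le_choose_mul_pow {n j : ℕ} (h : j ≤ n) : n ^ j ≤ n.choose j * j ^ j := by
  induction j generalizing n with
  | zero => simp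
  | succ j ih =>
    obtain ⟨n, rfl⟩ : ∃ m, n = m + 1 := ⟨n - 1, by omega⟩
    have hj : j ≤ n := by omega
    have h1 : (n + 1) ^ j ≤ n.choose j * (j + 1) ^ j := by
      obtain rfl | hj0 := Nat.eq_zero_or_pos j
      · simp
      refine Nat.le_of_mul_le_mul_right (c := j ^ j) ?_ (by positivity)
      calc (n + 1) ^ j * j ^ j = ((n + 1) * j) ^ j := (mul_pow _ _ _).symm
        _ ≤ (n * (j + 1)) ^ j := Nat.pow_le_pow_left (by nlinarith) _
        _ = n ^ j * (j + 1) ^ j := mul_pow _ _ _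
        _ ≤ n.choose j * j ^ j * (j + 1) ^ j := Nat.mul_le_mul_right _ (ih hj)
        _ = n.choose j * (j + 1) ^ j * j ^ j := by ring
    calc (n + 1) ^ (j + 1) = (n + 1) * (n + 1) ^ j := by ring
      _ ≤ (n + 1) * (n.choose j * (j + 1) ^ j) := Nat.mul_le_mul_left _ h1
      _ = (n + 1) * n.choose j * (j + 1) ^ j := by ring
      _ = (n + 1).choose (j + 1) * (j + 1) * (j + 1) ^ j := by rw [Nat.add_one_mul_choose_eq]
      _ = _ := by ring

theorem pow_le_choose_of_mul_le {m s ℓ : ℕ} (hm : 1 ≤ m) (h : m * ℓ ≤ s) :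
    m ^ ℓ ≤ s.choose ℓ := by
  obtain rfl | hℓ := Nat.eq_zero_or_pos ℓ
  · simp
  have hs : ℓ ≤ s := by nlinarith
  refine Nat.le_of_mul_le_mul_right (c := ℓ ^ ℓ) ?_ (by positivity)
  rw [← mul_pow]
  exact (Nat.pow_le_pow_left h _).trans (pow_le_choose_mul_pow hs)

theorem two_pow_size_le {n : ℕ} (hn : 1 ≤ n) : 2 ^ n.size ≤ 2 * n := by
  have h1 : 0 < n.size := Nat.size_pos.2 hn
  have h : 2 ^ (n.size - 1) ≤ n := Nat.lt_size.1 (by omega)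
  calc 2 ^ n.size = 2 * 2 ^ (n.size - 1) := by rw [← pow_succ']; congr 1; omega
    _ ≤ 2 * n := by omega

theorem sizeBound_le (n : ℕ) : sizeBound n ≤ n.size := Prog.size_le _

/-- The induction starts at 16 · 11² = 1936 ≤ 2^11. The factor 8 is the one that
`four_pow_le_of_small` requires. -/
theorem sq_size_le {n : ℕ} (hn : 1024 ≤ n) : 8 * (n.size * n.size) ≤ n := by
  have hb : 11 ≤ n.size := Nat.lt_size.2 (by simpa using hn)
  have key : ∀ b, 11 ≤ b → 8 * (b * b) * 2 ≤ 2 ^ b := by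
    intro b hb
    induction b, hb using Nat.le_induction with
    | base => norm_num
    | succ b hb ih =>
      rw [pow_succ]
      nlinarith
  have := (key _ hb).trans (two_pow_size_le (by omega))
  omega

theorem mul_gain_le {n ℓ : ℕ} (hℓ : ℓ ≤ sizeBound n) : ℓ * gain n ≤ n.size * n.size :=
  Nat.mul_le_mul (hℓ.trans (sizeBound_le n)) (by rw [gain]; omega)

/-- The constant in the number of trials. -/
def trialConst : ℕ := 1024 + 1024 * 1024 + 1

/-- This ensures that the subtraction in `trialBits` is not truncated; for n below 1024 the constant
alone is large enough. -/
theorem mul_gain_le_add {n ℓ : ℕ} (hℓ : ℓ ≤ sizeBound n) : ℓ * gain n ≤ n + trialConst := by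
  have h := mul_gain_le hℓ
  rcases le_or_gt 1024 n with hn | hn
  · have := sq_size_le hn
    omega
  · have h1 : n.size * n.size ≤ 1024 * 1024 := by
      have := Prog.size_le n
      gcongr <;> omega
    rw [trialConst]
    omega

theorem trialBits_add_mul_gain {n ℓ : ℕ} (hℓ : ℓ ≤ sizeBound n) :
    trialBits trialConst n ℓ + ℓ * gain n = n + (trialConst + 1) := by
  have := mul_gain_le_add hℓ
  rw [trialBits]
  omega

theorem one_le_trialBits {n ℓ : ℕ} (hℓ : ℓ ≤ sizeBound n) : 1 ≤ trialBits trialConst n ℓ := by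
  have := mul_gain_le_add hℓ
  rw [trialBits]
  omega

/-- The 3 in `gain` comes from here: a factor 4 for sets that contain only a quarter of the
elements, and a factor 2 because 2^size may be as large as 2n. The factor k is absorbed by 2^k. -/
theorem two_pow_gain_mul_le {n : ℕ} (hn : 1024 ≤ n) : 2 ^ gain n * (4 * sizeBound n) ≤ n := by
  have h8 := sq_size_le hn
  have hk := sizeBound_le n
  have hb : 11 ≤ n.size := Nat.lt_size.2 (by simpa using hn)
  rcases le_or_gt (sizeBound n + 3) n.size with h | h
  · have h1 : 2 ^ gain n * (8 * 2 ^ sizeBound n) = 2 ^ n.size := by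
      rw [show 8 = 2 ^ 3 by norm_num, ← pow_add, ← pow_add, gain]
      congr 1
      omega
    have h2 : sizeBound n ≤ 2 ^ sizeBound n := Nat.lt_two_pow_self.le
    have h3 := two_pow_size_le (n := n) (by omega)
    nlinarith [Nat.mul_le_mul_left (2 ^ gain n) h2]
  · have : gain n = 0 := by rw [gain]; omega
    rw [this]
    nlinarith

theorem two_pow_le_choose {n s ℓ : ℕ} (hn : 1024 ≤ n) (hs : n ≤ 4 * s) (hℓ : ℓ ≤ sizeBound n) :
    2 ^ (ℓ * gain n) ≤ s.choose ℓ := by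
  rw [mul_comm, pow_mul]
  refine pow_le_choose_of_mul_le Nat.one_le_two_pow ?_
  have := two_pow_gain_mul_le hn
  nlinarith [Nat.mul_le_mul_left (2 ^ gain n) hℓ]

/-- For large n, take eighth powers: 4(n − s) ≥ 3n gives 3^(8(n − s)) ≥ 27^(2n) = 729^n ≥ 2^(9n),
while 8ℓ·gain ≤ n leaves 8L ≥ 7n + O(1) for L = `trialBits`. The exponents 7 + 9 = 16 match exactly.
-/
theorem four_pow_le_of_small {n s ℓ : ℕ} (hsn : s ≤ n) (hs : n ≤ 1024 ∨ 4 * s ≤ n)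
    (hℓ : ℓ ≤ sizeBound n) :
    4 * 4 ^ n ≤ 2 ^ trialBits trialConst n ℓ * 3 ^ (n - s) := by
  have hL := trialBits_add_mul_gain hℓ
  have hg := mul_gain_le hℓ
  rcases le_or_gt n 1024 with hn | hn
  · have h1 : n.size * n.size ≤ 1024 * 1024 := by
      have := Prog.size_le n
      gcongr <;> omega
    rw [trialConst] at hL
    -- For n ≤ 1024 the constant gives L ≥ n + 1026 ≥ 2n + 2.
    calc 4 * 4 ^ n = 2 ^ (2 + 2 * n) := by rw [pow_add, pow_mul]; norm_num
      _ ≤ 2 ^ trialBits trialConst n ℓ := Nat.pow_le_pow_right (by norm_num) (by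
          rw [trialConst]; omega)
      _ ≤ _ := Nat.le_mul_of_pos_right _ (by positivity)
  · have hs : 4 * s ≤ n := by omega
    have h8 := sq_size_le hn.le
    refine (Nat.pow_le_pow_iff_left (n := 4) (by norm_num)).1 ?_
    have h3 : 27 ^ n ≤ (3 ^ (n - s)) ^ 4 := by
      rw [show 27 = 3 ^ 3 by norm_num, ← pow_mul, ← pow_mul]
      exact Nat.pow_le_pow_right (by norm_num) (by omega)
    have h4 : 2 ^ (9 * n) ≤ (27 ^ n) ^ 2 := by
      rw [pow_mul, pow_right_comm 27]
      exact Nat.pow_le_pow_left (by norm_num) _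
    have h5 : 4 * 4 ^ n = 2 ^ (2 + 2 * n) := by rw [pow_add, pow_mul]; norm_num
    refine (Nat.pow_le_pow_iff_left (n := 2) (by norm_num)).1 ?_
    calc ((4 * 4 ^ n) ^ 4) ^ 2 = 2 ^ (16 + 16 * n) := by
          rw [h5, ← pow_mul, ← pow_mul]
          congr 1
          ring
      _ ≤ 2 ^ (8 * trialBits trialConst n ℓ + 9 * n) :=
          Nat.pow_le_pow_right (by norm_num) (by rw [trialConst] at *; omega)
      _ = ((2 ^ trialBits trialConst n ℓ) ^ 4) ^ 2 * 2 ^ (9 * n) := by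
          rw [pow_add, ← pow_mul, ← pow_mul]
          congr 2
          ring
      _ ≤ ((2 ^ trialBits trialConst n ℓ) ^ 4) ^ 2 * ((3 ^ (n - s)) ^ 4) ^ 2 :=
          Nat.mul_le_mul_left _ (h4.trans (Nat.pow_le_pow_left h3 _))
      _ = _ := by rw [mul_pow, mul_pow]

/-! ### The success probability of one trial. -/

namespace Prog

open OracleTM TapeSym
open scoped Classical

theorem toFinset_filter_ground {I : SetInstance} {X : Finset (List Bool)} (hX : X ⊆ I.E) :
    (I.ground.filter (· ∈ X)).toFinset = X := by
  ext a
  simp only [List.mem_toFinset, List.mem_filter, SetInstance.ground, Finset.mem_sort,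
    decide_eq_true_eq]
  exact ⟨fun h => h.2, fun h => ⟨hX h, h⟩⟩

theorem weightedSum_chance (α β : ENNReal) (I : SetInstance) (ℓ : ℕ) :
    weightedSum α β I.ground (I.chance ℓ) = ∑ X ∈ I.E.powerset,
      α ^ X.card * β ^ (I.E.card - X.card) * if ∃ S, I.IsExtension X ℓ S then 1 / 2 else 0 := by
  rw [weightedSum_eq_sum _ _ I.nodup_ground, I.length_ground]
  refine Finset.sum_congr ?_ fun X hX => ?_
  · rw [SetInstance.ground, Finset.sort_toFinset]
  · have hX : X ⊆ I.E := by simpa [SetInstance.ground] using hX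
    rw [SetInstance.chance, toFinset_filter_ground hX]

/-- Every X = S \ D with D ⊆ S and |D| = ℓ has the ℓ-extension D, and distinct D give distinct X.
The last factor 1/2 is the success probability of the extension algorithm. -/
theorem le_weightedSum_half {I : SetInstance} {S : Finset (List Bool)} (hS : S ∈ I.F) (ℓ : ℕ) :
    (S.card.choose ℓ : ENNReal) * ((1 / 2) ^ I.E.card * (1 / 2)) ≤
      weightedSum (1 / 2) (1 / 2) I.ground (I.chance ℓ) := by
  have hSE := I.subset_of_mem S hS
  rw [weightedSum_chance]
  have hinj : Set.InjOn (fun D => S \ D) (S.powersetCard ℓ : Set (Finset (List Bool))) := by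
    intro D hD D' hD' h
    have hD := (Finset.mem_powersetCard.1 hD).1
    have hD' := (Finset.mem_powersetCard.1 hD').1
    rw [← Finset.sdiff_sdiff_eq_self hD, ← Finset.sdiff_sdiff_eq_self hD']
    exact congrArg (S \ ·) h
  calc (S.card.choose ℓ : ENNReal) * ((1 / 2) ^ I.E.card * (1 / 2))
      = ∑ X ∈ (S.powersetCard ℓ).image (fun D => S \ D), (1 / 2) ^ I.E.card * (1 / 2) := by
        rw [Finset.sum_const, Finset.card_image_of_injOn hinj, Finset.card_powersetCard,
          nsmul_eq_mul]
    _ ≤ ∑ X ∈ (S.powersetCard ℓ).image (fun D => S \ D), (1 / 2) ^ X.card *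
        (1 / 2) ^ (I.E.card - X.card) * if ∃ S, I.IsExtension X ℓ S then 1 / 2 else 0 := by
        refine Finset.sum_le_sum fun X hX => ?_
        obtain ⟨D, hD, rfl⟩ := Finset.mem_image.1 hX
        obtain ⟨hDS, hDc⟩ := Finset.mem_powersetCard.1 hD
        have hle : (S \ D).card ≤ I.E.card :=
          Finset.card_le_card (Finset.sdiff_subset.trans hSE)
        rw [if_pos, ← pow_add, Nat.add_sub_cancel' hle]
        refine ⟨D, fun a ha => ?_, ?_, hDc⟩
        · simp [hSE (hDS ha), ha]
        · rwa [Finset.sdiff_union_of_subset hDS]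
    _ ≤ _ := by
        refine Finset.sum_le_sum_of_subset fun X hX => ?_
        obtain ⟨D, hD, rfl⟩ := Finset.mem_image.1 hX
        exact Finset.mem_powerset.2 (Finset.sdiff_subset.trans hSE)

/-- Only the event X = S is counted; the empty set is then a 0-extension. -/
theorem le_weightedSum_quarter {I : SetInstance} {S : Finset (List Bool)} (hS : S ∈ I.F) :
    (1 / 4 : ENNReal) ^ S.card * (3 / 4) ^ (I.E.card - S.card) * (1 / 2) ≤
      weightedSum (1 / 4) (3 / 4) I.ground (I.chance 0) := by
  rw [weightedSum_chance]
  have h : ∃ D, I.IsExtension S 0 D := ⟨∅, by simp, by simpa using hS, rfl⟩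
  refine le_trans (le_of_eq ?_) (Finset.single_le_sum (f := fun X : Finset (List Bool) =>
    (1 / 4 : ENNReal) ^ X.card * (3 / 4) ^ (I.E.card - X.card) *
      if ∃ S, I.IsExtension X 0 S then 1 / 2 else 0) (fun _ _ => zero_le)
    (Finset.mem_powerset.2 (I.subset_of_mem S hS)))
  simp only [if_pos h]

/-- The factor 4 pays for the toss that selects the sampler and for the failures of the extension
algorithm. -/
theorem one_le_mul_half {L x y : ℕ} (hy : 0 < y) {z w : ENNReal}
    (hz : (x : ENNReal) / y * (1 / 2) ≤ z) (hw : z ≤ w) (hxy : 4 * y ≤ 2 ^ L * x) :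
    1 ≤ ((2 ^ L : ℕ) : ENNReal) * (1 / 2 * w) := by
  have hy0 : (y : ENNReal) ≠ 0 := by exact_mod_cast hy.ne'
  have hyt : (y : ENNReal) ≠ ⊤ := ENNReal.natCast_ne_top y
  have h4 : (4 : ENNReal) * y ≤ ((2 ^ L : ℕ) : ENNReal) * x := by exact_mod_cast hxy
  have h5 : (4 : ENNReal) ≤ ((2 ^ L : ℕ) : ENNReal) * (x / y) := by
    rw [← mul_div_assoc]
    exact (ENNReal.le_div_iff_mul_le (.inl hy0) (.inl hyt)).2 h4
  have h22 : (2 : ENNReal) * 2⁻¹ = 1 := ENNReal.mul_inv_cancel (by simp) (by simp)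
  calc (1 : ENNReal) = 4 * (1 / 2 * (1 / 2)) := by
        rw [one_div, show (4 : ENNReal) = 2 * 2 by norm_num, mul_mul_mul_comm, h22, one_mul]
    _ ≤ ((2 ^ L : ℕ) : ENNReal) * (x / y) * (1 / 2 * (1 / 2)) := by gcongr
    _ = ((2 ^ L : ℕ) : ENNReal) * (1 / 2 * (x / y * (1 / 2))) := by ring
    _ ≤ _ := by gcongr; exact hz.trans hw

/-- The algorithm does not know |S|, but every trial tries both samplers with equal probability, so
the one suited to |S| may be used in the estimate. -/
theorem one_le_mul_trialChance {I : SetInstance} (hF : I.F.Nonempty) {ℓ : ℕ}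
    (hℓ : ℓ ≤ sizeBound I.E.card) :
    1 ≤ ((2 ^ trialBits trialConst I.E.card ℓ : ℕ) : ENNReal) * trialChance I ℓ := by
  obtain ⟨S, hS⟩ := hF
  have hSE := Finset.card_le_card (I.subset_of_mem S hS)
  set n := I.E.card with hn
  have hL := trialBits_add_mul_gain hℓ
  have h1 := le_weightedSum_half hS ℓ
  have h2 := le_weightedSum_quarter hS
  rw [← hn] at h1 h2
  rw [trialChance, ENNReal.div_eq_inv_mul, ← one_div]
  by_cases hs : 1024 ≤ n ∧ n ≤ 4 * S.card
  · refine one_le_mul_half (x := S.card.choose ℓ) (y := 2 ^ n) (by positivity) ?_ le_self_add ?_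
    · refine le_trans (le_of_eq ?_) h1
      rw [div_eq_mul_inv, mul_assoc, one_div, ← ENNReal.inv_pow]
      push_cast
      rfl
    · have h3 := two_pow_le_choose hs.1 hs.2 hℓ
      refine Nat.le_of_mul_le_mul_right (c := 2 ^ (ℓ * gain n)) ?_ (by positivity)
      calc 4 * 2 ^ n * 2 ^ (ℓ * gain n) = 2 ^ (n + 2) * 2 ^ (ℓ * gain n) := by ring
        _ ≤ 2 ^ (n + (trialConst + 1)) * S.card.choose ℓ :=
          Nat.mul_le_mul (Nat.pow_le_pow_right (by norm_num) (by rw [trialConst]; omega)) h3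
        _ = _ := by rw [← hL, pow_add]; ring
  · refine one_le_mul_half (x := 3 ^ (n - S.card)) (y := 4 ^ n) (by positivity) ?_ le_add_self
      (four_pow_le_of_small hSE (by omega) hℓ)
    refine le_trans (le_of_eq ?_) h2
    rw [div_eq_mul_inv, one_div, one_div, div_eq_mul_inv, mul_pow, mul_left_comm, ← pow_add,
      Nat.add_sub_cancel' hSE, ← ENNReal.inv_pow]
    push_cast
    rfl

end Prog

end

noncomputable section

/-! ### The running time -/

/-- The time of the trials, up to polynomial factors. -/
def trialWork (g : ℕ → ℕ) (n ℓ : ℕ) : ℕ := 2 ^ trialBits trialConst n ℓ * (g ℓ + g 0 + 1)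

open Classical in
/-- The worst case of `trialWork` over the sizes that an optimizer may suggest. -/
def workBound (g : ℕ → ℕ) (n : ℕ) : ℕ :=
  max 1 (((Finset.range (sizeBound n + 1)).filter (IsBestSize g n)).sup (trialWork g n))

/-- The exponent saved over brute force. -/
def savings (g : ℕ → ℕ) (n : ℕ) : ℝ := n - Real.logb 2 (workBound g n)

theorem one_le_workBound (g : ℕ → ℕ) (n : ℕ) : 1 ≤ workBound g n := le_max_left _ _

theorem trialWork_le_workBound {g : ℕ → ℕ} {n ℓ : ℕ} (h : IsBestSize g n ℓ) :
    trialWork g n ℓ ≤ workBound g n :=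
  le_max_of_le_right (Finset.le_sup (f := trialWork g n)
    (by simpa [Nat.lt_succ_iff] using ⟨h.1, h⟩))

theorem two_rpow_sub_savings (g : ℕ → ℕ) (n : ℕ) :
    (2 : ℝ) ^ ((n : ℝ) - savings g n) = workBound g n := by
  rw [savings, sub_sub_cancel, Real.rpow_logb (by norm_num) (by norm_num)]
  exact_mod_cast one_le_workBound g n

/-- Compare the minimizer k − ℓ with k − ℓ₀, where k = `sizeBound n`. The binomials of k cost at
most 2^k, and replacing C(n, j) by n^j costs at most k^k; finally n^k is cancelled. -/
theorem IsBestSize.mul_pow_le {g : ℕ → ℕ} {n ℓ ℓ₀ : ℕ} (hn : 1 ≤ n) (h : IsBestSize g n ℓ)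
    (h₀ : ℓ₀ ≤ sizeBound n) :
    g ℓ * n ^ ℓ₀ ≤ 2 ^ sizeBound n * sizeBound n ^ sizeBound n * g ℓ₀ * n ^ ℓ := by
  obtain ⟨hℓ, -, h⟩ := h
  have hkn : sizeBound n ≤ n := (sizeBound_le n).trans (Prog.size_le n)
  set k := sizeBound n
  have h1 := h (k - ℓ₀) (Nat.sub_le _ _)
  rw [Nat.sub_sub_self hℓ, Nat.sub_sub_self h₀] at h1
  have hc1 : 0 < k.choose (k - ℓ) := Nat.choose_pos (Nat.sub_le _ _)
  have hc2 : 0 < k.choose (k - ℓ₀) := Nat.choose_pos (Nat.sub_le _ _)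
  have h2 : n.choose (k - ℓ) * g ℓ * k.choose (k - ℓ₀) ≤
      n.choose (k - ℓ₀) * g ℓ₀ * k.choose (k - ℓ) := by
    rw [div_mul_eq_mul_div, div_mul_eq_mul_div, div_le_div_iff₀ (by exact_mod_cast hc1)
      (by exact_mod_cast hc2)] at h1
    exact_mod_cast h1
  have h3 : n.choose (k - ℓ) * g ℓ ≤ n ^ (k - ℓ₀) * g ℓ₀ * 2 ^ k := calc
    _ ≤ n.choose (k - ℓ) * g ℓ * k.choose (k - ℓ₀) := Nat.le_mul_of_pos_right _ hc2
    _ ≤ _ := h2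
    _ ≤ _ := by
      gcongr
      · exact Nat.choose_le_pow _ _
      · exact Nat.choose_le_two_pow _ _
  have h4 : (k - ℓ) ^ (k - ℓ) ≤ k ^ k := by
    obtain hk | hk := Nat.eq_zero_or_pos k
    · simp [hk]
    · exact (Nat.pow_le_pow_left (Nat.sub_le _ _) _).trans
        (Nat.pow_le_pow_right hk (Nat.sub_le _ _))
  have h5 : n ^ (k - ℓ) * g ℓ ≤ n ^ (k - ℓ₀) * g ℓ₀ * 2 ^ k * k ^ k := calc
    _ ≤ n.choose (k - ℓ) * (k - ℓ) ^ (k - ℓ) * g ℓ :=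
      Nat.mul_le_mul_right _ (pow_le_choose_mul_pow (by omega))
    _ = n.choose (k - ℓ) * g ℓ * (k - ℓ) ^ (k - ℓ) := by ring
    _ ≤ _ := Nat.mul_le_mul h3 h4
  refine Nat.le_of_mul_le_mul_right (c := n ^ k) ?_ (by positivity)
  calc g ℓ * n ^ ℓ₀ * n ^ k = n ^ (k - ℓ) * g ℓ * (n ^ ℓ * n ^ ℓ₀) := by
        rw [show n ^ k = n ^ (k - ℓ) * n ^ ℓ by rw [← pow_add, Nat.sub_add_cancel hℓ]]
        ring
    _ ≤ n ^ (k - ℓ₀) * g ℓ₀ * 2 ^ k * k ^ k * (n ^ ℓ * n ^ ℓ₀) := Nat.mul_le_mul_right _ h5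
    _ = _ := by
        rw [show n ^ k = n ^ (k - ℓ₀) * n ^ ℓ₀ by rw [← pow_add, Nat.sub_add_cancel h₀]]
        ring

/-- The exponent collects all losses: k from binomials, k² from k^k, and k² + 3k from the gap
between `gain` and log n. It is polynomial in log log n, hence below log n. -/
theorem two_pow_sizeBound_le {n : ℕ} (hk : 10 ≤ sizeBound n) :
    2 ^ (2 * (sizeBound n * sizeBound n) + 4 * sizeBound n) ≤ n := by
  have h1 : 2 ^ (sizeBound n - 1) ≤ n.size := Nat.lt_size.1 (show _ < sizeBound n by omega)
  have key : ∀ k, 10 ≤ k → 2 * (k * k) + 4 * k + 1 ≤ 2 ^ (k - 1) := by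
    intro k hk
    induction k, hk using Nat.le_induction with
    | base => norm_num
    | succ k hk ih =>
      obtain ⟨k, rfl⟩ : ∃ j, k = j + 1 := ⟨k - 1, by omega⟩
      simp only [Nat.add_sub_cancel, pow_succ] at ih ⊢
      nlinarith
  have h2 := key _ hk
  exact Nat.lt_size.1 (by omega)

theorem trialWork_mul_pow_le {g : ℕ → ℕ} (hg : ∀ ℓ, 1 ≤ g ℓ) {n ℓ ℓ₀ : ℕ}
    (hk : 10 ≤ sizeBound n) (h : IsBestSize g n ℓ) (h₀ : ℓ₀ ≤ sizeBound n) :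
    trialWork g n ℓ * n ^ ℓ₀ ≤ 2 ^ n * n * (2 ^ (trialConst + 1) * g ℓ₀ * (g 0 + 2)) := by
  have hn : 1 ≤ n := le_trans Nat.one_le_two_pow (two_pow_sizeBound_le hk)
  have h1 := h.mul_pow_le hn h₀
  have h2 := two_pow_sizeBound_le hk
  have hL := trialBits_add_mul_gain h.1
  have hgn : n.size ≤ gain n + (sizeBound n + 3) := by rw [gain]; omega
  have hℓ := h.1
  set k := sizeBound n
  set L := trialBits trialConst n ℓ
  have h3 : g ℓ + g 0 + 1 ≤ g ℓ * (g 0 + 2) := by nlinarith [hg ℓ]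
  -- Each of the ℓ ≤ k factors n exceeds 2^gain by at most k + 3 bits.
  have h4 : n ^ ℓ ≤ 2 ^ (ℓ * gain n) * 2 ^ ((k + 3) * k) := calc
    n ^ ℓ ≤ (2 ^ n.size) ^ ℓ := Nat.pow_le_pow_left n.lt_size_self.le _
    _ = 2 ^ (n.size * ℓ) := (pow_mul _ _ _).symm
    _ ≤ 2 ^ (ℓ * gain n + (k + 3) * k) := Nat.pow_le_pow_right (by norm_num) (by nlinarith)
    _ = _ := pow_add _ _ _
  have h5 : k ^ k ≤ 2 ^ (k * k) := by
    rw [pow_mul]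
    exact Nat.pow_le_pow_left Nat.lt_two_pow_self.le _
  rw [trialWork]
  calc 2 ^ L * (g ℓ + g 0 + 1) * n ^ ℓ₀ ≤ 2 ^ L * (g ℓ * (g 0 + 2)) * n ^ ℓ₀ := by gcongr
    _ = 2 ^ L * (g 0 + 2) * (g ℓ * n ^ ℓ₀) := by ring
    _ ≤ 2 ^ L * (g 0 + 2) * (2 ^ k * 2 ^ (k * k) * g ℓ₀ *
        (2 ^ (ℓ * gain n) * 2 ^ ((k + 3) * k))) := by
      refine Nat.mul_le_mul_left _ (h1.trans ?_)
      gcongr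
    _ = 2 ^ (L + ℓ * gain n) * 2 ^ (2 * (k * k) + 4 * k) * (g ℓ₀ * (g 0 + 2)) := by
      ring
    _ ≤ 2 ^ (L + ℓ * gain n) * n * (g ℓ₀ * (g 0 + 2)) := by gcongr
    _ = _ := by rw [hL, pow_add]; ring

theorem workBound_mul_pow_le {g : ℕ → ℕ} (hg : ∀ ℓ, 1 ≤ g ℓ) {n ℓ₀ : ℕ}
    (hk : 10 ≤ sizeBound n) (h₀ : ℓ₀ ≤ sizeBound n) :
    workBound g n * n ^ ℓ₀ ≤ 2 ^ n * n * (2 ^ (trialConst + 1) * g ℓ₀ * (g 0 + 2)) := by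
  classical
  have h2 := two_pow_sizeBound_le hk
  have hn : 1024 ≤ n := calc
    1024 = 2 ^ 10 := by norm_num
    _ ≤ 2 ^ (2 * (sizeBound n * sizeBound n) + 4 * sizeBound n) :=
      Nat.pow_le_pow_right (by norm_num) (by omega)
    _ ≤ n := h2
  rw [workBound]
  obtain h | h := max_choice 1
    (((Finset.range (sizeBound n + 1)).filter (IsBestSize g n)).sup (trialWork g n))
  · rw [h, one_mul]
    have h3 : n ^ ℓ₀ ≤ 2 ^ n := calc
      n ^ ℓ₀ ≤ (2 ^ n.size) ^ ℓ₀ := Nat.pow_le_pow_left n.lt_size_self.le _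
      _ = 2 ^ (n.size * ℓ₀) := (pow_mul _ _ _).symm
      _ ≤ 2 ^ n := Nat.pow_le_pow_right (by norm_num) (by
        nlinarith [sq_size_le hn, Nat.mul_le_mul_left n.size (h₀.trans (sizeBound_le n))])
    have h4 : 1 ≤ 2 ^ (trialConst + 1) * g ℓ₀ * (g 0 + 2) :=
      Nat.mul_pos (Nat.mul_pos (by positivity) (hg _)) (by omega)
    rw [mul_assoc]
    exact h3.trans (Nat.le_mul_of_pos_right _ (Nat.mul_pos (by omega) h4))
  · rw [h]
    obtain h0 | ⟨ℓ, hℓ, h0⟩ := Finset.eq_empty_or_nonempty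
      ((Finset.range (sizeBound n + 1)).filter (IsBestSize g n)) |>.imp_right
        fun hne => Finset.exists_mem_eq_sup _ hne (trialWork g n)
    · simp [h0]
    · rw [h0]
      exact trialWork_mul_pow_le hg hk (Finset.mem_filter.1 hℓ).2 h₀

/-! ### Growth faster than the logarithm. -/

theorem eventually_le_sizeBound (K : ℕ) : ∀ᶠ n in atTop, K ≤ sizeBound n := by
  filter_upwards [eventually_ge_atTop (2 ^ 2 ^ K)] with n hn
  exact (Nat.lt_size.2 (Nat.lt_size.2 hn).le).le

theorem tendsto_logb_two : Tendsto (fun n : ℕ => Real.logb 2 (n : ℝ)) atTop atTop :=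
  (Real.tendsto_logb_atTop (by norm_num)).comp tendsto_natCast_atTop_atTop

/-- For a target slope b, the hypothesis is used with ⌈b⌉ + 1; the surplus log n absorbs C. -/
theorem isOmegaLog_of_le {f : ℕ → ℝ}
    (h : ∀ K : ℕ, ∃ C : ℝ, ∀ᶠ n : ℕ in atTop, (K : ℝ) * Real.logb 2 n - C ≤ f n) :
    IsOmegaLog f := by
  refine tendsto_atTop.2 fun b => ?_
  obtain ⟨C, hC⟩ := h (⌈b⌉₊ + 1)
  filter_upwards [hC, tendsto_logb_two.eventually_ge_atTop (max C 1)] with n h1 h2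
  have h3 : C ≤ Real.logb 2 n := (le_max_left _ _).trans h2
  have h4 : 1 ≤ Real.logb 2 (n : ℝ) := (le_max_right _ _).trans h2
  rw [le_div_iff₀ (by linarith)]
  push_cast at h1
  nlinarith [Nat.le_ceil b]

theorem isOmegaLog_Phi (g : ℕ → ℕ) : IsOmegaLog (Phi g) := by
  refine isOmegaLog_of_le fun K => ?_
  refine ⟨K * Real.logb 2 (4 * K) + Real.logb 2 (g K), ?_⟩
  filter_upwards [eventually_ge_atTop (4 * K + 1)] with n hn
  have h1 : (K : ℝ) * Real.logb 2 ((n : ℝ) / (4 * (K : ℝ))) - Real.logb 2 (g K : ℝ) ≤ Phi g n :=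
    Finset.le_sup' (fun ℓ : ℕ => (ℓ : ℝ) * Real.logb 2 ((n : ℝ) / (4 * (ℓ : ℝ))) -
      Real.logb 2 (g ℓ : ℝ)) (Finset.mem_range.2 (by omega))
  refine le_trans (le_of_eq ?_) h1
  obtain rfl | hK := Nat.eq_zero_or_pos K
  · simp
  · have hK' : (0 : ℝ) < K := by exact_mod_cast hK
    have hn' : (n : ℝ) ≠ 0 := by
      have : n ≠ 0 := by omega
      exact_mod_cast this
    rw [Real.logb_div hn' (by positivity)]
    ring

/-- The comparison is with ℓ₀ = K + 1, because one factor n is lost. The constant C depends on g and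
K, but not on n. -/
theorem isOmegaLog_savings {g : ℕ → ℕ} (hg : ∀ ℓ, 1 ≤ g ℓ) : IsOmegaLog (savings g) := by
  refine isOmegaLog_of_le fun K => ?_
  obtain ⟨C, hC0, hC⟩ : ∃ C : ℕ, 0 < C ∧ ∀ n, 10 ≤ sizeBound n → K + 1 ≤ sizeBound n →
      workBound g n * n ^ (K + 1) ≤ 2 ^ n * n * C :=
    ⟨_, Nat.mul_pos (Nat.mul_pos (pow_pos two_pos _) (hg _)) (Nat.succ_pos _),
      fun n => workBound_mul_pow_le hg⟩
  refine ⟨Real.logb 2 C, ?_⟩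
  filter_upwards [eventually_le_sizeBound 10, eventually_le_sizeBound (K + 1),
    eventually_ge_atTop 1] with n h1 h2 h3
  have h4 := hC n h1 h2
  have hn : (0 : ℝ) < n := by exact_mod_cast h3
  have hW : (0 : ℝ) < workBound g n := by exact_mod_cast one_le_workBound g n
  have hC' : (0 : ℝ) < C := by exact_mod_cast hC0
  have h5 : (workBound g n : ℝ) * (n : ℝ) ^ (K + 1) ≤ 2 ^ n * n * C := by exact_mod_cast h4
  have h6 := Real.logb_le_logb_of_le (b := 2) (by norm_num) (by positivity) h5
  rw [Real.logb_mul hW.ne' (by positivity), Real.logb_mul (by positivity) hC'.ne',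
    Real.logb_mul (by positivity) hn.ne', Real.logb_pow, Real.logb_pow,
    Real.logb_self_eq_one (by norm_num)] at h6
  rw [savings]
  push_cast at h6
  linarith

/-- Eventually 2^f(n) ≥ n^(c + 1), and the surplus factor n beats 1/ε. -/
theorem IsOmegaLog.isLittleO {f : ℕ → ℝ} (hf : IsOmegaLog f) (c : ℕ) :
    (fun n : ℕ => (2 : ℝ) ^ ((n : ℝ) - f n)) =o[atTop]
      (fun n : ℕ => (2 : ℝ) ^ (n : ℝ) / (n : ℝ) ^ c) := by
  refine Asymptotics.isLittleO_iff.2 fun ε hε => ?_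
  filter_upwards [hf.eventually_ge_atTop ((c : ℝ) + 1), tendsto_logb_two.eventually_gt_atTop 0,
    eventually_ge_atTop 1, tendsto_natCast_atTop_atTop.eventually_ge_atTop (1 / ε)]
    with n h1 h2 h3 h4
  rw [le_div_iff₀ h2] at h1
  have hn : (0 : ℝ) < n := by exact_mod_cast h3
  rw [Real.norm_of_nonneg (by positivity), Real.norm_of_nonneg (by positivity)]
  have h5 : (2 : ℝ) ^ (Real.logb 2 n) = n := Real.rpow_logb (by norm_num) (by norm_num) hn
  have h6 : (n : ℝ) ^ (c + 1) ≤ 2 ^ f n := calc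
    (n : ℝ) ^ (c + 1) = (2 : ℝ) ^ (Real.logb 2 n * ((c + 1 : ℕ) : ℝ)) := by
      rw [Real.rpow_mul (by norm_num), h5, Real.rpow_natCast]
    _ ≤ 2 ^ f n := by
      refine Real.rpow_le_rpow_of_exponent_le (by norm_num) ?_
      push_cast
      linarith
  rw [Real.rpow_sub (by norm_num), ← mul_div_assoc, div_le_div_iff₀ (by positivity) (by positivity)]
  have h7 : 1 ≤ ε * n := by
    rw [div_le_iff₀ hε] at h4
    linarith
  calc (2 : ℝ) ^ (n : ℝ) * (n : ℝ) ^ c ≤ 2 ^ (n : ℝ) * ((n : ℝ) ^ c * (ε * n)) := by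
        gcongr
        exact le_mul_of_one_le_right (by positivity) h7
    _ = ε * 2 ^ (n : ℝ) * (n : ℝ) ^ (c + 1) := by ring
    _ ≤ _ := by gcongr

end

noncomputable section

/-! ### The main theorem -/

namespace Prog

open OracleTM TapeSym
open scoped Classical

theorem OnStacks.exists_post {W : Type} [Finite W] {P : Prog W} {O : Set (List TapeSym)} {T : ℕ}
    {s : Stacks W} {Q : Stacks W → Prop} {φ : Stacks W → ENNReal} {r : ENNReal}
    (h : P.OnStacks O T s Q φ r) : ∃ s', Q s' := by
  obtain ⟨h, -⟩ := OracleTM.Reaches.run h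
  obtain ⟨c, hc⟩ := PMF.support_nonempty (P.toTM.run O T ⟨P.start, s.lift⟩)
  obtain ⟨-, s', hs', -⟩ := h c hc
  exact ⟨s', hs'⟩

/-- Applied to the machine that lists the ground set, this bounds |E| by a polynomial in |B|. The
length bound is already part of the specification of `callSub`, and some run always exists. -/
theorem exists_length_le {M : OracleTM} {O : Set (List TapeSym)} {w : List TapeSym} {T : ℕ}
    {R : List TapeSym → Prop} (h : M.Surely O w T R) : ∃ v, R v ∧ v.length ≤ w.length + T + 1 := by
  have := M.finite_work
  obtain ⟨-, v, hv, hl, -⟩ := (onStacks_callSub (X := M.Work) { arg := w.reverse } (κ := id)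
    Function.injective_id (answer_self O) h (A := fun _ => False) rfl rfl (φ := fun _ => 0) (ρ := 0)
    (σ := 0) (by simp) (by simp)).exists_post
  exact ⟨v, hv, hl⟩

variable {X : Type} [Finite X]

theorem toTM_init (P : Prog (Var ⊕ X)) (w : List TapeSym) :
    P.toTM.init w = ⟨P.start, ({ inp := w } : Mem).st.lift⟩ := by
  have h : (P.toTM.init w).tape = ({ inp := w } : Mem).st.lift := by
    funext i
    rcases i with _ | _ | _ | ((_ | _) | _) <;> rfl
  rw [← h]
  rfl

theorem OnStacks.surely {P : Prog (Var ⊕ X)} {O : Set (List TapeSym)} {T : ℕ} {w : List TapeSym}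
    {Q : Stacks (Var ⊕ X) → Prop} {φ : Stacks (Var ⊕ X) → ENNReal} {r : ENNReal}
    (h : P.OnStacks O T ({ inp := w } : Mem).st Q φ r) {R : List TapeSym → Prop}
    (hR : ∀ s, Q s → R (s .output)) : P.toTM.Surely O w T R := by
  obtain ⟨h, -⟩ := OracleTM.Reaches.run h
  rw [OracleTM.Surely, toTM_init]
  intro c hc
  obtain ⟨hh, s, hs, hτ⟩ := h c hc
  exact ⟨hh, s .output, congrFun hτ _, hR s hs⟩

theorem OnStacks.le_prob {P : Prog (Var ⊕ X)} {O : Set (List TapeSym)} {T : ℕ} {w : List TapeSym}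
    {Q : Stacks (Var ⊕ X) → Prop} {r : ENNReal}
    (h : P.OnStacks O T ({ inp := w } : Mem).st Q success r) :
    r ≤ P.toTM.prob O w T (fun v => v = yes) := by
  obtain ⟨h, hr⟩ := OracleTM.Reaches.run h
  rw [prob_eq_expect, toTM_init]
  refine hr.trans (le_expect_of_support fun c hc => ?_)
  obtain ⟨hh, s, hs, hτ⟩ := h c hc
  simp only [hτ, Stacks.unlift_lift, success]
  split_ifs with ho
  · rw [Set.indicator_of_mem]
    · exact le_rfl
    · exact ⟨hh, yes, (congrFun hτ _).trans (congrArg tapeOf ho), rfl⟩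
  · exact zero_le

theorem isRandomizedAlgorithm {g : ℕ → ℕ} {P : ImplicitSetProblem} {M₁ M₂ M₃ : OracleTM}
    {p₁ p₂ p₃ : Polynomial ℕ}
    (h₁ : ∀ I ∈ P, M₁.Surely I.oracleWords (ofBits I.B) (p₁.eval I.B.length)
      (fun v => v = ofSet I.E))
    (h₂ : ∀ n k : ℕ, k ≤ n → M₂.Surely ∅ (unary n ++ semi :: unary k) (p₂.eval n)
      (fun v => ∃ t, IsArgmin g n k t ∧ v = unary t))
    (h₃ : ∀ I ∈ P, ∀ ℓ, I.Extends M₃ ℓ (g ℓ * p₃.eval I.B.length)) :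
    ∃ (M : OracleTM) (p : Polynomial ℕ), P.IsRandomizedAlgorithm
      (fun I => (2 : ℝ) ^ ((I.E.card : ℝ) - savings g I.E.card) *
        ((p.eval I.B.length : ℕ) : ℝ)) M := by
  have := M₁.finite_work
  have := M₂.finite_work
  have := M₃.finite_work
  let A : Prog (Var ⊕ (M₁.Work ⊕ M₂.Work ⊕ M₃.Work)) :=
    algorithm trialConst M₁ M₂ M₃ .inl (.inr ∘ .inl) (.inr ∘ .inr)
  let d : Polynomial ℕ := .X + p₁ + 1
  let p : Polynomial ℕ := 60 * (.X + 2 * d + p₃) + 14 * (d + .C (trialConst + 1)) + 321 +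
    600 * (d * d + p₂.comp d + .C (trialConst + 1))
  refine ⟨A.toTM, p, fun I hI => ?_⟩
  set n := I.E.card with hn
  set B := I.B.length with hB
  set D := B + p₁.eval B + 1 with hD
  set Z := 60 * (B + 2 * D + p₃.eval B) + 14 * (D + (trialConst + 1)) + 320 with hZ
  have hp : p.eval B = Z + 1 + 600 * (D * D + p₂.eval D + (trialConst + 1)) := by
    simp only [p, d, Polynomial.eval_add, Polynomial.eval_mul, Polynomial.eval_X,
      Polynomial.eval_C, Polynomial.eval_comp, Polynomial.eval_one, Polynomial.eval_ofNat, hZ, hD]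
    ring
  have hnD : n ≤ D := by
    obtain ⟨v, rfl, hv⟩ := exists_length_le (h₁ I hI)
    rw [hn, ← I.length_ground]
    exact (length_le_length_encode _).trans (hv.trans (by simp [ofBits, hD, hB]))
  have hkn : sizeBound n ≤ n := (sizeBound_le n).trans (size_le n)
  have hT : ∀ ℓ, IsBestSize g n ℓ → 2 ^ trialBits trialConst n ℓ *
      (60 * (B + (B + p₁.eval B + 1) + ℓ + g ℓ * p₃.eval B + g 0 * p₃.eval B) +
        14 * trialBits trialConst n ℓ + 320) + 1 ≤ workBound g n * Z + 1 := by
    intro ℓ hℓ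
    have hL : trialBits trialConst n ℓ ≤ D + (trialConst + 1) := by
      have := trialBits_add_mul_gain hℓ.1
      omega
    have hℓ' : ℓ ≤ D := hℓ.1.trans (hkn.trans hnD)
    refine Nat.add_le_add_right (le_trans ?_
      (Nat.mul_le_mul_right Z (trialWork_le_workBound hℓ))) 1
    rw [trialWork, mul_assoc, ← hD]
    refine Nat.mul_le_mul_left _ ?_
    calc 60 * (B + D + ℓ + g ℓ * p₃.eval B + g 0 * p₃.eval B) +
          14 * trialBits trialConst n ℓ + 320
        ≤ 60 * (B + D + D + g ℓ * p₃.eval B + g 0 * p₃.eval B) +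
          14 * (D + (trialConst + 1)) + 320 := by gcongr
      -- The two calls of the extension algorithm are paid by g ℓ + g 0; the cost of a trial that
      -- does not involve g is paid by the 1 in `trialWork`.
      _ ≤ (g ℓ + g 0) * Z + Z := by
          have h1 : 60 * p₃.eval B ≤ Z := by omega
          have h2 := Nat.mul_le_mul_left (g ℓ + g 0) h1
          have h3 : 60 * (B + D + D) + 14 * (D + (trialConst + 1)) + 320 ≤ Z := by omega
          linarith
      _ = _ := by ring
  let r : ENNReal := if I.F.Nonempty then 1 / 2 else 0
  have hA : A.OnStacks I.oracleWords (setupTime trialConst B (p₁.eval B) (p₂.eval n) +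
      (workBound g n * Z + 1)) ({ inp := ofBits I.B } : Mem).st (Sound I) success r := by
    refine onStacks_algorithm Sum.inl_injective (Sum.inr_injective.comp Sum.inl_injective)
      (Sum.inr_injective.comp Sum.inr_injective) hn.symm (h₁ I hI) (h₂ n _ hkn) (h₃ I hI)
      (fun ℓ hℓ => one_le_trialBits hℓ.1) hT fun ℓ hℓ => ?_
    by_cases hF : I.F.Nonempty
    · rw [show r = 1 / 2 from if_pos hF]
      exact half_le_amplified (trialChance_le_one I ℓ) (one_le_mul_trialChance hF hℓ.1)
    · rw [show r = 0 from if_neg hF]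
      exact zero_le
  refine ⟨_, ?_, hA.surely ?_, fun hF => ?_, fun hF => hA.surely ?_⟩
  · beta_reduce
    rw [two_rpow_sub_savings]
    have h : setupTime trialConst B (p₁.eval B) (p₂.eval n) + (workBound g n * Z + 1) ≤
        workBound g n * p.eval B := by
      have h1 : p₂.eval n ≤ p₂.eval D := by
        rw [Polynomial.eval_eq_sum, Polynomial.eval_eq_sum]
        exact Finset.sum_le_sum fun i _ => Nat.mul_le_mul_left _ (Nat.pow_le_pow_left hnD i)
      have h2 := one_le_workBound g n
      have h3 : setupTime trialConst B (p₁.eval B) (p₂.eval n) + 1 ≤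
          1 + 600 * (D * D + p₂.eval D + (trialConst + 1)) := by
        rw [setupTime, ← hD]
        omega
      have h4 : p.eval B = Z + (1 + 600 * (D * D + p₂.eval D + (trialConst + 1))) := by
        rw [hp, add_assoc]
      have h5 := h3.trans (Nat.le_mul_of_pos_left _ h2)
      rw [h4, mul_add _ Z, add_left_comm]
      exact Nat.add_le_add_left h5 _
    exact_mod_cast h
  · rintro s (h | ⟨-, h⟩)
    · exact .inr h
    · exact .inl h
  · have h := hA.le_prob
    rwa [show r = 1 / 2 from if_pos hF] at h
  · rintro s (h | ⟨h, -⟩)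
    · exact h
    · exact absurd hF h.ne_empty

theorem ofSet_eq_nil {S : Finset (List Bool)} (h : ofSet S = []) : S = ∅ := by
  by_contra hS
  obtain ⟨a, ha⟩ := Finset.nonempty_iff_ne_empty.2 hS
  rw [ofSet, List.flatMap_eq_nil_iff] at h
  simpa using h a ((Finset.mem_sort _).2 ha)

/-- If g ℓ = 0, the machine halts in its start state, hence on every input, with blank output. The
blank word encodes the empty set, which is neither `bot` nor a 1-extension. -/
theorem one_le_of_isExtensionAlgorithm {g : ℕ → ℕ} {P : ImplicitSetProblem} {M : OracleTM}
    (h : P.IsExtensionAlgorithm g M) {I : SetInstance} (hI : I ∈ P) (ℓ : ℕ) : 1 ≤ g ℓ := by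
  obtain ⟨p, h⟩ := h
  by_contra hg
  have hstart (w : List TapeSym) : M.Halted (M.init w) := by
    change M.kind M.start = .halt
    have h0 := (h I hI ∅ (Finset.empty_subset _) ℓ).1
    rw [show g ℓ = 0 by omega, zero_mul] at h0
    exact (h0 _ ((PMF.mem_support_pure_iff _ _).2 rfl)).1
  have h1 := (h I hI ∅ (Finset.empty_subset _) 1).1
  rw [OracleTM.Surely, run_of_halted (hstart _)] at h1
  obtain ⟨-, v, hv, h2⟩ := h1 _ ((PMF.mem_support_pure_iff _ _).2 rfl)
  obtain rfl : [] = v := tapeOf_injective hv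
  obtain h2 | ⟨S, hS, h2⟩ := h2
  · simp [bot] at h2
  · have := hS.2.2
    simp [ofSet_eq_nil h2.symm] at this

end Prog

end

theorem mainTheorem9 :
    (∀ g : ℕ → ℕ, IsOmegaLog (Phi g)) ∧
    (∀ g : ℕ → ℕ, Optimizable g →
      ∃ f : ℕ → ℝ, IsOmegaLog f ∧
        (∀ c : ℕ, (fun n : ℕ => (2 : ℝ) ^ ((n : ℝ) - f n)) =o[atTop]
          (fun n : ℕ => (2 : ℝ) ^ (n : ℝ) / (n : ℝ) ^ c)) ∧
        ∀ P : ImplicitSetProblem, P.PolyTimeComputable →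
          (∃ M : OracleTM, P.IsExtensionAlgorithm g M) →
          ∃ (M : OracleTM) (p : Polynomial ℕ),
            P.IsRandomizedAlgorithm
              (fun I => (2 : ℝ) ^ ((I.E.card : ℝ) - f I.E.card) *
                ((p.eval I.B.length : ℕ) : ℝ)) M) := by
  refine ⟨isOmegaLog_Phi, ?_⟩
  rintro g ⟨M₂, p₂, -, h₂⟩
  by_cases hg : ∀ ℓ, 1 ≤ g ℓ
  · have hf := isOmegaLog_savings hg
    refine ⟨savings g, hf, hf.isLittleO, ?_⟩
    rintro P ⟨⟨M₁, p₁, -, h₁⟩, -⟩ ⟨M₃, p₃, h₃⟩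
    exact Prog.isRandomizedAlgorithm h₁ h₂ fun I hI ℓ X hX => h₃ I hI X hX ℓ
  -- Here `P` has no instances, so any ω(log n) function and any machine will do.
  · have hf := isOmegaLog_Phi g
    refine ⟨Phi g, hf, hf.isLittleO, ?_⟩
    rintro P - ⟨M, hM⟩
    exact ⟨M, 0, fun I hI => absurd (fun ℓ => Prog.one_le_of_isExtensionAlgorithm hM hI ℓ) hg⟩
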